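/- **Conventions.** Compactify $\mathbb H^3$ by the Riemann sphere $\widehat{\mathbb C}$ in the usual way. For $\alpha>0$ let $\mathbb H^3_\alpha$ be the metric completion of the quotient of $\{(r,\theta,z): r>0,\ \theta,z\in\mathbb R\}$, with the metric $dr^2+\sinh^2 r\,d\theta^2+\cosh^2 r\,dz^2$, by $(r,\theta,z)\mapsto(r,\theta+\alpha,z)$. A *3-dimensional hyperbolic cone-manifold* is a compact 3-manifold $N$ with boundary together with a complete length metric on $\operatorname{int}N$ such that every point of $\operatorname{int}N$ has a neighborhood isometric to a neighborhood of a point of $\mathbb H^3_\alpha$ for some $\alpha>0$ (which may depend on the point). Its *non-singular part* $M$ is the set of points of $\operatorname{int} N$ having a neighborhood isometric to a neighborhood of a point of $\mathbb H^3$. A *chart at infinity* is a homeomorphism $c:V\to c(V)$ from an open subset $V$ of $N$ onto an open subset of $\mathbb H^3\cup\widehat{\mathbb C}$ that takes $V\cap\operatorname{int}N$ into $\mathbb H^3$ by a local isometry and $V\cap\partial N$ into $\widehat{\mathbb C}$. A *projective boundary* $\Sigma$ of $M$ is a set of points of $\partial N$ covered by an atlas of charts at infinity whose coordinate changes, restricted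 to the boundary, are locally elements of $PSL_2(\mathbb C)$; thus $\Sigma$ has a complex projective structure. (For a geometrically finite cone-manifold, $\Sigma$ may be all the components of $\partial N$ that are not tori.) A *round disk in $\Sigma$* is a projective map $\phi:D\to\Sigma$, where $D\subset\widehat{\mathbb C}$ is an open round disk, that is, $\phi$ is given in charts locally by elements of $PSL_2(\mathbb C)$; $\phi$ need not be injective. Let $H_D\subset\mathbb H^3$ be the open half-space bounded by $D$. A *half-space in $M$ extending $\phi$* is a local isometry $F:H_D\to M$ such that $F\cup\phi: H_D\cup D\to N$ is continuous. The disk $\phi$ is *embedded* if it is injective, and the half-space $F$ is *embedded* if $F$ is a topological embedding. **Lemma 4.3.** Let $M$ be the non-singular part of a 3-dimensional hyperbolic cone-manifold with projective boundary $\Sigma$. Then every round disk in $\Sigma$ extends to a half-space in $M$. If the round disk is embedded, then every half-space in $M$ extending it is embedded. -/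

import Mathlib

open Set Filter Topology
open scoped Manifold NNReal ENNReal

noncomputable section

namespace ConeManifold

/-! ### Hyperbolic 3-space and its compactification by the Riemann sphere -/

/-- Hyperbolic 3-space, in the upper half-space model: pairs `(z, t)` with `z` complex, `t > 0`. -/
@[ext]
structure Hyp3 where
  z : ℂ
  t : ℝ
  t_pos : 0 < t

namespace Hyp3

/-- The underlying point of Euclidean 3-space. -/
def toE (p : Hyp3) : WithLp 2 (ℂ × ℝ) := WithLp.toLp 2 (p.z, p.t)

/-- The mirror image in the boundary plane. -/
def mirror (p : Hyp3) : WithLp 2 (ℂ × ℝ) := WithLp.toLp 2 (p.z, -p.t)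

/-- The hyperbolic distance (same formula as for Mathlib's upper half-plane); equivalently
`cosh d = 1 + |p - q|² / (2 t(p) t(q))` with the Euclidean norm, see `cosh_dist`. -/
instance : Dist Hyp3 :=
  ⟨fun p q => 2 * Real.arsinh (dist p.toE q.toE / (2 * √(p.t * q.t)))⟩

theorem dist_eq (p q : Hyp3) :
    dist p q = 2 * Real.arsinh (dist p.toE q.toE / (2 * √(p.t * q.t))) := rfl

theorem toE_dist_sq (p q : Hyp3) :
    dist p.toE q.toE ^ 2 = ‖p.z - q.z‖ ^ 2 + (p.t - q.t) ^ 2 := by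
  rw [WithLp.prod_dist_eq_of_L2, Real.sq_sqrt (by positivity)]
  simp [toE, dist_eq_norm]

theorem mirror_dist_sq (p q : Hyp3) :
    dist p.toE q.mirror ^ 2 = ‖p.z - q.z‖ ^ 2 + (p.t + q.t) ^ 2 := by
  rw [WithLp.prod_dist_eq_of_L2, Real.sq_sqrt (by positivity)]
  simp [toE, mirror, dist_eq_norm]

theorem sinh_half_dist (p q : Hyp3) :
    Real.sinh (dist p q / 2) = dist p.toE q.toE / (2 * √(p.t * q.t)) := by
  rw [dist_eq, mul_div_cancel_left₀ _ two_ne_zero, Real.sinh_arsinh]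

theorem cosh_half_dist (p q : Hyp3) :
    Real.cosh (dist p q / 2) = dist p.toE q.mirror / (2 * √(p.t * q.t)) := by
  have hp := p.t_pos
  have hq := q.t_pos
  have hpq : 0 < p.t * q.t := mul_pos hp hq
  rw [← sq_eq_sq₀ (by positivity) (by positivity), Real.cosh_sq', sinh_half_dist, div_pow, div_pow,
    mirror_dist_sq, toE_dist_sq, mul_pow, Real.sq_sqrt hpq.le]
  field_simp
  ring

theorem cosh_dist (p q : Hyp3) :
    Real.cosh (dist p q) = 1 + (‖p.z - q.z‖ ^ 2 + (p.t - q.t) ^ 2) / (2 * p.t * q.t) := by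
  have hp := p.t_pos
  have hq := q.t_pos
  have hpq : 0 < p.t * q.t := mul_pos hp hq
  have h : dist p q = 2 * (dist p q / 2) := by ring
  rw [h, Real.cosh_two_mul, Real.cosh_sq', sinh_half_dist, div_pow, toE_dist_sq, mul_pow,
    Real.sq_sqrt hpq.le]
  field_simp
  ring

theorem dist_nonneg' (p q : Hyp3) : 0 ≤ dist p q := by
  rw [dist_eq]
  have : 0 ≤ Real.arsinh (dist p.toE q.toE / (2 * √(p.t * q.t))) :=
    Real.arsinh_nonneg_iff.2 (by positivity)
  linarith

theorem dist_le_of_cosh {p q : Hyp3} {p' q' : Hyp3}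
    (h : Real.cosh (dist p q) ≤ Real.cosh (dist p' q')) : dist p q ≤ dist p' q' := by
  rw [Real.cosh_le_cosh, abs_of_nonneg (dist_nonneg' _ _), abs_of_nonneg (dist_nonneg' _ _)] at h
  exact h

protected theorem dist_triangle (a b c : Hyp3) : dist a c ≤ dist a b + dist b c := by
  have ha := a.t_pos
  have hb := b.t_pos
  have hc := c.t_pos
  have hbm : dist b.toE b.mirror = 2 * b.t := by
    rw [← sq_eq_sq₀ (by positivity) (by positivity), mirror_dist_sq]
    simp
    ring
  have hcb : dist b.toE c.mirror = dist c.toE b.mirror := by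
    rw [← sq_eq_sq₀ (by positivity) (by positivity), mirror_dist_sq, mirror_dist_sq,
      norm_sub_rev, add_comm b.t]
  have key : Real.sinh (dist a c / 2) ≤ Real.sinh (dist a b / 2 + dist b c / 2) := by
    rw [Real.sinh_add, sinh_half_dist, sinh_half_dist, sinh_half_dist, cosh_half_dist,
      cosh_half_dist, hcb]
    have pt := EuclideanGeometry.mul_dist_le_mul_dist_add_mul_dist a.toE b.toE c.toE b.mirror
    rw [hbm] at pt
    rw [Real.sqrt_mul ha.le, Real.sqrt_mul ha.le, Real.sqrt_mul hb.le]
    have h2 : √b.t * √b.t = b.t := Real.mul_self_sqrt hb.le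
    have sa := Real.sqrt_pos.2 ha
    have sb := Real.sqrt_pos.2 hb
    have sc := Real.sqrt_pos.2 hc
    have e : dist a.toE b.toE / (2 * (√a.t * √b.t)) * (dist c.toE b.mirror / (2 * (√b.t * √c.t))) +
        dist a.toE b.mirror / (2 * (√a.t * √b.t)) * (dist b.toE c.toE / (2 * (√b.t * √c.t)))
        = (dist a.toE b.toE * dist c.toE b.mirror + dist b.toE c.toE * dist a.toE b.mirror) /
          (2 * b.t) / (2 * (√a.t * √c.t)) := by
      have h3 : 2 * b.t = 2 * (√b.t * √b.t) := by rw [h2]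
      rw [h3]
      clear pt h3 h2
      generalize √b.t = s at *
      field_simp
    rw [e]
    gcongr
    rw [le_div_iff₀ (by positivity)]
    exact pt
  rw [Real.sinh_le_sinh] at key
  linarith

instance : MetricSpace Hyp3 where
  dist := dist
  dist_self p := by simp [dist_eq]
  dist_comm p q := by rw [dist_eq, dist_eq, dist_comm, mul_comm p.t]
  dist_triangle := Hyp3.dist_triangle
  eq_of_dist_eq_zero {p q} h := by
    have hp := p.t_pos
    have hq := q.t_pos
    have hc := cosh_dist p q
    rw [h, Real.cosh_zero] at hc
    have h0 : (‖p.z - q.z‖ ^ 2 + (p.t - q.t) ^ 2) / (2 * p.t * q.t) = 0 := by linarith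
    rw [div_eq_zero_iff] at h0
    have h1 : ‖p.z - q.z‖ ^ 2 + (p.t - q.t) ^ 2 = 0 :=
      h0.resolve_right (by positivity)
    have hz : ‖p.z - q.z‖ ^ 2 = 0 := by nlinarith [sq_nonneg ‖p.z - q.z‖, sq_nonneg (p.t - q.t)]
    have ht : (p.t - q.t) ^ 2 = 0 := by nlinarith [sq_nonneg ‖p.z - q.z‖, sq_nonneg (p.t - q.t)]
    ext1
    · exact sub_eq_zero.1 (norm_eq_zero.1 (pow_eq_zero_iff two_ne_zero |>.1 hz))
    · exact sub_eq_zero.1 (pow_eq_zero_iff two_ne_zero |>.1 ht)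

/-- The point with cylindrical coordinates `(r, θ, x)` about the geodesic `ℓ` from `0` to `∞`:
`r` is the distance to `ℓ`, `θ` the angle about `ℓ`, `x` the position along `ℓ`. In these
coordinates the hyperbolic metric is `dr² + sinh² r dθ² + cosh² r dx²`. -/
def cyl (r θ x : ℝ) : Hyp3 where
  z := ((Real.exp x * Real.tanh r : ℝ) : ℂ) * Complex.exp (θ * Complex.I)
  t := Real.exp x / Real.cosh r
  t_pos := by positivity

theorem cosh_dist_cyl (r θ x r' θ' x' : ℝ) :
    Real.cosh (dist (cyl r θ x) (cyl r' θ' x')) =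
      Real.cosh r * Real.cosh r' * Real.cosh (x - x')
        - Real.sinh r * Real.sinh r' * Real.cos (θ - θ') := by
  rw [cosh_dist, ← Complex.normSq_eq_norm_sq]
  simp only [cyl, Complex.normSq_apply, Complex.sub_re, Complex.sub_im, Complex.re_ofReal_mul,
    Complex.im_ofReal_mul, Complex.exp_ofReal_mul_I_re, Complex.exp_ofReal_mul_I_im,
    Real.tanh_eq_sinh_div_cosh]
  have c1 : 0 < Real.cosh r := Real.cosh_pos r
  have c2 : 0 < Real.cosh r' := Real.cosh_pos r'
  have e1 : 0 < Real.exp x := Real.exp_pos x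
  have e2 : 0 < Real.exp x' := Real.exp_pos x'
  rw [Real.cosh_eq (x - x'), neg_sub, Real.exp_sub, Real.exp_sub, Real.cos_sub]
  have s1 := Real.sin_sq_add_cos_sq θ
  have s2 := Real.sin_sq_add_cos_sq θ'
  have h1 := Real.cosh_sq' r
  have h2 := Real.cosh_sq' r'
  generalize Real.exp x = E at *
  generalize Real.exp x' = E' at *
  generalize Real.cosh r = C at *
  generalize Real.cosh r' = C' at *
  generalize Real.sinh r = S at *
  generalize Real.sinh r' = S' at *
  generalize Real.cos θ = k at *
  generalize Real.sin θ = m at *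
  generalize Real.cos θ' = k' at *
  generalize Real.sin θ' = m' at *
  field_simp
  grind

end Hyp3

/-- The closed 3-ball obtained by compactifying hyperbolic 3-space: the closed upper half-space
together with the point `∞`. -/
abbrev HypBar : Type := OnePoint (ℂ × ℝ≥0)

/-- The Riemann sphere. -/
abbrev Sphere : Type := OnePoint ℂ

/-- Hyperbolic space as the interior of its compactification. -/
def toBar (p : Hyp3) : HypBar := ((p.z, ⟨p.t, p.t_pos.le⟩) : ℂ × ℝ≥0)

/-- The Riemann sphere as the boundary of the compactification of hyperbolic space. -/
def bdry : Sphere → HypBar := OnePoint.map fun z : ℂ => ((z, 0) : ℂ × ℝ≥0)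

/-! ### Round disks and half-spaces -/

/-- An (open) round disk in the Riemann sphere: the solution set of
`a |z|² + 2 Re (conj b * z) + c < 0` with `a c < |b|²`. For `a > 0`, `a = 0`, `a < 0` it is a
Euclidean disk, a Euclidean half-plane, the complement of a closed Euclidean disk (with `∞`). -/
structure RoundDisk where
  a : ℝ
  b : ℂ
  c : ℝ
  disc_pos : a * c < ‖b‖ ^ 2

/-- The disk as a set of points of the sphere. -/
def RoundDisk.disk (D : RoundDisk) : Set Sphere :=
  {x | (x = OnePoint.infty ∧ D.a < 0) ∨
    ∃ z : ℂ, x = (z : Sphere) ∧ D.a * ‖z‖ ^ 2 + 2 * (starRingEnd ℂ D.b * z).re + D.c < 0}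

/-- The (open) hyperbolic half-space bounded by the round disk, i.e. the one with the disk as its
ideal boundary, cut off by the hemisphere or vertical plane over the circle around the disk. -/
def RoundDisk.halfSpace (D : RoundDisk) : Set Hyp3 :=
  {p | D.a * (‖p.z‖ ^ 2 + p.t ^ 2) + 2 * (starRingEnd ℂ D.b * p.z).re + D.c < 0}

/-! ### The model `ℍ³_α` of a cone singularity -/

/-- Cylindrical coordinates `(r, θ, x)` on `ℍ³_α`, with `θ` an angle modulo `α`. The points with
`r = 0` form the singular axis. -/
structure ConeCoord (α : ℝ) where
  r : ℝ
  r_nonneg : 0 ≤ r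
  θ : AddCircle α
  x : ℝ

namespace ConeCoord

variable {α : ℝ}

/-- The dihedral angle, seen from the singular axis, between two points, cut off at `π`. -/
def angle (p q : ConeCoord α) : ℝ := min Real.pi (dist p.θ q.θ)

/-- The length distance of the metric completion of the quotient by `θ ↦ θ + α` of
`dr² + sinh² r dθ² + cosh² r dx²`, `r > 0`. Two points at dihedral angle `ω < π` about the axis
have the distance of two such points of `ℍ³`; if the angle is at least `π`, the shortest connection
runs through the axis, and the distance is that of two points of `ℍ³` at dihedral angle `π`. -/
instance : Dist (ConeCoord α) :=
  ⟨fun p q => dist (Hyp3.cyl p.r 0 p.x) (Hyp3.cyl q.r (p.angle q) q.x)⟩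

theorem dist_def (p q : ConeCoord α) :
    dist p q = dist (Hyp3.cyl p.r 0 p.x) (Hyp3.cyl q.r (p.angle q) q.x) := rfl

theorem cosh_dist (p q : ConeCoord α) :
    Real.cosh (dist p q) = Real.cosh p.r * Real.cosh q.r * Real.cosh (p.x - q.x)
      - Real.sinh p.r * Real.sinh q.r * Real.cos (p.angle q) := by
  rw [dist_def, Hyp3.cosh_dist_cyl, zero_sub, Real.cos_neg]

theorem angle_nonneg (p q : ConeCoord α) : 0 ≤ p.angle q := le_min Real.pi_pos.le dist_nonneg

theorem angle_le_pi (p q : ConeCoord α) : p.angle q ≤ Real.pi := min_le_left _ _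

theorem angle_comm (p q : ConeCoord α) : p.angle q = q.angle p := by
  simp only [angle, _root_.dist_comm]

theorem angle_triangle (p q s : ConeCoord α) : p.angle s ≤ p.angle q + q.angle s := by
  have h := _root_.dist_triangle p.θ q.θ s.θ
  have h1 : 0 ≤ dist p.θ q.θ := dist_nonneg
  have h2 : 0 ≤ dist q.θ s.θ := dist_nonneg
  have h3 := Real.pi_pos
  simp only [angle]
  grind

/-- The distance of two points of `ℍ³` grows with the dihedral angle between them. -/
theorem cyl_mono {r r' x x' φ ψ : ℝ} (hr : 0 ≤ r) (hr' : 0 ≤ r') (hφ : 0 ≤ φ) (h : φ ≤ ψ)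
    (hψ : ψ ≤ Real.pi) {φ₁ φ₂ ψ₁ ψ₂ : ℝ} (h1 : |φ₁ - φ₂| = φ) (h2 : |ψ₁ - ψ₂| = ψ) :
    dist (Hyp3.cyl r φ₁ x) (Hyp3.cyl r' φ₂ x') ≤ dist (Hyp3.cyl r ψ₁ x) (Hyp3.cyl r' ψ₂ x') := by
  apply Hyp3.dist_le_of_cosh
  rw [Hyp3.cosh_dist_cyl, Hyp3.cosh_dist_cyl, ← Real.cos_abs (φ₁ - φ₂), ← Real.cos_abs (ψ₁ - ψ₂),
    h1, h2]
  have hc : Real.cos ψ ≤ Real.cos φ := Real.cos_le_cos_of_nonneg_of_le_pi hφ hψ h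
  have hs : 0 ≤ Real.sinh r * Real.sinh r' :=
    mul_nonneg (Real.sinh_nonneg_iff.2 hr) (Real.sinh_nonneg_iff.2 hr')
  nlinarith [mul_le_mul_of_nonneg_left hc hs]

protected theorem dist_triangle (p q s : ConeCoord α) : dist p s ≤ dist p q + dist q s := by
  have a0 := angle_nonneg p q
  have b0 := angle_nonneg q s
  have c0 := angle_nonneg p s
  have a1 := angle_le_pi p q
  have b1 := angle_le_pi q s
  have c1 := angle_le_pi p s
  have t := angle_triangle p q s
  -- the angle at which `s` is placed, seen from the half-plane of `q`
  obtain ⟨β, β0, βb, βc, βπ⟩ : ∃ β, 0 ≤ β ∧ β ≤ q.angle s ∧ p.angle s ≤ p.angle q + β ∧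
      p.angle q + β ≤ Real.pi := by
    rcases le_total (p.angle q + q.angle s) Real.pi with h | h
    · exact ⟨q.angle s, b0, le_rfl, t, h⟩
    · exact ⟨Real.pi - p.angle q, by linarith, by linarith, by linarith, by linarith⟩
  have e1 : dist p s ≤ dist (Hyp3.cyl p.r 0 p.x) (Hyp3.cyl s.r (p.angle q + β) s.x) := by
    rw [dist_def]
    refine cyl_mono p.r_nonneg s.r_nonneg c0 βc βπ ?_ ?_
    · rw [zero_sub, abs_neg, abs_of_nonneg c0]
    · rw [zero_sub, abs_neg, abs_of_nonneg (by linarith)]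
  have e2 : dist (Hyp3.cyl q.r (p.angle q) q.x) (Hyp3.cyl s.r (p.angle q + β) s.x) ≤ dist q s := by
    rw [dist_def]
    refine cyl_mono q.r_nonneg s.r_nonneg β0 βb b1 ?_ ?_
    · rw [sub_add_cancel_left, abs_neg, abs_of_nonneg β0]
    · rw [zero_sub, abs_neg, abs_of_nonneg b0]
  have e3 := Hyp3.dist_triangle (Hyp3.cyl p.r 0 p.x) (Hyp3.cyl q.r (p.angle q) q.x)
    (Hyp3.cyl s.r (p.angle q + β) s.x)
  rw [← dist_def] at e3
  linarith

instance : PseudoMetricSpace (ConeCoord α) where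
  dist := dist
  dist_self p := by simp [dist_def, angle, Real.pi_pos.le]
  dist_comm p q := by
    have h : Real.cosh (dist p q) = Real.cosh (dist q p) := by
      rw [cosh_dist, cosh_dist, angle_comm, ← Real.cosh_neg (p.x - q.x), neg_sub]
      ring
    exact le_antisymm (Hyp3.dist_le_of_cosh h.le) (Hyp3.dist_le_of_cosh h.ge)
  dist_triangle := ConeCoord.dist_triangle

end ConeCoord

/-- The model space `ℍ³_α`; points of the axis with different `θ` (at distance zero) are
identified. -/
abbrev ConeModel (α : ℝ) : Type := SeparationQuotient (ConeCoord α)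

/-! ### Hyperbolic cone-manifolds -/

/-- The point `x` has a neighbourhood isometric to a neighbourhood of a point of `Y`. -/
def LocallyModelled {X : Type*} [EMetricSpace X] (Y : Type*) [EMetricSpace Y] (x : X) : Prop :=
  ∃ f : X → Y, ∃ W ∈ 𝓝 x, (∀ a ∈ W, ∀ b ∈ W, edist (f a) (f b) = edist a b) ∧ f '' W ∈ 𝓝 (f x)

/-- A 3-dimensional hyperbolic cone-manifold. Here `N` is a compact 3-manifold with boundary, and
the extended metric space `X` is the interior of `N` with a complete length metric (two
points of different components have distance `∞`), such that every point has a neighbourhood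
isometric to a neighbourhood of a point of `ℍ³_α` for some `α > 0` (which may vary with the
point). -/
structure HypConeManifold (N : Type*) [TopologicalSpace N] [T2Space N] [CompactSpace N]
    [ChartedSpace (EuclideanHalfSpace 3) N] (X : Type*) [EMetricSpace X] where
  /-- The inclusion of the interior. -/
  incl : X → N
  incl_isEmbedding : IsEmbedding incl
  range_incl : range incl = (𝓡∂ 3).interior N
  complete : CompleteSpace X
  length_metric : ∀ x y : X, edist x y = ⨅ γ : Path x y, eVariationOn γ univ
  cone : ∀ x : X, ∃ α : ℝ, 0 < α ∧ LocallyModelled (ConeModel α) x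

section

variable {N : Type*} [TopologicalSpace N] [T2Space N] [CompactSpace N]
  [ChartedSpace (EuclideanHalfSpace 3) N] {X : Type*} [EMetricSpace X]

namespace HypConeManifold

/-- The non-singular part: the points near which the metric is hyperbolic. -/
def nonsingular (_K : HypConeManifold N X) : Set X := {x | LocallyModelled Hyp3 x}

/-- A chart at infinity: a homeomorphism from an open subset of `N` onto an open subset of the
compactification of `ℍ³` that takes boundary points of `N` into the Riemann sphere and is an
isometry of metrics (that is, locally distance preserving), with values in `ℍ³`, on the
interior. -/
structure IsChartAtInfinity (K : HypConeManifold N X)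
    (c : OpenPartialHomeomorph N HypBar) : Prop where
  map_boundary : ∀ y ∈ c.source, y ∈ (𝓡∂ 3).boundary N → ∃ w : Sphere, c y = bdry w
  map_interior : ∀ x : X, K.incl x ∈ c.source → ∃ f : X → Hyp3, ∃ W ∈ 𝓝 x, ∀ a ∈ W,
    K.incl a ∈ c.source ∧ c (K.incl a) = toBar (f a) ∧ ∀ b ∈ W, edist (f a) (f b) = edist a b

/-- A projective boundary: an atlas of charts at infinity whose changes of coordinates are, on the
boundary, locally Möbius transformations (elements of `PSL₂(ℂ)`). -/
structure ProjectiveBoundary (K : HypConeManifold N X) where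
  charts : Set (OpenPartialHomeomorph N HypBar)
  isChart : ∀ c ∈ charts, K.IsChartAtInfinity c
  compatible : ∀ c ∈ charts, ∀ c' ∈ charts, ∀ y ∈ c.source ∩ c'.source ∩ (𝓡∂ 3).boundary N,
    ∃ g : GL (Fin 2) ℂ, ∀ᶠ y' in 𝓝[(𝓡∂ 3).boundary N] y,
      ∀ w : Sphere, c y' = bdry w → c' y' = bdry (g • w)

variable {K : HypConeManifold N X}

/-- The points of the projective boundary: the boundary points covered by the atlas. -/
def ProjectiveBoundary.carrier (S : K.ProjectiveBoundary) : Set N :=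
  {y | y ∈ (𝓡∂ 3).boundary N ∧ ∃ c ∈ S.charts, y ∈ c.source}

/-- `φ` restricts to a projective map from the round disk `D` to the projective boundary, that is,
to a round disk in the projective boundary: its values on `D` are points of the projective boundary,
and in charts it is locally a Möbius transformation. The values of `φ` outside `D` are
irrelevant. -/
def ProjectiveBoundary.IsRoundDiskMap (S : K.ProjectiveBoundary) (D : RoundDisk)
    (φ : Sphere → N) : Prop :=
  ∀ w ∈ D.disk, φ w ∈ S.carrier ∧ ∃ c ∈ S.charts, φ w ∈ c.source ∧
    ∃ g : GL (Fin 2) ℂ, ∀ᶠ w' in 𝓝 w, φ w' ∈ c.source ∧ c (φ w') = bdry (g • w')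

/-- `F` is a half-space in the non-singular part `M` extending the round disk `φ`: on the half-space
bounded by `D` it is an isometry of metrics (locally distance preserving) into `M`, and together
with `φ` on `D` it forms a continuous map into `N`. -/
structure IsHalfSpaceExtension (K : HypConeManifold N X) (D : RoundDisk) (φ : Sphere → N)
    (F : Hyp3 → X) : Prop where
  mapsTo : MapsTo F D.halfSpace K.nonsingular
  isometric : ∀ p ∈ D.halfSpace, ∃ W ∈ 𝓝 p, ∀ a ∈ W, ∀ b ∈ W, edist (F a) (F b) = edist a b
  extends_disk : ∃ G : HypBar → N, ContinuousOn G (toBar '' D.halfSpace ∪ bdry '' D.disk) ∧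
    (∀ p ∈ D.halfSpace, G (toBar p) = K.incl (F p)) ∧ ∀ w ∈ D.disk, G (bdry w) = φ w

end HypConeManifold

end

end ConeManifold

end

/-!
The values of `φ` are conformal in charts at infinity, so near each ideal point of the disk the chart
and the Poincaré extension of the Möbius transformation give a local extension of `φ` to hyperbolic
space; an extension is determined by `φ`, because near an ideal point it has to be the Poincaré
extension of its boundary values. After moving the disk to the unit disk
(`RoundDisk.exists_mapsDisk_unit`), the extension is constructed on the concentric half-balls of radius
`R`, and the point is to pass from `R` to a larger radius (`IsLocalExtension.exists_larger`). By
compactness of the closed hemisphere of radius `R` this is a continuation at each of its points.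
At ideal points it is the local extension. At a point `p` in hyperbolic space the map has a limit by
completeness, and if the limit is non-singular, a hyperbolic chart there gives the continuation.

The limit is never singular (`IsLocalExtension.continues`). If it were, the local model `ℍ³_α` at the
limit shows that the distance to the singular axis, pulled back to the half-ball, is the distance to a
geodesic through `p` that avoids the half-ball and at whose points the map also tends to singular points
(`exists_singular_geodesic`). A geodesic through `p` that avoids the half-ball is tangent to the
hemisphere, and stays in it since the half-ball and its complement are hyperbolic half-spaces. The set
of points with singular limit is compact, so it contains a point of least height, but on a geodesic in
the hemisphere the height has no local minimum: `cosh` of the distance to the top of the hemisphere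
satisfies `f'' = f`, and is positive.

For an embedded disk, let `F p = F q`. The non-singular part being hyperbolic, there is an isometry `T`
of hyperbolic space with `T p = q` and `F = F ∘ T` near `p`. The half-space `H` and `T⁻¹ H` both contain
`p`, so some direction at `p` points out of neither, and the geodesic rays from points near `p` in this
direction stay in `H ∩ T⁻¹ H`. Continuing `F = F ∘ T` along them gives `φ = φ ∘ T` on an
open set of ideal points in the disk, so `T` fixes these ideal points, hence is the identity
(`IsLocalExtension.injective`, `ExtIsom.eq_of_bar_eq_self`). An injective local isometry into the
non-singular part is open, so it is an embedding.
-/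

noncomputable section

namespace ConeManifold

/-! ### The topology of hyperbolic space and of its compactification -/

namespace Hyp3

/-- The coordinates of a point of the upper half-space, in `ℂ × ℝ`. -/
def coord (p : Hyp3) : ℂ × ℝ := (p.z, p.t)

theorem coord_injective : Function.Injective coord := fun p q h => by
  ext1
  · exact congrArg Prod.fst h
  · exact congrArg Prod.snd h

theorem range_coord : range coord = {x : ℂ × ℝ | 0 < x.2} := by
  ext x
  constructor
  · rintro ⟨p, rfl⟩
    exact p.t_pos
  · intro h
    exact ⟨⟨x.1, x.2, h⟩, rfl⟩

theorem tendsto_coord (p : Hyp3) : Tendsto coord (𝓝 p) (𝓝 (coord p)) := by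
  have hp := p.t_pos
  have hd : Tendsto (fun q => Real.cosh (dist p q) - 1) (𝓝 p) (𝓝 0) := by
    have : Continuous fun q : Hyp3 => Real.cosh (dist p q) - 1 := by fun_prop
    simpa using this.tendsto p
  have hb : Tendsto (fun q => 4 * p.t ^ 2 * (1 + (Real.cosh (dist p q) - 1)) *
      (Real.cosh (dist p q) - 1)) (𝓝 p) (𝓝 0) := by
    have := ((tendsto_const_nhds (x := 4 * p.t ^ 2)).mul
      ((tendsto_const_nhds (x := (1 : ℝ))).add hd)).mul hd
    simpa using this
  have key : ∀ q : Hyp3, ‖p.z - q.z‖ ^ 2 + (p.t - q.t) ^ 2 ≤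
      4 * p.t ^ 2 * (1 + (Real.cosh (dist p q) - 1)) * (Real.cosh (dist p q) - 1) := by
    intro q
    have hq := q.t_pos
    have h1 := cosh_dist p q
    have h0 : 0 ≤ Real.cosh (dist p q) - 1 := by linarith [Real.one_le_cosh (dist p q)]
    generalize Real.cosh (dist p q) = c at *
    have h2 : ‖p.z - q.z‖ ^ 2 + (p.t - q.t) ^ 2 = 2 * p.t * q.t * (c - 1) := by
      rw [h1]; field_simp; ring
    have h3 : q.t ≤ 2 * p.t * c := by
      have : q.t * q.t ≤ q.t * (2 * p.t * c) := by nlinarith [sq_nonneg ‖p.z - q.z‖]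
      exact le_of_mul_le_mul_left this hq
    rw [h2]
    have := mul_le_mul_of_nonneg_right h3 h0
    nlinarith
  have hs : Tendsto (fun q : Hyp3 => ‖p.z - q.z‖ ^ 2 + (p.t - q.t) ^ 2) (𝓝 p) (𝓝 0) :=
    squeeze_zero (fun q => by positivity) key hb
  have hz : Tendsto (fun q : Hyp3 => ‖p.z - q.z‖) (𝓝 p) (𝓝 0) := by
    have h := (squeeze_zero (fun q => by positivity)
      (fun q : Hyp3 => le_add_of_nonneg_right (sq_nonneg (p.t - q.t))) hs).sqrt
    simpa using h
  have ht : Tendsto (fun q : Hyp3 => |p.t - q.t|) (𝓝 p) (𝓝 0) := by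
    have h := (squeeze_zero (fun q => by positivity)
      (fun q : Hyp3 => le_add_of_nonneg_left (sq_nonneg ‖p.z - q.z‖)) hs).sqrt
    simpa [Real.sqrt_sq_eq_abs] using h
  refine Tendsto.prodMk_nhds ?_ ?_
  · rw [tendsto_iff_norm_sub_tendsto_zero]
    simpa only [norm_sub_rev] using hz
  · rw [tendsto_iff_norm_sub_tendsto_zero]
    simpa only [Real.norm_eq_abs, abs_sub_comm] using ht

theorem dist_le_of_le_t {τ : ℝ} (hτ : 0 < τ) {p q : Hyp3} (hp : τ ≤ p.t) (hq : τ ≤ q.t) :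
    dist p q ≤ 2 / τ * dist p.coord q.coord := by
  rw [dist_eq]
  have h1 : τ ≤ √(p.t * q.t) := by
    apply Real.le_sqrt_of_sq_le
    nlinarith
  have h2 : dist p.toE q.toE ≤ 2 * dist p.coord q.coord := by
    apply le_of_sq_le_sq _ (by positivity)
    rw [toE_dist_sq]
    have h3 : ‖p.z - q.z‖ ≤ dist p.coord q.coord := by
      rw [← dist_eq_norm]; exact le_max_left _ _
    have h4 : |p.t - q.t| ≤ dist p.coord q.coord := by
      rw [← Real.dist_eq]; exact le_max_right _ _
    rw [← sq_abs (p.t - q.t)]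
    nlinarith [norm_nonneg (p.z - q.z), abs_nonneg (p.t - q.t)]
  have h5 : Real.arsinh (dist p.toE q.toE / (2 * √(p.t * q.t))) ≤
      dist p.toE q.toE / (2 * √(p.t * q.t)) := by
    have h0 : 0 ≤ dist p.toE q.toE / (2 * √(p.t * q.t)) := by positivity
    generalize dist p.toE q.toE / (2 * √(p.t * q.t)) = y at *
    rw [← Real.sinh_le_sinh, Real.sinh_arsinh]
    exact Real.self_le_sinh_iff.2 h0
  calc _ ≤ 2 * (dist p.toE q.toE / (2 * √(p.t * q.t))) := by linarith
    _ = dist p.toE q.toE / √(p.t * q.t) := by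
      have : 0 < √(p.t * q.t) := hτ.trans_le h1
      field_simp
    _ ≤ (2 * dist p.coord q.coord) / τ := by gcongr
    _ = _ := by ring

theorem isInducing_coord : IsInducing coord := by
  rw [isInducing_iff_nhds]
  intro p
  apply le_antisymm
  · exact tendsto_iff_comap.1 (tendsto_coord p)
  · have hp := p.t_pos
    have hc : Tendsto coord (comap coord (𝓝 (coord p))) (𝓝 (coord p)) := tendsto_comap
    suffices Tendsto id (comap coord (𝓝 (coord p))) (𝓝 p) from this
    rw [tendsto_iff_dist_tendsto_zero]
    have ht : ∀ᶠ q in comap coord (𝓝 (coord p)), p.t / 2 < q.t := by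
      refine hc.eventually (p := fun x => p.t / 2 < x.2) ?_
      have : Tendsto (fun x : ℂ × ℝ => x.2) (𝓝 (coord p)) (𝓝 p.t) := continuous_snd.tendsto _
      exact this.eventually (lt_mem_nhds (by linarith))
    have hd : Tendsto (fun q => 2 / (p.t / 2) * dist (coord q) (coord p))
        (comap coord (𝓝 (coord p))) (𝓝 0) := by
      simpa using (tendsto_iff_dist_tendsto_zero.1 hc).const_mul (2 / (p.t / 2))
    refine squeeze_zero' (Eventually.of_forall fun q => dist_nonneg) ?_ hd
    filter_upwards [ht] with q hq
    exact dist_le_of_le_t (by linarith) hq.le (by linarith)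

theorem isOpenEmbedding_coord : IsOpenEmbedding coord :=
  ⟨⟨isInducing_coord, coord_injective⟩, by
    rw [range_coord]; exact isOpen_lt continuous_const continuous_snd⟩

@[fun_prop]
theorem continuous_coord : Continuous coord := isInducing_coord.continuous

@[fun_prop]
theorem continuous_z : Continuous Hyp3.z := continuous_fst.comp continuous_coord

@[fun_prop]
theorem continuous_t : Continuous Hyp3.t := continuous_snd.comp continuous_coord

end Hyp3

open Hyp3

/-- The embedding of the closed upper half-space into its compactification, in the coordinates
`ℂ × ℝ`. Negative heights are replaced by `0`. -/
def barOf (x : ℂ × ℝ) : HypBar := ((x.1, x.2.toNNReal) : ℂ × ℝ≥0)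

theorem continuous_barOf : Continuous barOf :=
  OnePoint.continuous_coe.comp (continuous_fst.prodMk (continuous_real_toNNReal.comp continuous_snd))

theorem barOf_coord (p : Hyp3) : barOf p.coord = toBar p :=
  congrArg (fun t : ℝ≥0 => ((p.z, t) : HypBar)) (Real.toNNReal_of_nonneg p.t_pos.le)

theorem bdry_coe (w : ℂ) : bdry (w : Sphere) = ((w, 0) : ℂ × ℝ≥0) := rfl

theorem bdry_infty : bdry OnePoint.infty = OnePoint.infty := rfl

theorem barOf_zero (w : ℂ) : barOf (w, 0) = bdry w := by
  simp [barOf, bdry_coe]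

theorem bdry_injective : Function.Injective bdry := by
  intro a b h
  induction a using OnePoint.rec <;> induction b using OnePoint.rec
  · rfl
  · simp [bdry_coe, bdry_infty] at h
  · simp [bdry_coe, bdry_infty] at h
  · simp only [bdry_coe, OnePoint.coe_eq_coe, Prod.mk.injEq, and_true] at h
    rw [h]

theorem barOf_inj {x y : ℂ × ℝ} (hx : 0 ≤ x.2) (hy : 0 ≤ y.2) (h : barOf x = barOf y) : x = y := by
  rw [barOf, barOf, OnePoint.coe_eq_coe, Prod.ext_iff] at h
  exact Prod.ext h.1 ((Real.toNNReal_eq_toNNReal_iff hx hy).1 h.2)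

theorem toBar_injective : Function.Injective toBar := by
  intro p q h
  rw [← barOf_coord, ← barOf_coord] at h
  exact coord_injective (barOf_inj p.t_pos.le q.t_pos.le h)

theorem toBar_ne_bdry (p : Hyp3) (w : Sphere) : toBar p ≠ bdry w := by
  intro h
  rw [← barOf_coord] at h
  induction w using OnePoint.rec with
  | infty => simp [barOf, bdry_infty] at h
  | coe w =>
    rw [← barOf_zero] at h
    exact p.t_pos.ne' (congrArg Prod.snd (barOf_inj p.t_pos.le le_rfl h))

theorem eq_toBar_or_bdry (x : HypBar) : (∃ p, x = toBar p) ∨ ∃ w, x = bdry w := by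
  induction x using OnePoint.rec with
  | infty => exact Or.inr ⟨OnePoint.infty, rfl⟩
  | coe x =>
    obtain ⟨z, t, ht⟩ := x
    rcases ht.eq_or_lt with h | h
    · subst h
      exact Or.inr ⟨z, rfl⟩
    · exact Or.inl ⟨⟨z, t, h⟩, rfl⟩

/-- In the coordinates `ℂ × ℝ`, the neighbourhoods of a point of the closed upper half-space leave
the expected trace on hyperbolic space. -/
theorem comap_toBar_nhds_barOf {x : ℂ × ℝ} (hx : 0 ≤ x.2) :
    comap toBar (𝓝 (barOf x)) = comap coord (𝓝 x) := by
  have e1 : toBar = (fun y : ℂ × ℝ≥0 => (y : HypBar)) ∘ fun p : Hyp3 => (p.z, p.t.toNNReal) := by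
    funext p
    exact (barOf_coord p).symm
  have e2 : coord = (Prod.map id NNReal.toReal) ∘ fun p : Hyp3 => (p.z, p.t.toNNReal) := by
    funext p
    simp [coord, p.t_pos.le]
  have e3 : IsInducing (Prod.map (id : ℂ → ℂ) NNReal.toReal) :=
    IsInducing.id.prodMap NNReal.isEmbedding_coe.isInducing
  have e4 : Prod.map id NNReal.toReal (x.1, x.2.toNNReal) = x := by
    simp [hx]
  have h3 := e3.nhds_eq_comap (x.1, x.2.toNNReal)
  rw [e4] at h3
  rw [e1, e2, ← comap_comap, ← comap_comap, barOf, ← h3,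
    ← OnePoint.isOpenEmbedding_coe.isInducing.nhds_eq_comap]

theorem isEmbedding_toBar : IsEmbedding toBar := by
  refine ⟨isInducing_iff_nhds.2 fun p => ?_, toBar_injective⟩
  rw [← barOf_coord, comap_toBar_nhds_barOf p.t_pos.le, ← isInducing_coord.nhds_eq_comap]

theorem continuous_bdry : Continuous bdry := by
  refine OnePoint.continuous_map (by fun_prop) ?_
  have : IsClosedEmbedding fun z : ℂ => ((z, 0) : ℂ × ℝ≥0) :=
    .of_continuous_injective_isClosedMap (by fun_prop) (fun a b h => congrArg Prod.fst h)
      (isClosedMap_prodMk_right (0 : ℝ≥0))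
  simpa [coclosedCompact_eq_cocompact] using this.tendsto_cocompact

theorem isClosed_range_bdry : IsClosed (range bdry) := (isCompact_range continuous_bdry).isClosed

theorem range_toBar : range toBar = (range bdry)ᶜ := by
  ext x
  constructor
  · rintro ⟨p, rfl⟩ ⟨w, hw⟩
    exact toBar_ne_bdry p w hw.symm
  · intro h
    rcases eq_toBar_or_bdry x with ⟨p, rfl⟩ | ⟨w, rfl⟩
    · exact ⟨p, rfl⟩
    · exact absurd ⟨w, rfl⟩ h

theorem isOpenEmbedding_toBar : IsOpenEmbedding toBar :=
  ⟨isEmbedding_toBar, by rw [range_toBar]; exact isClosed_range_bdry.isOpen_compl⟩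

/-- The trace on hyperbolic space of the neighbourhoods of an ideal point. -/
def idealNhds (w : Sphere) : Filter Hyp3 := comap toBar (𝓝 (bdry w))

theorem idealNhds_coe (w : ℂ) : idealNhds w = comap coord (𝓝 (w, 0)) := by
  rw [idealNhds, ← barOf_zero, comap_toBar_nhds_barOf le_rfl]

/-- The vertical line over `w` converges to the ideal point `w`. -/
theorem tendsto_vertical (w : ℂ) (f : ℝ → Hyp3) (hf : ∀ t > 0, (f t).coord = (w, t)) :
    Tendsto f (𝓝[>] 0) (idealNhds w) := by
  rw [idealNhds_coe, tendsto_comap_iff]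
  have h : Tendsto (fun t : ℝ => (w, t)) (𝓝[>] 0) (𝓝 (w, 0)) :=
    ((by fun_prop : Continuous fun t : ℝ => (w, t)).tendsto 0).mono_left nhdsWithin_le_nhds
  refine h.congr' ?_
  filter_upwards [self_mem_nhdsWithin] with t ht
  exact (hf t ht).symm

instance neBot_idealNhds (w : ℂ) : NeBot (idealNhds w) :=
  (tendsto_vertical w (fun t => if h : 0 < t then ⟨w, t, h⟩ else ⟨w, 1, one_pos⟩)
    fun t ht => by simp only [gt_iff_lt.1 ht, dif_pos]; rfl).neBot

theorem tendsto_z_idealNhds (w : ℂ) : Tendsto Hyp3.z (idealNhds w) (𝓝 w) := by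
  rw [idealNhds_coe]
  exact (continuous_fst.tendsto (w, (0 : ℝ))).comp tendsto_comap

theorem tendsto_t_idealNhds (w : ℂ) : Tendsto Hyp3.t (idealNhds w) (𝓝 0) := by
  rw [idealNhds_coe]
  exact (continuous_snd.tendsto (w, (0 : ℝ))).comp tendsto_comap

/-! ### Isometries of hyperbolic space with their extensions to the compactification -/

/-- An isometry of hyperbolic space together with its continuous extension to the
compactification. -/
structure ExtIsom where
  toFun : Hyp3 ≃ᵢ Hyp3
  bar : HypBar ≃ₜ HypBar
  bar_toBar : ∀ p, bar (toBar p) = toBar (toFun p)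

namespace ExtIsom

instance : CoeFun ExtIsom fun _ => Hyp3 → Hyp3 := ⟨fun T => T.toFun⟩

/-- The identity. -/
def refl : ExtIsom := ⟨.refl _, .refl _, fun _ => rfl⟩

/-- The composition, `T` first. -/
def trans (T S : ExtIsom) : ExtIsom where
  toFun := T.toFun.trans S.toFun
  bar := T.bar.trans S.bar
  bar_toBar p := by simp [T.bar_toBar, S.bar_toBar]

/-- The inverse. -/
def symm (T : ExtIsom) : ExtIsom where
  toFun := T.toFun.symm
  bar := T.bar.symm
  bar_toBar p := by
    rw [Homeomorph.symm_apply_eq, T.bar_toBar, IsometryEquiv.apply_symm_apply]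

@[simp] theorem trans_apply (T S : ExtIsom) (p : Hyp3) : T.trans S p = S (T p) := rfl

@[simp] theorem trans_bar (T S : ExtIsom) (x : HypBar) : (T.trans S).bar x = S.bar (T.bar x) := rfl

@[simp] theorem symm_apply_apply (T : ExtIsom) (p : Hyp3) : T.symm (T p) = p :=
  T.toFun.symm_apply_apply p

@[simp] theorem apply_symm_apply (T : ExtIsom) (p : Hyp3) : T (T.symm p) = p :=
  T.toFun.apply_symm_apply p

@[simp] theorem symm_bar_bar (T : ExtIsom) (x : HypBar) : T.symm.bar (T.bar x) = x :=
  T.bar.symm_apply_apply x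

@[simp] theorem bar_symm_bar (T : ExtIsom) (x : HypBar) : T.bar (T.symm.bar x) = x :=
  T.bar.apply_symm_apply x

theorem dist_eq (T : ExtIsom) (p q : Hyp3) : dist (T p) (T q) = dist p q := T.toFun.dist_eq p q

theorem edist_eq (T : ExtIsom) (p q : Hyp3) : edist (T p) (T q) = edist p q := T.toFun.edist_eq p q

theorem continuous (T : ExtIsom) : Continuous T := T.toFun.continuous

theorem exists_bar_bdry (T : ExtIsom) (w : Sphere) : ∃ w', T.bar (bdry w) = bdry w' := by
  rcases eq_toBar_or_bdry (T.bar (bdry w)) with ⟨p, hp⟩ | h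
  · have h1 := T.symm_bar_bar (bdry w)
    rw [hp, T.symm.bar_toBar] at h1
    exact absurd h1 (toBar_ne_bdry _ _)
  · exact h

theorem tendsto_idealNhds (T : ExtIsom) {w w' : Sphere} (h : T.bar (bdry w) = bdry w') :
    Tendsto T (idealNhds w) (idealNhds w') := by
  rw [idealNhds, idealNhds, tendsto_comap_iff, ← h]
  have : toBar ∘ T = T.bar ∘ toBar := funext fun p => (T.bar_toBar p).symm
  rw [this]
  exact (T.bar.continuous.tendsto _).comp tendsto_comap

end ExtIsom

/-! ### Similarities, inversion and Poincaré extension -/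

/-- An extended isometry from a bijection of hyperbolic space, given with its inverse, that
preserves `cosh` of the distance. -/
def ExtIsom.ofCosh (f g : Hyp3 → Hyp3) (hl : ∀ p, g (f p) = p) (hr : ∀ p, f (g p) = p)
    (h : ∀ p q, Real.cosh (dist (f p) (f q)) = Real.cosh (dist p q)) (bar : HypBar ≃ₜ HypBar)
    (hbar : ∀ p, bar (toBar p) = toBar (f p)) : ExtIsom where
  toFun := ⟨⟨f, g, hl, hr⟩, Isometry.of_dist_eq fun p q =>
    le_antisymm (dist_le_of_cosh (h p q).le) (dist_le_of_cosh (h p q).ge)⟩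
  bar := bar
  bar_toBar := hbar

/-- The similarity `(z, t) ↦ (a z + b, |a| t)`, extending `z ↦ a z + b`. -/
def similarity (a b : ℂ) (ha : a ≠ 0) : ExtIsom :=
  .ofCosh (fun p => ⟨a * p.z + b, ‖a‖ * p.t, mul_pos (norm_pos_iff.2 ha) p.t_pos⟩)
    (fun p => ⟨a⁻¹ * (p.z - b), ‖a‖⁻¹ * p.t, mul_pos (inv_pos.2 (norm_pos_iff.2 ha)) p.t_pos⟩)
    (fun p => by
      have := norm_pos_iff.2 ha
      ext1 <;> (simp; field_simp))
    (fun p => by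
      have := norm_pos_iff.2 ha
      ext1 <;> (simp; field_simp; try ring))
    (fun p q => by
      have h0 := norm_pos_iff.2 ha
      have hp := p.t_pos
      have hq := q.t_pos
      have e : a * p.z + b - (a * q.z + b) = a * (p.z - q.z) := by ring
      rw [cosh_dist, cosh_dist, e, norm_mul]
      field_simp)
    (((Homeomorph.mulLeft₀ a ha).trans (Homeomorph.addRight b)).prodCongr
      (Homeomorph.mulLeft₀ ‖a‖₊ (nnnorm_ne_zero_iff.2 ha))).onePointCongr
    (fun p => by
      refine congrArg (fun x : ℂ × ℝ≥0 => (x : HypBar)) (Prod.ext rfl ?_)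
      exact NNReal.eq rfl)

@[simp] theorem similarity_z (a b : ℂ) (ha : a ≠ 0) (p : Hyp3) :
    (similarity a b ha p).z = a * p.z + b := rfl

@[simp] theorem similarity_t (a b : ℂ) (ha : a ≠ 0) (p : Hyp3) :
    (similarity a b ha p).t = ‖a‖ * p.t := rfl

theorem similarity_bar_coe (a b : ℂ) (ha : a ≠ 0) (w : ℂ) :
    (similarity a b ha).bar (bdry w) = bdry (a * w + b : ℂ) :=
  congrArg (fun x : ℂ × ℝ≥0 => (x : HypBar)) (Prod.ext rfl (mul_zero _))

theorem similarity_bar_infty (a b : ℂ) (ha : a ≠ 0) :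
    (similarity a b ha).bar (bdry OnePoint.infty) = bdry OnePoint.infty := rfl

/-- The reflection `(z, t) ↦ (conj z, t)`. -/
def conjugation : ExtIsom :=
  .ofCosh (fun p => ⟨starRingEnd ℂ p.z, p.t, p.t_pos⟩) (fun p => ⟨starRingEnd ℂ p.z, p.t, p.t_pos⟩)
    (fun p => by simp) (fun p => by simp)
    (fun p q => by
      rw [cosh_dist, cosh_dist, ← map_sub, Complex.norm_conj])
    (Complex.conjLIE.toHomeomorph.prodCongr (Homeomorph.refl ℝ≥0)).onePointCongr
    (fun p => rfl)

@[simp] theorem conjugation_z (p : Hyp3) : (conjugation p).z = starRingEnd ℂ p.z := rfl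

@[simp] theorem conjugation_t (p : Hyp3) : (conjugation p).t = p.t := rfl

theorem conjugation_bar_coe (w : ℂ) :
    conjugation.bar (bdry w) = bdry (starRingEnd ℂ w : ℂ) := rfl

theorem conjugation_bar_infty :
    conjugation.bar (bdry OnePoint.infty) = bdry OnePoint.infty := rfl

/-- The square of the Euclidean distance to the origin. -/
def Hyp3.sq (p : Hyp3) : ℝ := ‖p.z‖ ^ 2 + p.t ^ 2

theorem Hyp3.sq_pos (p : Hyp3) : 0 < p.sq := by
  have := p.t_pos
  unfold Hyp3.sq
  positivity

/-- The square of the Euclidean norm on the closed upper half-space. -/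
def normSq (x : ℂ × ℝ≥0) : ℝ≥0 := ‖x.1‖₊ ^ 2 + x.2 ^ 2

theorem normSq_eq_zero {x : ℂ × ℝ≥0} : normSq x = 0 ↔ x = 0 := by
  rw [normSq, add_eq_zero, sq_eq_zero_iff, sq_eq_zero_iff, nnnorm_eq_zero, Prod.ext_iff]
  rfl

theorem dist_zero_eq_max (x : ℂ × ℝ≥0) : dist x 0 = max ‖x.1‖ (x.2 : ℝ) := by
  rw [Prod.dist_eq]
  simp [NNReal.dist_eq]

theorem dist_sq_le_normSq (x : ℂ × ℝ≥0) : dist x 0 ^ 2 ≤ normSq x := by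
  rw [dist_zero_eq_max]
  simp only [normSq, NNReal.coe_add, NNReal.coe_pow, coe_nnnorm]
  rcases max_cases ‖x.1‖ (x.2 : ℝ) with h | h <;> rw [h.1] <;> nlinarith [sq_nonneg ‖x.1‖, sq_nonneg (x.2 : ℝ)]

theorem normSq_le_dist_sq (x : ℂ × ℝ≥0) : normSq x ≤ 2 * dist x 0 ^ 2 := by
  rw [dist_zero_eq_max]
  simp only [normSq, NNReal.coe_add, NNReal.coe_pow, coe_nnnorm]
  have h1 := pow_le_pow_left₀ (norm_nonneg x.1) (le_max_left ‖x.1‖ (x.2 : ℝ)) 2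
  have h2 := pow_le_pow_left₀ x.2.2 (le_max_right ‖x.1‖ (x.2 : ℝ)) 2
  change (x.2 : ℝ) ^ 2 ≤ _ at h2
  linarith

/-- The inversion `x ↦ x / |x|²` in finite coordinates. -/
def invPoint (x : ℂ × ℝ≥0) : ℂ × ℝ≥0 := (((normSq x : ℝ) : ℂ)⁻¹ * x.1, (normSq x)⁻¹ * x.2)

theorem dist_invPoint (x : ℂ × ℝ≥0) : dist (invPoint x) 0 = (normSq x : ℝ)⁻¹ * dist x 0 := by
  rw [dist_zero_eq_max, dist_zero_eq_max, mul_max_of_nonneg _ _ (by positivity)]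
  simp [invPoint]

theorem normSq_invPoint (x : ℂ × ℝ≥0) : normSq (invPoint x) = (normSq x)⁻¹ := by
  rcases eq_or_ne (normSq x) 0 with h | h
  · have h0 : invPoint x = 0 := by simp [invPoint, h]
    rw [h, h0, inv_zero, normSq_eq_zero]
  · have hA : ∀ A : ℝ≥0, ‖((A : ℝ) : ℂ)⁻¹ * x.1‖₊ ^ 2 + (A⁻¹ * x.2) ^ 2 = A⁻¹ ^ 2 * normSq x :=
      fun A => by simp [normSq, mul_pow, mul_add]
    have : normSq (invPoint x) = (normSq x)⁻¹ ^ 2 * normSq x := hA _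
    rw [this]
    field_simp

theorem invPoint_invPoint (x : ℂ × ℝ≥0) (hx : x ≠ 0) : invPoint (invPoint x) = x := by
  have h : normSq x ≠ 0 := fun h => hx (normSq_eq_zero.1 h)
  have h' : ((normSq x : ℝ) : ℂ) ≠ 0 := by exact_mod_cast h
  rw [invPoint, normSq_invPoint]
  apply Prod.ext
  · simp [invPoint, h']
  · simp [invPoint, h]

theorem invPoint_ne_zero {x : ℂ × ℝ≥0} (hx : x ≠ 0) : invPoint x ≠ 0 := by
  intro h
  have := normSq_invPoint x
  rw [h, normSq_eq_zero.2 rfl, eq_comm, inv_eq_zero] at this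
  exact hx (normSq_eq_zero.1 this)

open Classical in
/-- The inversion in the unit sphere on the compactification of the upper half-space. -/
def invBar (x : HypBar) : HypBar :=
  x.elim ((0 : ℂ × ℝ≥0) : HypBar)
    (fun x => if x = 0 then OnePoint.infty else (invPoint x : HypBar))

theorem invBar_infty : invBar OnePoint.infty = ((0 : ℂ × ℝ≥0) : HypBar) := rfl

theorem invBar_zero : invBar ((0 : ℂ × ℝ≥0) : HypBar) = OnePoint.infty := if_pos rfl

theorem invBar_coe {x : ℂ × ℝ≥0} (hx : x ≠ 0) : invBar x = (invPoint x : HypBar) := if_neg hx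

theorem invBar_invBar (x : HypBar) : invBar (invBar x) = x := by
  induction x using OnePoint.rec with
  | infty => rw [invBar_infty, invBar_zero]
  | coe x =>
    by_cases hx : x = 0
    · rw [hx, invBar_zero, invBar_infty]
    · rw [invBar_coe hx, invBar_coe (invPoint_ne_zero hx), invPoint_invPoint x hx]

theorem continuous_normSq : Continuous normSq := by
  unfold normSq
  fun_prop

theorem continuous_invBar : Continuous invBar := by
  rw [continuous_iff_continuousAt]
  intro x
  induction x using OnePoint.rec with
  | infty =>
    rw [OnePoint.continuousAt_infty', invBar_infty, coclosedCompact_eq_cocompact,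
      ← Metric.cobounded_eq_cocompact]
    have hd : Tendsto (fun x : ℂ × ℝ≥0 => dist x 0) (Bornology.cobounded _) atTop :=
      tendsto_iff_comap.2 (Metric.comap_dist_right_atTop (0 : ℂ × ℝ≥0)).ge
    have h1 : Tendsto invPoint (Bornology.cobounded _) (𝓝 0) := by
      rw [tendsto_iff_dist_tendsto_zero]
      refine squeeze_zero' (Eventually.of_forall fun x => dist_nonneg) ?_ hd.inv_tendsto_atTop
      filter_upwards [hd.eventually_gt_atTop 0] with x hx
      have h2 := dist_sq_le_normSq x
      rw [dist_invPoint, Pi.inv_apply]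
      calc (normSq x : ℝ)⁻¹ * dist x 0 ≤ (dist x 0 ^ 2)⁻¹ * dist x 0 := by gcongr
        _ = _ := by field_simp
    refine ((OnePoint.continuous_coe.tendsto _).comp h1).congr' ?_
    filter_upwards [hd.eventually_gt_atTop 0] with x hx
    exact (invBar_coe (by rintro rfl; simp at hx)).symm
  | coe x =>
    rw [OnePoint.continuousAt_coe]
    by_cases hx : x = 0
    · subst hx
      rw [continuousAt_iff_punctured_nhds]
      have h0 : ∀ᶠ x : ℂ × ℝ≥0 in 𝓝[≠] 0, x ≠ 0 := self_mem_nhdsWithin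
      have hd : Tendsto (fun x : ℂ × ℝ≥0 => dist x 0) (𝓝[≠] 0) (𝓝[>] 0) := by
        rw [tendsto_nhdsWithin_iff]
        constructor
        · have : Continuous fun x : ℂ × ℝ≥0 => dist x 0 := by fun_prop
          simpa using (this.tendsto 0).mono_left nhdsWithin_le_nhds
        · filter_upwards [h0] with x hx
          exact dist_pos.2 hx
      have h1 : Tendsto invPoint (𝓝[≠] 0) (Bornology.cobounded _) := by
        rw [← Metric.comap_dist_right_atTop 0, tendsto_comap_iff]
        refine tendsto_atTop_mono' _ ?_
          ((tendsto_inv_nhdsGT_zero.comp hd).const_mul_atTop (one_half_pos (α := ℝ)))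
        filter_upwards [h0] with x hx
        have hp : 0 < dist x 0 := dist_pos.2 hx
        have hn : (0 : ℝ) < normSq x := (by positivity : 0 < dist x 0 ^ 2).trans_le
          (dist_sq_le_normSq x)
        have h2 := normSq_le_dist_sq x
        simp only [Function.comp, dist_invPoint]
        calc (1 / 2) * (dist x 0)⁻¹ = (2 * dist x 0 ^ 2)⁻¹ * dist x 0 := by field_simp
          _ ≤ _ := by gcongr
      rw [Metric.cobounded_eq_cocompact, ← coclosedCompact_eq_cocompact] at h1
      simp only [Function.comp, invBar_zero]
      refine (OnePoint.tendsto_coe_infty.comp h1).congr' ?_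
      filter_upwards [h0] with x hx
      exact (invBar_coe hx).symm
    · have hn : normSq x ≠ 0 := fun h => hx (normSq_eq_zero.1 h)
      have h1 : ContinuousAt invPoint x := by
        have hc := continuous_normSq.continuousAt (x := x)
        have hc' : ContinuousAt (fun x => ((normSq x : ℝ) : ℂ)) x := by fun_prop
        exact ((hc'.inv₀ (by exact_mod_cast hn)).mul continuousAt_fst).prodMk
          ((hc.inv₀ hn).mul continuousAt_snd)
      refine (OnePoint.continuous_coe.continuousAt.comp h1).congr ?_
      filter_upwards [isOpen_ne.mem_nhds hx] with y hy
      exact (invBar_coe hy).symm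

/-- The inversion in the unit hemisphere, `p ↦ p / |p|²`. -/
def inversion : ExtIsom :=
  let f : Hyp3 → Hyp3 := fun p =>
    ⟨((p.sq⁻¹ : ℝ) : ℂ) * p.z, p.sq⁻¹ * p.t, mul_pos (inv_pos.2 p.sq_pos) p.t_pos⟩
  have hsq : ∀ p, (f p).sq = p.sq⁻¹ := fun p => by
    have h := p.sq_pos
    have hA : ∀ A : ℝ, ‖((A⁻¹ : ℝ) : ℂ) * p.z‖ ^ 2 + (A⁻¹ * p.t) ^ 2 = A⁻¹ ^ 2 * p.sq :=
      fun A => by simp [Hyp3.sq, mul_pow, mul_add]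
    have : (f p).sq = p.sq⁻¹ ^ 2 * p.sq := hA _
    rw [this]
    field_simp
  have hinv : ∀ p, f (f p) = p := fun p => by
    have h := p.sq_pos.ne'
    have h' : (p.sq : ℂ) ≠ 0 := by exact_mod_cast h
    ext1
    · change (((f p).sq⁻¹ : ℝ) : ℂ) * (((p.sq⁻¹ : ℝ) : ℂ) * p.z) = p.z
      rw [hsq]
      push_cast
      field_simp
    · change (f p).sq⁻¹ * (p.sq⁻¹ * p.t) = p.t
      rw [hsq]
      field_simp
  .ofCosh f f hinv hinv
    (fun p q => by
      have hp := p.t_pos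
      have hq := q.t_pos
      have h1 := p.sq_pos
      have h2 := q.sq_pos
      rw [cosh_dist, cosh_dist]
      simp only [f, ← Complex.normSq_eq_norm_sq, Complex.normSq_apply, Complex.sub_re,
        Complex.sub_im, Complex.re_ofReal_mul, Complex.im_ofReal_mul]
      have e1 : p.sq = p.z.re ^ 2 + p.z.im ^ 2 + p.t ^ 2 := by
        rw [Hyp3.sq, ← Complex.normSq_eq_norm_sq, Complex.normSq_apply]; ring
      have e2 : q.sq = q.z.re ^ 2 + q.z.im ^ 2 + q.t ^ 2 := by
        rw [Hyp3.sq, ← Complex.normSq_eq_norm_sq, Complex.normSq_apply]; ring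
      generalize p.sq = A at *
      generalize q.sq = B at *
      field_simp
      linear_combination (A * B - B * B) * e1 + (A * B - A * A) * e2)
    ⟨⟨invBar, invBar, invBar_invBar, invBar_invBar⟩, continuous_invBar, continuous_invBar⟩
    (fun p => by
      have e : normSq (p.z, p.t.toNNReal) = p.sq := by
        simp [normSq, Hyp3.sq, p.t_pos.le]
      have h0 : (p.z, p.t.toNNReal) ≠ 0 := fun h => by
        have := e
        rw [h, normSq_eq_zero.2 rfl] at this
        exact p.sq_pos.ne this
      change invBar (toBar p) = toBar (f p)
      rw [← barOf_coord, ← barOf_coord, barOf]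
      change invBar ((p.z, p.t.toNNReal) : ℂ × ℝ≥0) = _
      rw [invBar_coe h0, barOf]
      congr 1
      apply Prod.ext
      · simp [invPoint, f, coord, e]
      · apply NNReal.eq
        have := mul_nonneg (inv_nonneg.2 p.sq_pos.le) p.t_pos.le
        simp [invPoint, f, coord, e, p.t_pos.le, this])

@[simp] theorem inversion_z (p : Hyp3) : (inversion p).z = ((p.sq⁻¹ : ℝ) : ℂ) * p.z := rfl

@[simp] theorem inversion_t (p : Hyp3) : (inversion p).t = p.sq⁻¹ * p.t := rfl

theorem inversion_bar_infty : inversion.bar (bdry OnePoint.infty) = bdry (0 : ℂ) := invBar_infty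

theorem inversion_bar_zero : inversion.bar (bdry (0 : ℂ)) = bdry OnePoint.infty := invBar_zero

theorem inversion_bar_coe {w : ℂ} (hw : w ≠ 0) :
    inversion.bar (bdry w) = bdry ((starRingEnd ℂ w)⁻¹ : ℂ) := by
  have h0 : ((w, 0) : ℂ × ℝ≥0) ≠ 0 := fun h => hw (congrArg Prod.fst h)
  rw [bdry_coe, bdry_coe]
  refine (invBar_coe h0).trans ?_
  congr 1
  apply Prod.ext
  · simp only [invPoint, normSq]
    have := Complex.conj_mul' w
    have h2 : starRingEnd ℂ w ≠ 0 := by simpa using hw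
    simp only [ne_eq, OfNat.ofNat_ne_zero, not_false_eq_true, zero_pow, add_zero, NNReal.coe_pow,
      coe_nnnorm, Complex.ofReal_pow, ← this]
    field_simp
  · simp [invPoint]

/-- Every Möbius transformation extends to an isometry of hyperbolic space (the Poincaré
extension). -/
theorem exists_poincare_extension (g : GL (Fin 2) ℂ) :
    ∃ T : ExtIsom, ∀ w, T.bar (bdry w) = bdry (g • w) := by
  have hdet : g 0 0 * g 1 1 - g 0 1 * g 1 0 ≠ 0 := by
    have := g.det_ne_zero
    rwa [Matrix.det_fin_two] at this
  by_cases hc : g 1 0 = 0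
  · have ha : g 0 0 ≠ 0 := by rintro h; simp [h, hc] at hdet
    have hd : g 1 1 ≠ 0 := by rintro h; simp [h, hc] at hdet
    refine ⟨similarity (g 0 0 / g 1 1) (g 0 1 / g 1 1) (div_ne_zero ha hd), fun w => ?_⟩
    induction w using OnePoint.rec with
    | infty => rw [similarity_bar_infty, OnePoint.smul_infty_eq_ite, if_pos hc]
    | coe w =>
      rw [similarity_bar_coe, OnePoint.smul_some_eq_ite, if_neg (by simpa [hc] using hd), hc]
      congr 2
      rw [zero_mul, zero_add]
      field_simp
  · -- `(a w + b) / (c w + d) = a / c - (det g / c) / (c w + d)`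
    have hk : -(g 0 0 * g 1 1 - g 0 1 * g 1 0) / g 1 0 ≠ 0 := div_ne_zero (neg_ne_zero.2 hdet) hc
    refine ⟨(((similarity (g 1 0) (g 1 1) hc).trans inversion).trans conjugation).trans
      (similarity _ (g 0 0 / g 1 0) hk), fun w => ?_⟩
    simp only [ExtIsom.trans_bar]
    induction w using OnePoint.rec with
    | infty =>
      rw [similarity_bar_infty, OnePoint.smul_infty_eq_ite, if_neg hc, inversion_bar_infty,
        conjugation_bar_coe, similarity_bar_coe]
      simp
    | coe w =>
      rw [similarity_bar_coe, OnePoint.smul_some_eq_ite]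
      split_ifs with h
      · rw [h, inversion_bar_zero, conjugation_bar_infty, similarity_bar_infty]
      · rw [inversion_bar_coe h, conjugation_bar_coe, similarity_bar_coe]
        congr 2
        rw [map_inv₀, Complex.conj_conj]
        field_simp
        ring

/-! ### Rigidity of isometries -/

theorem Hyp3.cosh_dist_re_im (p q : Hyp3) : Real.cosh (dist p q) =
    1 + ((p.z.re - q.z.re) ^ 2 + (p.z.im - q.z.im) ^ 2 + (p.t - q.t) ^ 2) / (2 * p.t * q.t) := by
  rw [cosh_dist, ← Complex.normSq_eq_norm_sq, Complex.normSq_apply, Complex.sub_re, Complex.sub_im]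
  ring

theorem Hyp3.ext_re_im {p q : Hyp3} (h1 : p.z.re = q.z.re) (h2 : p.z.im = q.z.im)
    (h3 : p.t = q.t) : p = q :=
  Hyp3.ext (Complex.ext h1 h2) h3

theorem exists_pos_coord_mem {p : Hyp3} {O : Set Hyp3} (hO : O ∈ 𝓝 p) :
    ∃ δ > 0, ∀ q : Hyp3, dist q.coord p.coord ≤ δ → q ∈ O := by
  rw [isInducing_coord.nhds_eq_comap, mem_comap] at hO
  obtain ⟨U, hU, hUO⟩ := hO
  obtain ⟨ε, hε, hb⟩ := Metric.mem_nhds_iff.1 hU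
  exact ⟨ε / 2, by positivity, fun q hq => hUO (hb (by
    rw [Metric.mem_ball]; linarith))⟩

/-- The distances to finitely many suitable points, which can be found in any open set, determine
a point. -/
theorem exists_list_dist_determines {p : Hyp3} {O : Set Hyp3} (hO : O ∈ 𝓝 p) :
    ∃ l : List Hyp3, (∀ x ∈ l, x ∈ O) ∧
      ∀ q q' : Hyp3, (∀ x ∈ l, dist x q = dist x q') → q = q' := by
  obtain ⟨δ, hδ, hb⟩ := exists_pos_coord_mem hO
  have hp := p.t_pos
  refine ⟨[p, ⟨p.z + δ, p.t, hp⟩, ⟨p.z + δ * Complex.I, p.t, hp⟩, ⟨p.z, p.t + δ, by linarith⟩],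
    ?_, ?_⟩
  · simp only [List.mem_cons, List.not_mem_nil, or_false]
    rintro x (rfl | rfl | rfl | rfl)
    · exact hb _ (by simp [hδ.le])
    all_goals exact hb _ (by simp [coord, dist_eq_norm, abs_of_pos hδ, hδ.le])
  · intro q q' h
    have hq := q.t_pos
    have hq' := q'.t_pos
    have key : ∀ x : Hyp3, dist x q = dist x q' →
        ((x.z.re - q.z.re) ^ 2 + (x.z.im - q.z.im) ^ 2 + (x.t ^ 2 + q.t ^ 2)) * q'.t =
        ((x.z.re - q'.z.re) ^ 2 + (x.z.im - q'.z.im) ^ 2 + (x.t ^ 2 + q'.t ^ 2)) * q.t := by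
      intro x hx
      have hxt := x.t_pos
      have h1 := congrArg Real.cosh hx
      rw [cosh_dist_re_im, cosh_dist_re_im] at h1
      field_simp at h1
      linear_combination h1
    have h0 := key p (h _ (by simp))
    have h1 := key ⟨p.z + δ, p.t, hp⟩ (h _ (by simp))
    have h2 := key ⟨p.z + δ * Complex.I, p.t, hp⟩ (h _ (by simp))
    have h3 := key ⟨p.z, p.t + δ, by linarith⟩ (h _ (by simp))
    simp only [Complex.add_re, Complex.add_im, Complex.ofReal_re, Complex.ofReal_im,
      Complex.re_ofReal_mul, Complex.im_ofReal_mul, Complex.I_re, Complex.I_im, mul_zero, mul_one,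
      add_zero] at h1 h2 h3
    have ht : q.t = q'.t := by
      have : (δ * (2 * p.t + δ)) * q.t = (δ * (2 * p.t + δ)) * q'.t := by
        linear_combination h0 - h3
      exact mul_left_cancel₀ (by positivity) this
    rw [ht] at h0 h1 h2
    have hre : q.z.re = q'.z.re := by
      have : (2 * δ * q'.t) * q.z.re = (2 * δ * q'.t) * q'.z.re := by
        linear_combination h0 - h1
      exact mul_left_cancel₀ (by positivity) this
    have him : q.z.im = q'.z.im := by
      have : (2 * δ * q'.t) * q.z.im = (2 * δ * q'.t) * q'.z.im := by
        linear_combination h0 - h2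
      exact mul_left_cancel₀ (by positivity) this
    exact ext_re_im hre him ht

theorem eq_of_dist_eq_of_mem_nhds {p : Hyp3} {O : Set Hyp3} (hO : O ∈ 𝓝 p) {q q' : Hyp3}
    (h : ∀ x ∈ O, dist x q = dist x q') : q = q' := by
  obtain ⟨l, hl, hd⟩ := exists_list_dist_determines hO
  exact hd q q' fun x hx => h x (hl x hx)

/-- Two isometries that agree on an open set are equal. -/
theorem ExtIsom.eq_of_eventuallyEq {T S : ExtIsom} {p : Hyp3} (h : ∀ᶠ x in 𝓝 p, T x = S x)
    (q : Hyp3) : T q = S q := by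
  have h1 : S.symm (T q) = q := by
    refine eq_of_dist_eq_of_mem_nhds h fun x hx => ?_
    have hx' : T x = S x := hx
    rw [← S.dist_eq, apply_symm_apply, ← hx', T.dist_eq]
  rw [← h1, apply_symm_apply, h1]

/-- The reflection in the perpendicular bisector of two points. -/
theorem exists_reflection {x y : Hyp3} (hxy : x ≠ y) :
    ∃ R : ExtIsom, R y = x ∧ ∀ q, dist q x = dist q y → R q = q := by
  have hx := x.t_pos
  have hy := y.t_pos
  by_cases ht : x.t = y.t
  · -- the bisector is a vertical plane
    have hd : x.z - y.z ≠ 0 := fun h => hxy (Hyp3.ext (sub_eq_zero.1 h) ht)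
    have hd' : starRingEnd ℂ (x.z - y.z) ≠ 0 := fun h => hd ((map_eq_zero _).1 h)
    have ha : -((x.z - y.z) / starRingEnd ℂ (x.z - y.z)) ≠ 0 := neg_ne_zero.2 (div_ne_zero hd hd')
    have hn : ‖-((x.z - y.z) / starRingEnd ℂ (x.z - y.z))‖ = 1 := by
      rw [norm_neg, norm_div, Complex.norm_conj, div_self (norm_ne_zero_iff.2 hd)]
    refine ⟨conjugation.trans (similarity _ ((x.z + y.z) / 2 + (x.z - y.z) /
      starRingEnd ℂ (x.z - y.z) * starRingEnd ℂ ((x.z + y.z) / 2)) ha), ?_, fun q hq => ?_⟩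
    · ext1
      · simp only [ExtIsom.trans_apply, similarity_z, conjugation_z]
        field_simp
        simp only [map_add, map_sub, map_div₀, map_ofNat]
        ring
      · simp only [ExtIsom.trans_apply, similarity_t, conjugation_t, hn, ht, one_mul]
    · have h1 := congrArg Real.cosh hq
      have hqt := q.t_pos
      rw [cosh_dist_re_im, cosh_dist_re_im, ht] at h1
      field_simp at h1
      ext1
      · simp only [ExtIsom.trans_apply, similarity_z, conjugation_z]
        field_simp
        simp only [map_add, map_sub, map_div₀, map_ofNat]
        apply Complex.ext
        · simp
          linear_combination 2 * h1
        · simp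
          ring
      · simp only [ExtIsom.trans_apply, similarity_t, conjugation_t, hn, one_mul]
  · -- the bisector is a hemisphere with centre `c`, the intersection of the line `xy` with `ℂ`
    have hd : y.t - x.t ≠ 0 := fun h => ht (sub_eq_zero.1 h).symm
    have hd' : ((y.t - x.t : ℝ) : ℂ) ≠ 0 := by exact_mod_cast hd
    obtain ⟨w, hw⟩ : ∃ w : ℂ, w = (y.z - x.z) / ((y.t - x.t : ℝ) : ℂ) := ⟨_, rfl⟩
    obtain ⟨c, hc⟩ : ∃ c : ℂ, c = x.z - x.t * w := ⟨_, rfl⟩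
    have hxz : x.z = c + x.t * w := by rw [hc]; ring
    have hyz : y.z = c + y.t * w := by
      have h1 : ((y.t - x.t : ℝ) : ℂ) * w = y.z - x.z := by rw [hw]; field_simp
      push_cast at h1
      rw [hc]
      linear_combination -h1
    obtain ⟨s, hs⟩ : ∃ s : ℝ, s = x.t * y.t * (‖w‖ ^ 2 + 1) := ⟨_, rfl⟩
    have hs0 : 0 < s := by rw [hs]; positivity
    have hs0' : (s : ℂ) ≠ 0 := by exact_mod_cast hs0.ne'
    have hns : ‖(s : ℂ)‖ = s := by simp [hs0.le]
    refine ⟨((similarity 1 (-c) one_ne_zero).trans inversion).trans (similarity s c hs0'), ?_,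
      fun q hq => ?_⟩
    · have h1 : (similarity 1 (-c) one_ne_zero y).sq = y.t ^ 2 * (‖w‖ ^ 2 + 1) := by
        simp only [Hyp3.sq, similarity_z, similarity_t, hyz]
        have : 1 * (c + y.t * w) + -c = y.t * w := by ring
        rw [this]
        simp [mul_pow]
        ring
      have hw1 : ‖w‖ ^ 2 + 1 ≠ 0 := by positivity
      have hsc : s * (y.t ^ 2 * (‖w‖ ^ 2 + 1))⁻¹ * y.t = x.t := by
        rw [hs]; field_simp
      ext1
      · simp only [ExtIsom.trans_apply, similarity_z, inversion_z, h1, hyz, hxz]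
        have : (x.t : ℂ) = ((s * (y.t ^ 2 * (‖w‖ ^ 2 + 1))⁻¹ * y.t : ℝ) : ℂ) := by rw [hsc]
        rw [this]
        push_cast
        ring
      · simp only [ExtIsom.trans_apply, similarity_t, inversion_t, h1, hns, norm_one, one_mul]
        rw [← mul_assoc, hsc]
    · have hqt := q.t_pos
      have h1 := congrArg Real.cosh hq
      have h2 : (similarity 1 (-c) one_ne_zero q).sq = s := by
        rw [cosh_dist_re_im, cosh_dist_re_im] at h1
        field_simp at h1
        rw [hxz, hyz] at h1
        simp only [Complex.add_re, Complex.add_im, Complex.re_ofReal_mul,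
          Complex.im_ofReal_mul] at h1
        rw [hs]
        simp only [Hyp3.sq, similarity_z, similarity_t, ← Complex.normSq_eq_norm_sq,
          Complex.normSq_apply]
        simp
        apply mul_left_cancel₀ hd
        linear_combination h1
      ext1
      · simp only [ExtIsom.trans_apply, similarity_z, inversion_z, h2]
        push_cast
        field_simp
        ring
      · simp only [ExtIsom.trans_apply, similarity_t, inversion_t, h2, hns, norm_one, one_mul]
        field_simp

theorem exists_extIsom_list (f : Hyp3 → Hyp3) (l : List Hyp3)
    (h : ∀ a ∈ l, ∀ b ∈ l, dist (f a) (f b) = dist a b) : ∃ T : ExtIsom, ∀ a ∈ l, T (f a) = a := by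
  induction l with
  | nil => exact ⟨.refl, by simp⟩
  | cons x l ih =>
    obtain ⟨T, hT⟩ := ih fun a ha b hb => h a (by simp [ha]) b (by simp [hb])
    by_cases hx : T (f x) = x
    · exact ⟨T, by simpa [hx] using hT⟩
    · obtain ⟨R, hR, hfix⟩ := exists_reflection (Ne.symm hx)
      refine ⟨T.trans R, ?_⟩
      simp only [List.mem_cons, ExtIsom.trans_apply]
      rintro a (rfl | ha)
      · exact hR
      · rw [hT a ha]
        apply hfix
        conv_rhs => rw [← hT a ha, T.dist_eq, h a (by simp [ha]) x (by simp)]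

/-- A map that preserves distances on a neighbourhood of a point of hyperbolic space is there the
restriction of an isometry. -/
theorem exists_extIsom_of_isometric {f : Hyp3 → Hyp3} {p : Hyp3} {W : Set Hyp3} (hW : W ∈ 𝓝 p)
    (hf : ∀ a ∈ W, ∀ b ∈ W, edist (f a) (f b) = edist a b) : ∃ T : ExtIsom, ∀ a ∈ W, f a = T a := by
  have hf' : ∀ a ∈ W, ∀ b ∈ W, dist (f a) (f b) = dist a b := fun a ha b hb => by
    rw [dist_edist, dist_edist, hf a ha b hb]
  obtain ⟨l, hl, hd⟩ := exists_list_dist_determines hW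
  obtain ⟨T, hT⟩ := exists_extIsom_list f l fun a ha b hb => hf' a (hl a ha) b (hl b hb)
  refine ⟨T.symm, fun a ha => ?_⟩
  have : T (f a) = a := hd _ _ fun x hx => by
    conv_lhs => rw [← hT x hx, T.dist_eq, hf' x (hl x hx) a ha]
  rw [← this, T.symm_apply_apply, this]

/-! ### Isometries and ideal points -/

/-- The horospherical distance function of the ideal point `w`: half of the Poisson-type quotient
`(|w - z|² + t²) / t`. -/
def horo (w : ℂ) (q : Hyp3) : ℝ := (‖w - q.z‖ ^ 2 + q.t ^ 2) / (2 * q.t)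

theorem horo_pos (w : ℂ) (q : Hyp3) : 0 < horo w q := by
  have := q.t_pos
  unfold horo
  positivity

theorem tendsto_t_mul_cosh_dist (w : ℂ) (q : Hyp3) :
    Tendsto (fun p : Hyp3 => p.t * Real.cosh (dist p q)) (idealNhds w) (𝓝 (horo w q)) := by
  have hq := q.t_pos
  have e : (fun p : Hyp3 => p.t * Real.cosh (dist p q)) =
      fun p => p.t + (‖p.z - q.z‖ ^ 2 + (p.t - q.t) ^ 2) / (2 * q.t) := by
    funext p
    have hp := p.t_pos
    rw [cosh_dist]
    field_simp
  rw [e]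
  have hz := tendsto_z_idealNhds w
  have ht := tendsto_t_idealNhds w
  have := ht.add ((((hz.sub_const q.z).norm.pow 2).add ((ht.sub_const q.t).pow 2)).div_const
    (2 * q.t))
  simpa [horo] using this

/-- An isometry multiplies the horospherical distance functions by a constant. -/
theorem ExtIsom.exists_horo_eq (T : ExtIsom) {w w' : ℂ} (h : T.bar (bdry w) = bdry w') :
    ∃ k : ℝ, 0 < k ∧ Tendsto (fun p => (T p).t / p.t) (idealNhds w) (𝓝 k) ∧
      ∀ q, horo w' (T q) = k * horo w q := by
  have key : ∀ q, Tendsto (fun p => (T p).t / p.t) (idealNhds w)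
      (𝓝 (horo w' (T q) / horo w q)) := by
    intro q
    have h1 := (tendsto_t_mul_cosh_dist w' (T q)).comp (T.tendsto_idealNhds h)
    refine (h1.div (tendsto_t_mul_cosh_dist w q) (horo_pos w q).ne').congr fun p => ?_
    have := Real.cosh_pos (dist p q)
    have := p.t_pos
    change (T p).t * Real.cosh (dist (T p) (T q)) / (p.t * Real.cosh (dist p q)) = _
    rw [T.dist_eq]
    field_simp
  have q₀ : Hyp3 := ⟨0, 1, one_pos⟩
  refine ⟨_, div_pos (horo_pos w' (T q₀)) (horo_pos w q₀), key q₀, fun q => ?_⟩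
  rw [tendsto_nhds_unique (key q₀) (key q)]
  field_simp [(horo_pos w q).ne']

/-- An isometry that fixes all ideal points of an open set is the identity. -/
theorem ExtIsom.eq_of_bar_eq_self (T : ExtIsom) {w₀ : ℂ}
    (h : ∀ᶠ w : ℂ in 𝓝 w₀, T.bar (bdry w) = bdry w) (q : Hyp3) : T q = q := by
  obtain ⟨δ, hδ, hb⟩ := Metric.eventually_nhds_iff.1 h
  choose! k hk0 hk hkq using fun (w : ℂ) (hw : T.bar (bdry w) = bdry w) => T.exists_horo_eq hw
  -- the constants of two different fixed points are inverse to each other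
  have hmul : ∀ w₁ w₂ : ℂ, w₁ ≠ w₂ → T.bar (bdry w₁) = bdry w₁ → T.bar (bdry w₂) = bdry w₂ →
      k w₁ * k w₂ = 1 := by
    intro w₁ w₂ hne h1 h2
    have hlim : Tendsto (fun x : Hyp3 × Hyp3 => x.1.t * x.2.t * Real.cosh (dist x.1 x.2))
        (idealNhds w₁ ×ˢ idealNhds w₂) (𝓝 (‖w₁ - w₂‖ ^ 2 / 2)) := by
      have e : (fun x : Hyp3 × Hyp3 => x.1.t * x.2.t * Real.cosh (dist x.1 x.2)) =
          fun x => x.1.t * x.2.t + (‖x.1.z - x.2.z‖ ^ 2 + (x.1.t - x.2.t) ^ 2) / 2 := by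
        funext x
        have h1 := x.1.t_pos
        have h2 := x.2.t_pos
        rw [cosh_dist]
        field_simp
      rw [e]
      have t1 := (tendsto_t_idealNhds w₁).comp (tendsto_fst (g := idealNhds w₂))
      have t2 := (tendsto_t_idealNhds w₂).comp (tendsto_snd (f := idealNhds w₁))
      have z1 := (tendsto_z_idealNhds w₁).comp (tendsto_fst (g := idealNhds w₂))
      have z2 := (tendsto_z_idealNhds w₂).comp (tendsto_snd (f := idealNhds w₁))
      simpa [Function.comp_def] using
        (t1.mul t2).add ((((z1.sub z2).norm.pow 2).add ((t1.sub t2).pow 2)).div_const 2)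
    have h0 : ‖w₁ - w₂‖ ^ 2 / 2 ≠ 0 := by
      have := norm_pos_iff.2 (sub_ne_zero.2 hne)
      positivity
    have hT := hlim.comp ((T.tendsto_idealNhds h1).prodMap (T.tendsto_idealNhds h2))
    have hq := hT.div hlim h0
    rw [div_self h0] at hq
    have hk' := ((hk w₁ h1).comp (tendsto_fst (g := idealNhds w₂))).mul
      ((hk w₂ h2).comp (tendsto_snd (f := idealNhds w₁)))
    refine tendsto_nhds_unique hk' (hq.congr fun x => ?_)
    have := Real.cosh_pos (dist x.1 x.2)
    have := x.1.t_pos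
    have := x.2.t_pos
    simp only [Function.comp, Prod.map, T.dist_eq, Pi.div_apply]
    field_simp
  have fix : ∀ a : ℂ, ‖a‖ < δ → T.bar (bdry (w₀ + a : ℂ)) = bdry (w₀ + a : ℂ) :=
    fun a ha => hb (by simpa [dist_eq_norm] using ha)
  have hone : ∀ a : ℂ, ‖a‖ < δ / 2 → k (w₀ + a) = 1 := by
    intro a ha
    have e1 : ‖a + (δ / 4 : ℝ)‖ < δ := by
      have : ‖((δ / 4 : ℝ) : ℂ)‖ = δ / 4 := by simp only [Complex.norm_real, Real.norm_eq_abs, abs_of_pos (by positivity : 0 < δ / 4)]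
      linarith [norm_add_le a ((δ / 4 : ℝ) : ℂ)]
    have e2 : ‖a - (δ / 4 : ℝ)‖ < δ := by
      have : ‖((δ / 4 : ℝ) : ℂ)‖ = δ / 4 := by simp only [Complex.norm_real, Real.norm_eq_abs, abs_of_pos (by positivity : 0 < δ / 4)]
      linarith [norm_sub_le a ((δ / 4 : ℝ) : ℂ)]
    have hd : ((δ / 4 : ℝ) : ℂ) ≠ 0 := by exact_mod_cast (by positivity : δ / 4 ≠ 0)
    have n1 : w₀ + a ≠ w₀ + (a + (δ / 4 : ℝ)) := by
      intro h; apply hd; linear_combination -h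
    have n2 : w₀ + a ≠ w₀ + (a - (δ / 4 : ℝ)) := by
      intro h; apply hd; linear_combination h
    have n3 : w₀ + (a + (δ / 4 : ℝ)) ≠ w₀ + (a - (δ / 4 : ℝ)) := by
      intro h; apply hd; linear_combination h / 2
    have f0 := fix a (by linarith)
    have m1 := hmul _ _ n1 f0 (fix _ e1)
    have m2 := hmul _ _ n2 f0 (fix _ e2)
    have m3 := hmul _ _ n3 (fix _ e1) (fix _ e2)
    have p0 := hk0 _ f0
    generalize k (w₀ + a) = x at *
    generalize k (w₀ + (a + (δ / 4 : ℝ))) = y at *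
    generalize k (w₀ + (a - (δ / 4 : ℝ))) = z at *
    have : x * x = 1 := by
      calc x * x = x * x * (y * z) := by rw [m3, mul_one]
        _ = (x * y) * (x * z) := by ring
        _ = 1 := by rw [m1, m2, one_mul]
    nlinarith
  have heq : ∀ a : ℂ, ‖a‖ < δ / 2 →
      ((w₀.re + a.re - (T q).z.re) ^ 2 + (w₀.im + a.im - (T q).z.im) ^ 2 + (T q).t ^ 2) * q.t =
      ((w₀.re + a.re - q.z.re) ^ 2 + (w₀.im + a.im - q.z.im) ^ 2 + q.t ^ 2) * (T q).t := by
    intro a ha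
    have h1 := hkq _ (fix a (by linarith)) q
    rw [hone a ha, one_mul, horo, horo] at h1
    have hq := q.t_pos
    have hTq := (T q).t_pos
    simp only [← Complex.normSq_eq_norm_sq, Complex.normSq_apply, Complex.sub_re, Complex.sub_im,
      Complex.add_re, Complex.add_im] at h1
    field_simp at h1
    linear_combination h1
  have hr : ∀ s : ℝ, ‖((s : ℝ) : ℂ)‖ = |s| := fun s => by simp
  have hi : ∀ s : ℝ, ‖((s : ℝ) : ℂ) * Complex.I‖ = |s| := fun s => by simp
  have hs : |δ / 4| < δ / 2 := by rw [abs_of_pos (by positivity)]; linarith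
  have h0 := heq 0 (by simp [hδ])
  have h1 := heq ((δ / 4 : ℝ) : ℂ) (by rw [hr]; exact hs)
  have h2 := heq ((-(δ / 4) : ℝ) : ℂ) (by rw [hr, abs_neg]; exact hs)
  have h3 := heq (((δ / 4 : ℝ) : ℂ) * Complex.I) (by rw [hi]; exact hs)
  simp only [Complex.ofReal_re, Complex.ofReal_im, Complex.re_ofReal_mul, Complex.im_ofReal_mul,
    Complex.I_re, Complex.I_im, mul_zero, mul_one, add_zero, Complex.zero_re,
    Complex.zero_im] at h0 h1 h2 h3
  have hq := q.t_pos
  have ht : (T q).t = q.t := by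
    have : (2 * (δ / 4) ^ 2) * (T q).t = (2 * (δ / 4) ^ 2) * q.t := by
      linear_combination 2 * h0 - h1 - h2
    exact mul_left_cancel₀ (by positivity) this
  rw [ht] at h0 h1 h3
  refine ext_re_im ?_ ?_ ht
  · have : (δ / 2 * q.t) * (T q).z.re = (δ / 2 * q.t) * q.z.re := by
      linear_combination h0 - h1
    exact mul_left_cancel₀ (by positivity) this
  · have : (δ / 2 * q.t) * (T q).z.im = (δ / 2 * q.t) * q.z.im := by
      linear_combination h0 - h3
    exact mul_left_cancel₀ (by positivity) this

theorem ExtIsom.eq_of_bar_eq {T S : ExtIsom} {w₀ : ℂ}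
    (h : ∀ᶠ w : ℂ in 𝓝 w₀, T.bar (bdry w) = S.bar (bdry w)) (q : Hyp3) : T q = S q := by
  have := (T.trans S.symm).eq_of_bar_eq_self (w₀ := w₀) (by
    filter_upwards [h] with w hw
    rw [trans_bar, hw, symm_bar_bar]) q
  rw [trans_apply] at this
  conv_rhs => rw [← this, apply_symm_apply]

/-! ### Locally isometric maps -/

section LocalIsometry

variable {X Y Z : Type*}

/-- The map `f` preserves distances on a neighbourhood of `x`. -/
def IsometricAt [PseudoEMetricSpace X] [PseudoEMetricSpace Y] (f : X → Y) (x : X) : Prop :=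
  ∃ W ∈ 𝓝 x, ∀ a ∈ W, ∀ b ∈ W, edist (f a) (f b) = edist a b

/-- The map `f` is an isometry from a neighbourhood of `x` onto a neighbourhood of `f x`. -/
def OpenIsometricAt [PseudoEMetricSpace X] [PseudoEMetricSpace Y] (f : X → Y) (x : X) : Prop :=
  IsometricAt f x ∧ 𝓝 (f x) ≤ map f (𝓝 x)

section Pseudo

variable [PseudoEMetricSpace X] [PseudoEMetricSpace Y] [PseudoEMetricSpace Z]

theorem IsometricAt.eventually {f : X → Y} {x : X} (h : IsometricAt f x) :
    ∀ᶠ y in 𝓝 x, IsometricAt f y := by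
  obtain ⟨W, hW, hf⟩ := h
  filter_upwards [eventually_mem_nhds_iff.2 hW] with y hy
  exact ⟨W, hy, hf⟩

theorem IsometricAt.continuousAt {f : X → Y} {x : X} (h : IsometricAt f x) :
    ContinuousAt f x := by
  obtain ⟨W, hW, hf⟩ := h
  rw [ContinuousAt, tendsto_iff_edist_tendsto_0]
  have : Tendsto (fun y => edist y x) (𝓝 x) (𝓝 0) := tendsto_iff_edist_tendsto_0.1 tendsto_id
  refine this.congr' ?_
  filter_upwards [hW] with y hy
  exact (hf y hy x (mem_of_mem_nhds hW)).symm

theorem IsometricAt.congr {f g : X → Y} {x : X} (h : IsometricAt f x) (hfg : f =ᶠ[𝓝 x] g) :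
    IsometricAt g x := by
  obtain ⟨W, hW, hf⟩ := h
  refine ⟨W ∩ {y | f y = g y}, inter_mem hW hfg, fun a ha b hb => ?_⟩
  rw [← show f a = g a from ha.2, ← show f b = g b from hb.2, hf a ha.1 b hb.1]

theorem IsometricAt.comp {g : Y → Z} {f : X → Y} {x : X} (hg : IsometricAt g (f x))
    (hf : IsometricAt f x) : IsometricAt (fun y => g (f y)) x := by
  have hc := hf.continuousAt
  obtain ⟨W, hW, hf⟩ := hf
  obtain ⟨V, hV, hg⟩ := hg
  exact ⟨W ∩ f ⁻¹' V, inter_mem hW (hc hV), fun a ha b hb => by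
    rw [hg _ ha.2 _ hb.2, hf _ ha.1 _ hb.1]⟩

/-- A continuous local right inverse of a local isometry is a local isometry. -/
theorem IsometricAt.of_rightInverse {h : Y → X} {f : X → Y} {x : X} (hh : IsometricAt h (f x))
    (hf : ContinuousAt f x) (hinv : ∀ᶠ y in 𝓝 x, h (f y) = y) : IsometricAt f x := by
  obtain ⟨V, hV, hh⟩ := hh
  refine ⟨f ⁻¹' V ∩ {y | h (f y) = y}, inter_mem (hf hV) hinv, fun a ha b hb => ?_⟩
  rw [← hh _ ha.1 _ hb.1, show h (f a) = a from ha.2, show h (f b) = b from hb.2]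

theorem OpenIsometricAt.comp {g : Y → Z} {f : X → Y} {x : X} (hg : OpenIsometricAt g (f x))
    (hf : OpenIsometricAt f x) : OpenIsometricAt (fun y => g (f y)) x :=
  ⟨hg.1.comp hf.1, hg.2.trans (map_mono hf.2)⟩

theorem OpenIsometricAt.map_nhds {f : X → Y} {x : X} (h : OpenIsometricAt f x) :
    map f (𝓝 x) = 𝓝 (f x) :=
  le_antisymm h.1.continuousAt h.2

end Pseudo

variable [EMetricSpace X] [EMetricSpace Y] [EMetricSpace Z]

theorem IsometricAt.eventually_eq_of_eq {f : X → Y} {x : X} (h : IsometricAt f x) :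
    ∀ᶠ p : X × X in 𝓝 (x, x), f p.1 = f p.2 → p.1 = p.2 := by
  obtain ⟨W, hW, hf⟩ := h
  filter_upwards [prod_mem_nhds hW hW] with p hp he
  rw [← edist_eq_zero, ← hf _ hp.1 _ hp.2, he, edist_self]

theorem OpenIsometricAt.exists_inverse {f : X → Y} {x : X} (h : OpenIsometricAt f x) :
    ∃ g : Y → X, OpenIsometricAt g (f x) ∧ (∀ᶠ y in 𝓝 (f x), f (g y) = y) ∧
      ∀ᶠ y in 𝓝 x, g (f y) = y := by
  obtain ⟨⟨W, hW, hf⟩, hmap⟩ := h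
  have : Nonempty X := ⟨x⟩
  have hinj : InjOn f W := fun a ha b hb he => by
    rw [← edist_eq_zero, ← hf _ ha _ hb, he, edist_self]
  have hl : ∀ a ∈ W, Function.invFunOn f W (f a) = a := fun a ha => hinj.leftInvOn_invFunOn ha
  have himg : f '' W ∈ 𝓝 (f x) := hmap (image_mem_map hW)
  refine ⟨Function.invFunOn f W, ⟨⟨f '' W, himg, ?_⟩, ?_⟩, ?_, ?_⟩
  · rintro _ ⟨a, ha, rfl⟩ _ ⟨b, hb, rfl⟩
    rw [hl a ha, hl b hb, hf a ha b hb]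
  · rw [hl x (mem_of_mem_nhds hW)]
    intro V hV
    have hc : ContinuousAt f x := IsometricAt.continuousAt ⟨W, hW, hf⟩
    have : f ⁻¹' (Function.invFunOn f W ⁻¹' V) ∈ 𝓝 x := hc hV
    filter_upwards [this, hW] with y hy hyW
    rwa [mem_preimage, mem_preimage, hl y hyW] at hy
  · filter_upwards [himg]
    rintro _ ⟨a, ha, rfl⟩
    rw [hl a ha]
  · filter_upwards [hW] with a ha using hl a ha

theorem openIsometricAt_of_image {f : X → Y} {x : X} {W : Set X} (hW : W ∈ 𝓝 x)
    (hf : ∀ a ∈ W, ∀ b ∈ W, edist (f a) (f b) = edist a b) (himg : f '' W ∈ 𝓝 (f x)) :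
    OpenIsometricAt f x := by
  refine ⟨⟨W, hW, hf⟩, fun V hV => ?_⟩
  -- the image of `V` contains all points of `f '' W` at a small distance from `f x`
  obtain ⟨ε, hε, hb⟩ := EMetric.mem_nhds_iff.1 (mem_map.1 hV)
  filter_upwards [himg, Metric.eball_mem_nhds (f x) hε]
  rintro _ ⟨a, ha, rfl⟩ hd
  rw [Metric.mem_eball, hf a ha x (mem_of_mem_nhds hW)] at hd
  exact hb hd

theorem locallyModelled_iff {x : X} :
    LocallyModelled Y x ↔ ∃ f : X → Y, OpenIsometricAt f x := by
  constructor
  · rintro ⟨f, W, hW, hf, himg⟩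
    exact ⟨f, openIsometricAt_of_image hW hf himg⟩
  · rintro ⟨f, ⟨W, hW, hf⟩, hmap⟩
    exact ⟨f, W, hW, hf, hmap (image_mem_map hW)⟩

theorem OpenIsometricAt.eventually {f : X → Y} {x : X} (h : OpenIsometricAt f x) :
    ∀ᶠ y in 𝓝 x, OpenIsometricAt f y := by
  have hc := h.1.continuousAt
  obtain ⟨⟨W, hW, hf⟩, hmap⟩ := h
  filter_upwards [eventually_mem_nhds_iff.2 hW,
    hc.eventually (eventually_mem_nhds_iff.2 (hmap (image_mem_map hW)))] with y h1 h2
  exact openIsometricAt_of_image h1 hf h2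

theorem OpenIsometricAt.locallyModelled_iff {f : X → Z} {x : X} (h : OpenIsometricAt f x) :
    LocallyModelled Y (f x) ↔ LocallyModelled Y x := by
  rw [ConeManifold.locallyModelled_iff, ConeManifold.locallyModelled_iff]
  constructor
  · rintro ⟨g, hg⟩
    exact ⟨_, hg.comp h⟩
  · rintro ⟨g, hg⟩
    obtain ⟨k, hk, -, hkf⟩ := h.exists_inverse
    rw [← hkf.self_of_nhds] at hg
    exact ⟨_, hg.comp hk⟩

end LocalIsometry

theorem ExtIsom.isometricAt (T : ExtIsom) (p : Hyp3) : IsometricAt T p :=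
  ⟨univ, univ_mem, fun a _ b _ => T.edist_eq a b⟩

theorem ExtIsom.map_nhds (T : ExtIsom) (p : Hyp3) : map T (𝓝 p) = 𝓝 (T p) :=
  T.toFun.toHomeomorph.map_nhds_eq p

theorem IsometricAt.exists_extIsom {f : Hyp3 → Hyp3} {p : Hyp3} (h : IsometricAt f p) :
    ∃ T : ExtIsom, ∀ᶠ q in 𝓝 p, f q = T q := by
  obtain ⟨W, hW, hf⟩ := h
  obtain ⟨T, hT⟩ := exists_extIsom_of_isometric hW hf
  exact ⟨T, by filter_upwards [hW] with q hq using hT q hq⟩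

/-! ### Identity principles on connected sets -/

/-- Two maps that agree near one point of a preconnected set agree near all of its points, if
agreement near points arbitrarily close to `x` implies agreement near `x`. -/
theorem eventuallyEq_of_isPreconnected {α β : Type*} [TopologicalSpace α] {s : Set α}
    (hs : IsPreconnected s) {f g : α → β}
    (h : ∀ x ∈ s, (∃ᶠ y in 𝓝 x, ∀ᶠ z in 𝓝 y, f z = g z) → ∀ᶠ z in 𝓝 x, f z = g z)
    {x₀ : α} (h₀ : x₀ ∈ s) (he : ∀ᶠ z in 𝓝 x₀, f z = g z) {x : α} (hx : x ∈ s) :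
    ∀ᶠ z in 𝓝 x, f z = g z := by
  have := hs.subset_of_closure_inter_subset (u := {x | ∀ᶠ z in 𝓝 x, f z = g z})
    isOpen_setOfPred_eventually_nhds ⟨x₀, h₀, he⟩ fun y hy => h y hy.2 (mem_closure_iff_frequently.1 hy.1)
  exact this hx

/-- On a preconnected set, a locally isometric map into hyperbolic space is the restriction of an
isometry. -/
theorem exists_extIsom_of_isPreconnected {s : Set Hyp3} (hs : IsPreconnected s) (hne : s.Nonempty)
    {f : Hyp3 → Hyp3} (hf : ∀ p ∈ s, IsometricAt f p) : ∃ T : ExtIsom, ∀ p ∈ s, f p = T p := by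
  obtain ⟨p₀, hp₀⟩ := hne
  obtain ⟨T, hT⟩ := (hf p₀ hp₀).exists_extIsom
  refine ⟨T, fun p hp => Eventually.self_of_nhds (p := fun q => f q = T q) ?_⟩
  refine eventuallyEq_of_isPreconnected hs (fun x hx hfr => ?_) hp₀ hT hp
  obtain ⟨S, hS⟩ := (hf x hx).exists_extIsom
  obtain ⟨y, hy, hy'⟩ := (hfr.and_eventually (eventually_eventually_nhds.2 hS)).exists
  have hTS : ∀ q, S q = T q := ExtIsom.eq_of_eventuallyEq (p := y) (by
    filter_upwards [hy, hy'] with z h1 h2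
    rw [← h1, ← h2])
  filter_upwards [hS] with z hz
  rw [hz, hTS]

/-- On a preconnected set, a function that locally is a distance function to a point is the
distance function to one point. -/
theorem dist_eq_of_isPreconnected {s : Set Hyp3} (hs : IsPreconnected s) {f : Hyp3 → ℝ}
    (hf : ∀ p ∈ s, ∃ o : Hyp3, ∀ᶠ q in 𝓝 p, f q = dist q o) {p₀ : Hyp3} (hp₀ : p₀ ∈ s)
    {o₀ : Hyp3} (h₀ : ∀ᶠ q in 𝓝 p₀, f q = dist q o₀) : ∀ p ∈ s, f p = dist p o₀ := by
  refine fun p hp => Eventually.self_of_nhds (p := fun q => f q = dist q o₀) ?_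
  refine eventuallyEq_of_isPreconnected hs (fun x hx hfr => ?_) hp₀ h₀ hp
  obtain ⟨o, ho⟩ := hf x hx
  obtain ⟨y, hy, hy'⟩ := (hfr.and_eventually (eventually_eventually_nhds.2 ho)).exists
  have : o = o₀ := eq_of_dist_eq_of_mem_nhds (hy.and hy') fun z hz => by
    rw [← hz.1, ← hz.2]
  rwa [← this]

/-- Two locally isometric maps from hyperbolic space to points with hyperbolic neighbourhoods agree
near all points of a preconnected set if they agree near one. -/
theorem eventuallyEq_of_isometricAt {X : Type*} [EMetricSpace X] {s : Set Hyp3}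
    (hs : IsPreconnected s) {f g : Hyp3 → X} (hf : ∀ p ∈ s, IsometricAt f p)
    (hg : ∀ p ∈ s, IsometricAt g p) (hX : ∀ p ∈ s, LocallyModelled Hyp3 (f p))
    {x₀ : Hyp3} (h₀ : x₀ ∈ s) (he : ∀ᶠ z in 𝓝 x₀, f z = g z) {x : Hyp3} (hx : x ∈ s) :
    ∀ᶠ z in 𝓝 x, f z = g z := by
  refine eventuallyEq_of_isPreconnected hs (fun x hx hfr => ?_) h₀ he hx
  have hfc := (hf x hx).continuousAt
  have hgc := (hg x hx).continuousAt
  have hfg : f x = g x := by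
    by_contra hne
    exact hfr (((hfc.ne_iff_eventually_ne hgc).1 hne).mono fun y hy h => hy h.self_of_nhds)
  obtain ⟨k, hk⟩ := locallyModelled_iff.1 (hX x hx)
  have hkg : IsometricAt k (g x) := hfg ▸ hk.1
  obtain ⟨T, hT⟩ := (hk.1.comp (hf x hx)).exists_extIsom
  obtain ⟨S, hS⟩ := (hkg.comp (hg x hx)).exists_extIsom
  obtain ⟨y, hy, hy1, hy2⟩ := (hfr.and_eventually
    ((eventually_eventually_nhds.2 hT).and (eventually_eventually_nhds.2 hS))).exists
  have hTS : ∀ q, T q = S q := ExtIsom.eq_of_eventuallyEq (p := y) (by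
    filter_upwards [hy, hy1, hy2] with z h0 h1 h2
    rw [← h1, ← h2, h0])
  have hc : Tendsto (fun z => (f z, g z)) (𝓝 x) (𝓝 (f x, f x)) :=
    hfc.prodMk_nhds (by rw [hfg]; exact hgc)
  filter_upwards [hT, hS, hc.eventually hk.1.eventually_eq_of_eq] with z h1 h2 h3
  exact h3 (by rw [h1, h2, hTS])

/-! ### Locally Lipschitz maps on convex sets -/

theorem edist_le_of_locally {E X : Type*} [NormedAddCommGroup E] [NormedSpace ℝ E]
    [PseudoEMetricSpace X] {V : Set E} (hV : Convex ℝ V) {f : E → X} {C : ℝ≥0}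
    (h : ∀ x ∈ V, ∃ W ∈ 𝓝[V] x, ∀ a ∈ W, ∀ b ∈ W, edist (f a) (f b) ≤ C * edist a b)
    {a b : E} (ha : a ∈ V) (hb : b ∈ V) : edist (f a) (f b) ≤ C * edist a b := by
  have hγ : ∀ s ∈ Icc (0 : ℝ) 1, AffineMap.lineMap a b s ∈ V := fun s hs =>
    hV.lineMap_mem ha hb hs
  have hd : ∀ s t : ℝ, edist (AffineMap.lineMap a b s) (AffineMap.lineMap a b t) =
      ENNReal.ofReal |s - t| * edist a b := by
    intro s t
    rw [edist_dist, edist_dist, dist_lineMap_lineMap, ENNReal.ofReal_mul dist_nonneg, Real.dist_eq]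
  have hloc : ∀ s ∈ Icc (0 : ℝ) 1, ∃ W ∈ 𝓝[Icc (0 : ℝ) 1] s, ∀ t ∈ W, ∀ u ∈ W,
      edist (f (AffineMap.lineMap a b t)) (f (AffineMap.lineMap a b u)) ≤
        ENNReal.ofReal |t - u| * (C * edist a b) := by
    intro s hs
    obtain ⟨W, hW, hWd⟩ := h _ (hγ s hs)
    have hc : Tendsto (fun s : ℝ => (AffineMap.lineMap a b s : E)) (𝓝[Icc (0 : ℝ) 1] s)
        (𝓝[V] (AffineMap.lineMap a b s)) := by
      refine tendsto_nhdsWithin_iff.2 ⟨?_, ?_⟩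
      · exact AffineMap.lineMap_continuous.continuousAt.tendsto.mono_left nhdsWithin_le_nhds
      · filter_upwards [self_mem_nhdsWithin] with t ht using hγ t ht
    refine ⟨_, hc hW, fun t ht u hu => (hWd _ ht _ hu).trans (le_of_eq ?_)⟩
    rw [hd]
    ring
  have hL : (C : ℝ≥0∞) * edist a b ≠ ∞ := ENNReal.mul_ne_top ENNReal.coe_ne_top (edist_ne_top _ _)
  generalize (C : ℝ≥0∞) * edist a b = L at *
  have hcont : ContinuousOn (fun s : ℝ => f (AffineMap.lineMap a b s)) (Icc 0 1) := by
    intro s hs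
    obtain ⟨W, hW, hWd⟩ := hloc s hs
    rw [ContinuousWithinAt, tendsto_iff_edist_tendsto_0]
    have h0 : Tendsto (fun t : ℝ => ENNReal.ofReal |t - s| * L) (𝓝[Icc (0 : ℝ) 1] s) (𝓝 0) := by
      have h1 : Continuous fun t : ℝ => ENNReal.ofReal |t - s| :=
        ENNReal.continuous_ofReal.comp (by fun_prop)
      have h2 := ENNReal.Tendsto.mul_const (h1.tendsto s) (Or.inr hL)
      simp only [sub_self, abs_zero, ENNReal.ofReal_zero, zero_mul] at h2
      exact h2.mono_left nhdsWithin_le_nhds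
    refine tendsto_of_tendsto_of_tendsto_of_le_of_le' tendsto_const_nhds h0
      (Eventually.of_forall fun _ => bot_le) ?_
    filter_upwards [hW] with t ht
    exact hWd t ht s (mem_of_mem_nhdsWithin hs hW)
  have hcl : IsClosed {s ∈ Icc (0 : ℝ) 1 | edist (f (AffineMap.lineMap a b (0 : ℝ)))
      (f (AffineMap.lineMap a b s)) ≤ ENNReal.ofReal s * L} := by
    refine IsClosed.isClosed_le isClosed_Icc ?_ ?_
    · exact (continuous_const.edist continuous_id).comp_continuousOn hcont
    · have : Continuous fun s : ℝ => ENNReal.ofReal s * L :=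
        (ENNReal.continuous_mul_const hL).comp ENNReal.continuous_ofReal
      exact this.continuousOn
  have hsub := IsClosed.Icc_subset_of_forall_mem_nhdsWithin
    (s := {s : ℝ | edist (f (AffineMap.lineMap a b (0 : ℝ)))
      (f (AffineMap.lineMap a b s)) ≤ ENNReal.ofReal s * L}) (a := 0) (b := 1)
    (by rw [inter_comm]; exact hcl) (by simp) (by
      rintro s ⟨hs, hs1⟩
      obtain ⟨W, hW, hWd⟩ := hloc s ⟨hs1.1, hs1.2.le⟩
      have hW' : W ∈ 𝓝[>] s := by
        have : Ioc s 1 ⊆ Icc (0 : ℝ) 1 := fun t ht => ⟨hs1.1.trans ht.1.le, ht.2⟩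
        have h2 := nhdsWithin_mono s this hW
        rwa [nhdsWithin_Ioc_eq_nhdsGT hs1.2] at h2
      filter_upwards [hW', self_mem_nhdsWithin] with t ht hst
      have hst' : s < t := hst
      have hsW : s ∈ W := mem_of_mem_nhdsWithin (⟨hs1.1, hs1.2.le⟩ : s ∈ Icc (0 : ℝ) 1) hW
      calc edist (f (AffineMap.lineMap a b (0 : ℝ))) (f (AffineMap.lineMap a b t))
          ≤ edist (f (AffineMap.lineMap a b (0 : ℝ))) (f (AffineMap.lineMap a b s)) +
            edist (f (AffineMap.lineMap a b s)) (f (AffineMap.lineMap a b t)) :=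
            edist_triangle _ _ _
        _ ≤ ENNReal.ofReal s * L + ENNReal.ofReal |s - t| * L := add_le_add hs (hWd s hsW t ht)
        _ = ENNReal.ofReal t * L := by
          rw [← add_mul, abs_sub_comm, abs_of_pos (sub_pos.2 hst'),
            ← ENNReal.ofReal_add hs1.1 (sub_pos.2 hst').le]
          congr 2
          ring)
  have := hsub (right_mem_Icc.2 zero_le_one)
  simpa using this

/-! ### The model of a cone singularity -/

theorem eq_of_cosh_eq {a b : ℝ} (ha : 0 ≤ a) (hb : 0 ≤ b) (h : Real.cosh a = Real.cosh b) :
    a = b := by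
  have h1 := Real.cosh_le_cosh.1 h.le
  have h2 := Real.cosh_le_cosh.1 h.ge
  rw [abs_of_nonneg ha, abs_of_nonneg hb] at h1 h2
  exact le_antisymm h1 h2

/-- The radial cylindrical coordinate: the distance to the geodesic from `0` to `∞`. -/
def Hyp3.cylR (q : Hyp3) : ℝ := Real.arsinh (‖q.z‖ / q.t)

/-- The cylindrical coordinate along the geodesic from `0` to `∞`. -/
def Hyp3.cylX (q : Hyp3) : ℝ := Real.log √q.sq

theorem Hyp3.cylR_nonneg (q : Hyp3) : 0 ≤ q.cylR :=
  Real.arsinh_nonneg_iff.2 (div_nonneg (norm_nonneg _) q.t_pos.le)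

theorem Hyp3.cyl_cylR_cylX (q : Hyp3) : cyl q.cylR (Complex.arg q.z) q.cylX = q := by
  have ht := q.t_pos
  have hs := Real.sqrt_pos.2 q.sq_pos
  have h1 : Real.exp q.cylX = √q.sq := Real.exp_log hs
  have h2 : Real.cosh q.cylR = √q.sq / q.t := by
    rw [cylR, Real.cosh_arsinh, Real.sqrt_eq_iff_mul_self_eq_of_pos (by positivity)]
    have := Real.mul_self_sqrt q.sq_pos.le
    field_simp
    rw [pow_two, this, Hyp3.sq]
    ring
  ext1
  · simp only [cyl, Real.tanh_eq_sinh_div_cosh, h1, h2]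
    rw [cylR, Real.sinh_arsinh]
    have : √q.sq * (‖q.z‖ / q.t / (√q.sq / q.t)) = ‖q.z‖ := by field_simp
    rw [this, Complex.norm_mul_exp_arg_mul_I]
  · simp only [cyl, h1, h2]
    field_simp

theorem Hyp3.cyl_norm_z (r θ x : ℝ) (hr : 0 ≤ r) :
    ‖(cyl r θ x).z‖ = Real.exp x * Real.tanh r := by
  have : 0 ≤ Real.tanh r := by
    rw [Real.tanh_eq_sinh_div_cosh]
    exact div_nonneg (Real.sinh_nonneg_iff.2 hr) (Real.cosh_pos r).le
  simp only [cyl, norm_mul, Complex.norm_real, Complex.norm_exp_ofReal_mul_I, mul_one,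
    Real.norm_eq_abs]
  rw [← abs_mul]
  exact abs_of_nonneg (mul_nonneg (Real.exp_pos x).le this)

theorem Hyp3.cylR_cyl (r θ x : ℝ) (hr : 0 ≤ r) : (cyl r θ x).cylR = r := by
  have h1 := Real.exp_pos x
  have h2 := Real.cosh_pos r
  have : Real.exp x * Real.tanh r / (cyl r θ x).t = Real.sinh r := by
    simp only [cyl, Real.tanh_eq_sinh_div_cosh]
    field_simp
  rw [cylR, cyl_norm_z r θ x hr, this, Real.arsinh_sinh]

theorem Hyp3.cylX_cyl (r θ x : ℝ) (hr : 0 ≤ r) : (cyl r θ x).cylX = x := by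
  have h2 := Real.cosh_pos r
  have : (cyl r θ x).sq = Real.exp x ^ 2 := by
    rw [Hyp3.sq, cyl_norm_z r θ x hr]
    simp only [cyl, Real.tanh_eq_sinh_div_cosh]
    have := Real.cosh_sq r
    field_simp
    rw [this]
  rw [cylX, this, Real.sqrt_sq (Real.exp_pos x).le, Real.log_exp]

theorem Hyp3.arg_cyl {r θ x : ℝ} (hr : 0 < r) (hθ : θ ∈ Ioc (-Real.pi) Real.pi) :
    Complex.arg (cyl r θ x).z = θ := by
  have h : 0 < Real.exp x * Real.tanh r := by
    have h1 := Real.exp_pos x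
    have h2 := Real.cosh_pos r
    have h3 := Real.sinh_pos_iff.2 hr
    rw [Real.tanh_eq_sinh_div_cosh]
    positivity
  simp only [cyl]
  rw [Complex.exp_mul_I, Complex.arg_mul_cos_add_sin_mul_I h hθ]

section Cone

variable {α : ℝ}

/-- The point with coordinate `s` of the singular axis. -/
def coneAxis (α s : ℝ) : ConeModel α := SeparationQuotient.mk ⟨0, le_rfl, 0, s⟩

theorem dist_mk_coneAxis (p : ConeCoord α) (s : ℝ) {q : Hyp3} (hr : q.cylR = p.r)
    (hx : q.cylX = p.x) :
    dist (SeparationQuotient.mk p) (coneAxis α s) = dist q (cyl 0 0 s) := by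
  rw [coneAxis, SeparationQuotient.dist_mk]
  refine eq_of_cosh_eq dist_nonneg dist_nonneg ?_
  conv_rhs => rw [← cyl_cylR_cylX q]
  rw [ConeCoord.cosh_dist, cosh_dist_cyl, hr, hx]
  simp

theorem mk_eq_coneAxis {p : ConeCoord α} (hp : p.r = 0) :
    (SeparationQuotient.mk p : ConeModel α) = coneAxis α p.x := by
  rw [← dist_eq_zero, coneAxis, SeparationQuotient.dist_mk]
  refine eq_of_cosh_eq dist_nonneg le_rfl ?_
  rw [ConeCoord.cosh_dist, hp]
  simp

theorem continuous_coneAxis : Continuous (coneAxis α) := by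
  have : Isometry (coneAxis α) := Isometry.of_dist_eq fun s s' => by
    rw [coneAxis, coneAxis, SeparationQuotient.dist_mk, Real.dist_eq]
    refine eq_of_cosh_eq dist_nonneg (abs_nonneg _) ?_
    rw [ConeCoord.cosh_dist]
    simp
  exact this.continuous

/-- The translation by `σ` along the axis. -/
def ConeCoord.shift (σ : ℝ) (p : ConeCoord α) : ConeCoord α := ⟨p.r, p.r_nonneg, p.θ, p.x + σ⟩

theorem ConeCoord.dist_shift (σ : ℝ) (p q : ConeCoord α) :
    dist (p.shift σ) (q.shift σ) = dist p q := by
  refine eq_of_cosh_eq dist_nonneg dist_nonneg ?_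
  rw [ConeCoord.cosh_dist, ConeCoord.cosh_dist]
  simp [shift, angle]

/-- All points of the axis are equally singular. -/
theorem locallyModelled_coneAxis (s s' : ℝ) (h : LocallyModelled Hyp3 (coneAxis α s)) :
    LocallyModelled Hyp3 (coneAxis α s') := by
  let τ : ConeModel α → ConeModel α := fun y =>
    SeparationQuotient.mk ((Quotient.out y : ConeCoord α).shift (s - s'))
  have hout : ∀ y : ConeModel α, SeparationQuotient.mk (Quotient.out y : ConeCoord α) = y :=
    fun y => Quotient.out_eq y
  have hd : ∀ a b, dist (τ a) (τ b) = dist a b := fun a b => by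
    simp only [τ]
    rw [SeparationQuotient.dist_mk, ConeCoord.dist_shift, ← SeparationQuotient.dist_mk, hout, hout]
  have hτ : ∀ p : ConeCoord α, τ (SeparationQuotient.mk p) =
      SeparationQuotient.mk (p.shift (s - s')) := fun p => by
    rw [← dist_eq_zero]
    simp only [τ]
    rw [SeparationQuotient.dist_mk, ConeCoord.dist_shift, ← SeparationQuotient.dist_mk, hout,
      dist_self]
  have hs : Function.Surjective τ := fun y => by
    refine ⟨SeparationQuotient.mk ((Quotient.out y : ConeCoord α).shift (s' - s)), ?_⟩
    rw [hτ]
    conv_rhs => rw [← hout y]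
    generalize (Quotient.out y : ConeCoord α) = p
    rcases p with ⟨r, hr, θ, x⟩
    simp only [ConeCoord.shift]
    congr 2
    ring
  have ho : OpenIsometricAt τ (coneAxis α s') := by
    refine openIsometricAt_of_image univ_mem (fun a _ b _ => ?_) ?_
    · rw [edist_dist, edist_dist, hd]
    · rw [image_univ, hs.range_eq]
      exact univ_mem
  refine ho.locallyModelled_iff.1 ?_
  rw [coneAxis, hτ]
  simpa [ConeCoord.shift, coneAxis] using h

theorem exists_norm_eq_abs (θ : AddCircle α) : ∃ s : ℝ, (s : AddCircle α) = θ ∧ |s| = ‖θ‖ := by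
  induction θ using QuotientAddGroup.induction_on with
  | H x =>
    refine ⟨x - round (α⁻¹ * x) * α, ?_, (AddCircle.norm_eq α).symm⟩
    have : ((round (α⁻¹ * x) * α : ℝ) : AddCircle α) = 0 := by
      rw [AddCircle.coe_eq_zero_iff]
      exact ⟨_, zsmul_eq_mul _ _⟩
    rw [AddCircle.coe_sub, this, sub_zero]

/-- Away from the axis, cylindrical coordinates identify the model isometrically with
hyperbolic space, locally. -/
theorem exists_cylindrical_chart (hα : 0 < α) {p : ConeCoord α} (hp : 0 < p.r) :
    ∃ (l : Hyp3 → ConeModel α) (q : Hyp3), OpenIsometricAt l q ∧ l q = SeparationQuotient.mk p ∧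
      ∀ q s, dist (l q) (coneAxis α s) = dist q (cyl 0 0 s) := by
  obtain ⟨ω, hω, hωα, hωπ⟩ : ∃ ω > 0, 2 * ω ≤ α / 2 ∧ 2 * ω < Real.pi :=
    ⟨min (α / 4) (Real.pi / 4), by positivity, by linarith [min_le_left (α / 4) (Real.pi / 4)],
      by linarith [min_le_right (α / 4) (Real.pi / 4), Real.pi_pos]⟩
  let l : Hyp3 → ConeModel α := fun q =>
    SeparationQuotient.mk ⟨q.cylR, q.cylR_nonneg, p.θ + (Complex.arg q.z : ℝ), q.cylX⟩
  have harg0 : Complex.arg (cyl p.r 0 p.x).z = 0 :=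
    arg_cyl hp ⟨by linarith [Real.pi_pos], Real.pi_pos.le⟩
  have hl0 : l (cyl p.r 0 p.x) = SeparationQuotient.mk p := by
    simp only [l, harg0]
    congr 1
    rw [ConeCoord.mk.injEq]
    exact ⟨cylR_cyl _ _ _ p.r_nonneg, by simp, cylX_cyl _ _ _ p.r_nonneg⟩
  refine ⟨l, cyl p.r 0 p.x, ?_, hl0, fun q s => dist_mk_coneAxis _ s rfl rfl⟩
  have hz0 : (cyl p.r 0 p.x).z ∈ Complex.slitPlane := by
    rw [Complex.mem_slitPlane_iff_arg, harg0]
    refine ⟨Real.pi_pos.ne, fun h => ?_⟩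
    have h1 := cyl_norm_z p.r 0 p.x hp.le
    rw [h, norm_zero, Real.tanh_eq_sinh_div_cosh] at h1
    have h2 := Real.sinh_pos_iff.2 hp
    have h3 := Real.cosh_pos p.r
    have h4 := Real.exp_pos p.x
    have : 0 < Real.exp p.x * (Real.sinh p.r / Real.cosh p.r) := by positivity
    linarith
  have hW : {q : Hyp3 | |Complex.arg q.z| < ω} ∈ 𝓝 (cyl p.r 0 p.x) := by
    have hc : ContinuousAt (fun q : Hyp3 => |Complex.arg q.z|) (cyl p.r 0 p.x) :=
      ((Complex.continuousAt_arg hz0).comp (f := Hyp3.z) continuous_z.continuousAt).abs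
    refine hc.eventually (p := fun x => x < ω) (gt_mem_nhds ?_)
    change |Complex.arg (cyl p.r 0 p.x).z| < ω
    rw [harg0, abs_zero]
    exact hω
  refine openIsometricAt_of_image hW (fun a ha b hb => ?_) ?_
  · rw [edist_dist, edist_dist]
    congr 1
    simp only [l, SeparationQuotient.dist_mk]
    refine eq_of_cosh_eq dist_nonneg dist_nonneg ?_
    conv_rhs => rw [← cyl_cylR_cylX a, ← cyl_cylR_cylX b]
    rw [ConeCoord.cosh_dist, cosh_dist_cyl]
    have hab : |Complex.arg a.z - Complex.arg b.z| < 2 * ω := by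
      have := abs_sub (Complex.arg a.z) (Complex.arg b.z)
      have ha' : |Complex.arg a.z| < ω := ha
      have hb' : |Complex.arg b.z| < ω := hb
      linarith
    have : ConeCoord.angle ⟨a.cylR, a.cylR_nonneg, p.θ + ((Complex.arg a.z : ℝ) : AddCircle α), a.cylX⟩
        ⟨b.cylR, b.cylR_nonneg, p.θ + ((Complex.arg b.z : ℝ) : AddCircle α), b.cylX⟩ =
        |Complex.arg a.z - Complex.arg b.z| := by
      rw [ConeCoord.angle, dist_add_left, dist_eq_norm, ← AddCircle.coe_sub,
        (AddCircle.norm_coe_eq_abs_iff α hα.ne').2 (by rw [abs_of_pos hα]; linarith),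
        min_eq_right (by linarith)]
    rw [this, Real.cos_abs]
  · rw [hl0]
    obtain ⟨k, hk⟩ : ∃ k, k = Real.cos ω := ⟨_, rfl⟩
    have hk1 : k < 1 := by
      rw [hk, ← Real.cos_zero]
      exact Real.cos_lt_cos_of_nonneg_of_le_pi le_rfl (by linarith) hω
    have hk0 : 0 < k := by
      rw [hk]
      exact Real.cos_pos_of_mem_Ioo ⟨by linarith, by linarith⟩
    have hr1 : 1 < Real.cosh p.r := Real.one_lt_cosh.2 hp.ne'
    have hcont : Continuous fun y : ConeModel α => Real.cosh (dist y (SeparationQuotient.mk p)) := by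
      fun_prop
    have h1 : ∀ᶠ y in 𝓝 (SeparationQuotient.mk p : ConeModel α),
        Real.cosh (dist y (SeparationQuotient.mk p)) < (1 - k) * Real.cosh p.r + k := by
      refine (hcont.tendsto _).eventually (gt_mem_nhds ?_)
      rw [dist_self, Real.cosh_zero]
      nlinarith
    have h2 : ∀ᶠ y in 𝓝 (SeparationQuotient.mk p : ConeModel α),
        Real.cosh (dist y (SeparationQuotient.mk p)) < Real.cosh p.r := by
      refine (hcont.tendsto _).eventually (gt_mem_nhds ?_)
      rwa [dist_self, Real.cosh_zero]
    filter_upwards [h1, h2] with y hy1 hy2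
    obtain ⟨c, rfl⟩ := SeparationQuotient.surjective_mk y
    rw [SeparationQuotient.dist_mk, ConeCoord.cosh_dist] at hy1 hy2
    have hx := Real.one_le_cosh (c.x - p.x)
    have hcr : 0 < c.r := by
      refine lt_of_le_of_ne c.r_nonneg fun h => ?_
      rw [← h] at hy2
      simp only [Real.cosh_zero, Real.sinh_zero, one_mul, zero_mul, sub_zero] at hy2
      nlinarith
    have hsc := Real.sinh_pos_iff.2 hcr
    have hsp := Real.sinh_pos_iff.2 hp
    have hang : c.angle p < ω := by
      by_contra! hge
      have hcos : Real.cos (c.angle p) ≤ k := by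
        rw [hk]
        exact Real.cos_le_cos_of_nonneg_of_le_pi hω.le (c.angle_le_pi p) hge
      have e1 : Real.sinh c.r * Real.sinh p.r * Real.cos (c.angle p) ≤
          Real.sinh c.r * Real.sinh p.r * k := by gcongr
      have e2 := Real.one_le_cosh (c.r - p.r)
      rw [Real.cosh_sub] at e2
      have e3 := Real.one_le_cosh c.r
      have e4 : Real.cosh c.r * Real.cosh p.r ≤
          Real.cosh c.r * Real.cosh p.r * Real.cosh (c.x - p.x) :=
        le_mul_of_one_le_right (by positivity) hx
      nlinarith [mul_le_mul_of_nonneg_left e2 hk0.le,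
        mul_le_mul_of_nonneg_left (mul_le_mul_of_nonneg_right e3 (zero_le_one.trans hr1.le))
          (sub_pos.2 hk1).le]
    have hdist : dist c.θ p.θ < ω := by
      rcases min_lt_iff.1 hang with h | h
      · linarith
      · exact h
    obtain ⟨s, hs, hsn⟩ := exists_norm_eq_abs (c.θ - p.θ)
    rw [← dist_eq_norm] at hsn
    have hsω : |s| < ω := by rw [hsn]; exact hdist
    have hsI := abs_lt.1 hsω
    have harg : Complex.arg (cyl c.r s c.x).z = s :=
      arg_cyl hcr ⟨by linarith, by linarith⟩
    refine ⟨cyl c.r s c.x, ?_, ?_⟩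
    · change |_| < ω
      rwa [harg]
    · simp only [l, harg]
      congr 1
      rw [ConeCoord.mk.injEq]
      refine ⟨cylR_cyl _ _ _ c.r_nonneg, ?_, cylX_cyl _ _ _ c.r_nonneg⟩
      rw [hs]
      abel

end Cone

/-- Let `F` be a local isometry from `O` to the non-singular points, and let `F` tend to a singular
point `x` at a boundary point `p` of `O`, near which `O` is connected. Then a geodesic through `p`
does not meet `O` near `p`, and `F` tends to singular points at its points: the image of the
geodesic is the singular axis. -/
theorem exists_singular_geodesic {X : Type*} [EMetricSpace X] {F : Hyp3 → X} {O : Set Hyp3}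
    {p : Hyp3} {x : X} {α : ℝ} (hα : 0 < α)
    (hO : ∀ U ∈ 𝓝 p, ∃ U' ∈ 𝓝 p, U' ⊆ U ∧ IsPreconnected (U' ∩ O))
    (hpO : p ∈ closure O) (hF : ∀ q ∈ O, IsometricAt F q)
    (hFX : ∀ q ∈ O, LocallyModelled Hyp3 (F q)) (hlim : Tendsto F (𝓝[O] p) (𝓝 x))
    (hcone : LocallyModelled (ConeModel α) x) (hx : ¬ LocallyModelled Hyp3 x) :
    ∃ (S : ExtIsom) (s₀ : ℝ), S (cyl 0 0 s₀) = p ∧ ∀ᶠ s in 𝓝 s₀, S (cyl 0 0 s) ∉ O ∧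
      ∃ y, ¬ LocallyModelled Hyp3 y ∧ Tendsto F (𝓝[O] (S (cyl 0 0 s))) (𝓝 y) := by
  have : NeBot (𝓝[O] p) := mem_closure_iff_nhdsWithin_neBot.1 hpO
  obtain ⟨f, hf⟩ := locallyModelled_iff.1 hcone
  have hreg : ∀ c : ConeCoord α, 0 < c.r → LocallyModelled Hyp3 (SeparationQuotient.mk c) := by
    intro c hc
    obtain ⟨l, q, hl, hlq, -⟩ := exists_cylindrical_chart hα hc
    obtain ⟨k, hk, -, -⟩ := hl.exists_inverse
    rw [hlq] at hk
    exact locallyModelled_iff.2 ⟨k, hk⟩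
  obtain ⟨s₀, hs₀⟩ : ∃ s₀, f x = coneAxis α s₀ := by
    obtain ⟨c, hc⟩ := SeparationQuotient.surjective_mk (f x)
    rcases c.r_nonneg.eq_or_lt with h | h
    · exact ⟨c.x, by rw [← hc, mk_eq_coneAxis h.symm]⟩
    · refine absurd (hf.locallyModelled_iff.1 ?_) hx
      rw [← hc]
      exact hreg c h
  have haxis : ∀ s, ¬ LocallyModelled Hyp3 (coneAxis α s) := fun s h =>
    hx (hf.locallyModelled_iff.1 (by rw [hs₀]; exact locallyModelled_coneAxis s s₀ h))
  obtain ⟨W, hW, hWf⟩ := hf.1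
  have hW₀ : W ∩ {y | OpenIsometricAt f y} ∈ 𝓝 x := inter_mem hW hf.eventually
  obtain ⟨U₀, hU₀, hU₀W⟩ := mem_nhdsWithin_iff_exists_mem_nhds_inter.1 (hlim hW₀)
  obtain ⟨U, hU, hUU₀, hconn⟩ := hO U₀ hU₀
  have hUW : ∀ q ∈ U ∩ O, F q ∈ W ∧ OpenIsometricAt f (F q) := fun q hq =>
    hU₀W ⟨hUU₀ hq.1, hq.2⟩
  have hne : (U ∩ O).Nonempty := by
    have : U ∩ O ∈ 𝓝[O] p := inter_mem (mem_nhdsWithin_of_mem_nhds hU) self_mem_nhdsWithin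
    exact Filter.nonempty_of_mem this
  have hoff : ∀ q ∈ U ∩ O, ∀ s, f (F q) ≠ coneAxis α s := fun q hq s h =>
    haxis s (h ▸ (hUW q hq).2.locallyModelled_iff.2 (hFX q hq.2))
  -- locally, `f ∘ F` is an isometry to hyperbolic space, and takes the axis to a geodesic
  have hdev : ∀ q ∈ U ∩ O, ∃ T : ExtIsom, ∀ᶠ q' in 𝓝 q, ∀ s,
      dist (f (F q')) (coneAxis α s) = dist q' (T.symm (cyl 0 0 s)) := by
    intro q hq
    obtain ⟨c, hc⟩ := SeparationQuotient.surjective_mk (f (F q))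
    have hcr : 0 < c.r := by
      refine lt_of_le_of_ne c.r_nonneg fun h => hoff q hq c.x ?_
      rw [← hc, mk_eq_coneAxis h.symm]
    obtain ⟨l, q₁, hl, hlq, hld⟩ := exists_cylindrical_chart hα hcr
    obtain ⟨k, hk, hlk, -⟩ := hl.exists_inverse
    rw [hlq, hc] at hk hlk
    have hfF : IsometricAt (fun q => f (F q)) q := (hUW q hq).2.1.comp (hF q hq.2)
    obtain ⟨T, hT⟩ := (IsometricAt.comp (f := fun q => f (F q)) hk.1 hfF).exists_extIsom
    refine ⟨T, ?_⟩
    filter_upwards [hT, hfF.continuousAt.eventually hlk] with q' h1 h2 s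
    rw [← h2, hld, h1, ← T.dist_eq q', T.apply_symm_apply]
  obtain ⟨q₀, hq₀⟩ := hne
  obtain ⟨T, hT⟩ := hdev q₀ hq₀
  have hdist : ∀ s, ∀ q ∈ U ∩ O, dist (f (F q)) (coneAxis α s) = dist q (T.symm (cyl 0 0 s)) := by
    intro s
    refine dist_eq_of_isPreconnected (f := fun q => dist (f (F q)) (coneAxis α s)) hconn
      (fun q hq => ?_) hq₀ (hT.mono fun q hq => hq s)
    obtain ⟨T', hT'⟩ := hdev q hq
    exact ⟨_, hT'.mono fun q hq => hq s⟩
  have hUO : ∀ᶠ q in 𝓝[O] p, q ∈ U ∩ O :=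
    inter_mem (mem_nhdsWithin_of_mem_nhds hU) self_mem_nhdsWithin
  have hps : T.symm (cyl 0 0 s₀) = p := by
    have h1 : Tendsto (fun q => dist (f (F q)) (coneAxis α s₀)) (𝓝[O] p) (𝓝 0) := by
      have := (hf.1.continuousAt.tendsto.comp hlim).dist (tendsto_const_nhds (x := coneAxis α s₀))
      rwa [hs₀, dist_self] at this
    have h2 : Tendsto (fun q => dist q (T.symm (cyl 0 0 s₀))) (𝓝[O] p)
        (𝓝 (dist p (T.symm (cyl 0 0 s₀)))) :=
      ((by fun_prop : Continuous fun q => dist q (T.symm (cyl 0 0 s₀))).tendsto p).mono_left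
        nhdsWithin_le_nhds
    have h3 := tendsto_nhds_unique h2 (h1.congr' (hUO.mono fun q hq => hdist s₀ q hq))
    exact (dist_eq_zero.1 h3).symm
  refine ⟨T.symm, s₀, hps, ?_⟩
  have hcyl : Continuous fun s => cyl 0 0 s := by
    rw [isInducing_coord.continuous_iff]
    have : coord ∘ (fun s => cyl 0 0 s) = fun s => ((0 : ℂ), Real.exp s) := by
      funext s
      simp [coord, cyl]
    rw [this]
    fun_prop
  have ho : Tendsto (fun s => T.symm (cyl 0 0 s)) (𝓝 s₀) (𝓝 p) := by
    rw [← hps]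
    exact (T.symm.continuous.comp hcyl).tendsto s₀
  obtain ⟨g, hg, hfg, hgf⟩ := hf.exists_inverse
  have hga : Tendsto (fun s => g (coneAxis α s)) (𝓝 s₀) (𝓝 x) := by
    have h1 := hg.1.continuousAt.tendsto
    rw [hgf.self_of_nhds, hs₀] at h1
    exact h1.comp (continuous_coneAxis.tendsto s₀)
  have hfg' : ∀ᶠ s in 𝓝 s₀, f (g (coneAxis α s)) = coneAxis α s := by
    rw [hs₀] at hfg
    exact (continuous_coneAxis.tendsto s₀).eventually hfg
  filter_upwards [ho.eventually (eventually_mem_nhds_iff.2 hU), hga.eventually hW₀, hfg']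
    with s h1 h2 h3
  refine ⟨fun hs => ?_, g (coneAxis α s), fun h => ?_, ?_⟩
  · have hsU : T.symm (cyl 0 0 s) ∈ U ∩ O := ⟨mem_of_mem_nhds h1, hs⟩
    have := hdist s _ hsU
    rw [dist_self, dist_eq_zero] at this
    exact hoff _ hsU s this
  · have := h2.2.locallyModelled_iff.2 h
    rw [h3] at this
    exact haxis s this
  · rw [tendsto_iff_edist_tendsto_0]
    have h4 : Tendsto (fun q => edist q (T.symm (cyl 0 0 s))) (𝓝[O] (T.symm (cyl 0 0 s))) (𝓝 0) :=
      tendsto_iff_edist_tendsto_0.1 nhdsWithin_le_nhds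
    refine h4.congr' ?_
    filter_upwards [mem_nhdsWithin_of_mem_nhds h1, self_mem_nhdsWithin] with q hq1 hq2
    rw [← hWf _ (hUW q ⟨hq1, hq2⟩).1 _ h2.1, h3, edist_dist, edist_dist, hdist s q ⟨hq1, hq2⟩]

/-! ### Neighbourhoods in coordinates -/

theorem isPreconnected_coord_preimage {V : Set (ℂ × ℝ)} (hV : Convex ℝ V) :
    IsPreconnected (coord ⁻¹' V) := by
  rw [← isInducing_coord.isPreconnected_image, image_preimage_eq_inter_range, range_coord]
  refine (hV.inter ?_).isPreconnected
  exact convex_halfSpace_gt (LinearMap.snd ℝ ℂ ℝ).isLinear 0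

theorem eventually_eventually_nhds_of_idealNhds {w : Sphere} {P : Hyp3 → Prop}
    (h : ∀ᶠ p in idealNhds w, P p) : ∀ᶠ p in idealNhds w, ∀ᶠ q in 𝓝 p, P q := by
  obtain ⟨V, hV, hVP⟩ := mem_comap.1 h
  obtain ⟨U, hUV, hU, hw⟩ := mem_nhds_iff.1 hV
  refine mem_comap.2 ⟨U, hU.mem_nhds hw, fun p hp => ?_⟩
  filter_upwards [isEmbedding_toBar.continuous.continuousAt.preimage_mem_nhds (hU.mem_nhds hp)]
    with q hq using hVP (hUV hq)

theorem eventually_coord_mem {w : ℂ} {U : Set (ℂ × ℝ)} (hU : U ∈ 𝓝 (w, (0 : ℝ))) :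
    ∀ᶠ p in idealNhds w, coord p ∈ U := by
  rw [idealNhds_coe]
  exact tendsto_comap.eventually hU

theorem eventually_nhds_coord_mem {p : Hyp3} {U : Set (ℂ × ℝ)} (hU : U ∈ 𝓝 (coord p)) :
    ∀ᶠ q in 𝓝 p, coord q ∈ U :=
  continuous_coord.continuousAt.eventually hU

theorem eventually_coe_of_eventually {P : Sphere → Prop} {w : ℂ} (h : ∀ᶠ w' in 𝓝 (w : Sphere), P w') :
    ∀ᶠ w' : ℂ in 𝓝 w, P w' :=
  (OnePoint.continuous_coe.tendsto w).eventually h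

section

variable {N : Type*} [TopologicalSpace N] [T2Space N] [CompactSpace N]
  [ChartedSpace (EuclideanHalfSpace 3) N] {X : Type*} [EMetricSpace X] {K : HypConeManifold N X}

/-! ### Charts at infinity -/

namespace HypConeManifold

theorem IsChartAtInfinity.exists_incl {c : OpenPartialHomeomorph N HypBar}
    (hc : K.IsChartAtInfinity c) {y : N} (hy : y ∈ c.source) {p : Hyp3} (h : c y = toBar p) :
    ∃ x, K.incl x = y := by
  by_contra hx
  have hb : y ∈ (𝓡∂ 3).boundary N := by
    rw [← (𝓡∂ 3).compl_interior, ← K.range_incl]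
    exact hx
  obtain ⟨w, hw⟩ := hc.map_boundary y hy hb
  exact toBar_ne_bdry p w (h.symm.trans hw)

theorem IsChartAtInfinity.exists_isometricAt {c : OpenPartialHomeomorph N HypBar}
    (hc : K.IsChartAtInfinity c) {x : X} (hx : K.incl x ∈ c.source) :
    ∃ k : X → Hyp3, IsometricAt k x ∧ ∀ᶠ a in 𝓝 x, c (K.incl a) = toBar (k a) := by
  obtain ⟨k, W, hW, h⟩ := hc.map_interior x hx
  refine ⟨k, ⟨W, hW, fun a ha b hb => (h a ha).2.2 b hb⟩, ?_⟩
  filter_upwards [hW] with a ha using (h a ha).2.1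

/-- The inverse of a chart at infinity is a local isometry from hyperbolic space to the
non-singular part. -/
theorem IsChartAtInfinity.isometricAt_symm {c : OpenPartialHomeomorph N HypBar}
    (hc : K.IsChartAtInfinity c) {f : Hyp3 → X} {p : Hyp3} (hp : toBar p ∈ c.target)
    (hf : ∀ᶠ q in 𝓝 p, K.incl (f q) = c.symm (toBar q)) :
    IsometricAt f p ∧ f p ∈ K.nonsingular := by
  have hcont : ContinuousAt f p := by
    rw [K.incl_isEmbedding.continuousAt_iff]
    have : ContinuousAt (fun q => c.symm (toBar q)) p :=
      (c.symm.continuousAt hp).comp (f := toBar) isEmbedding_toBar.continuous.continuousAt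
    exact this.congr (hf.mono fun q hq => hq.symm)
  have hsrc : K.incl (f p) ∈ c.source := by
    rw [hf.self_of_nhds]
    exact c.map_target hp
  obtain ⟨k, hk, hck⟩ := hc.exists_isometricAt hsrc
  have htgt : ∀ᶠ q in 𝓝 p, toBar q ∈ c.target :=
    isEmbedding_toBar.continuous.continuousAt.eventually (c.open_target.mem_nhds hp)
  have hkf : ∀ᶠ q in 𝓝 p, k (f q) = q := by
    filter_upwards [hf, htgt, hcont.eventually hck] with q h1 h2 h3
    rw [h1, c.right_inv h2] at h3
    exact toBar_injective h3.symm
  refine ⟨IsometricAt.of_rightInverse hk hcont hkf, ?_⟩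
  refine locallyModelled_iff.2 ⟨k, hk, ?_⟩
  rw [hkf.self_of_nhds]
  calc 𝓝 p = map (fun q => k (f q)) (𝓝 p) := by
        rw [map_congr hkf, map_id']
    _ = map k (map f (𝓝 p)) := (map_map).symm
    _ ≤ map k (𝓝 (f p)) := map_mono hcont

end HypConeManifold

/-! ### Local extensions of a round disk -/

/-- The map `φ` from the Riemann sphere is, near the point `w`, given in a chart at infinity by
(the boundary values of) an isometry of hyperbolic space. -/
def IsConformalAt (K : HypConeManifold N X) (φ : Sphere → N) (w : Sphere) : Prop :=
  ∃ c, K.IsChartAtInfinity c ∧ ∃ T : ExtIsom, ∀ᶠ w' in 𝓝 w,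
    φ w' ∈ c.source ∧ c (φ w') = T.bar (bdry w')

/-- On the part of hyperbolic space with coordinates in `U`, the map `F` is a local isometry into
the non-singular part, and it extends continuously by `φ` to the ideal points of `U`. -/
structure IsLocalExtension (K : HypConeManifold N X) (φ : Sphere → N) (U : Set (ℂ × ℝ))
    (F : Hyp3 → X) : Prop where
  mem : ∀ p, coord p ∈ U → F p ∈ K.nonsingular
  isometricAt : ∀ p, coord p ∈ U → IsometricAt F p
  tendsto : ∀ w : ℂ, (w, (0 : ℝ)) ∈ U → Tendsto (fun p => K.incl (F p)) (idealNhds w) (𝓝 (φ w))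

variable {φ : Sphere → N}

namespace IsLocalExtension

theorem mono {U V : Set (ℂ × ℝ)} {F : Hyp3 → X} (h : IsLocalExtension K φ U F)
    (hVU : ∀ x ∈ V, 0 ≤ x.2 → x ∈ U) : IsLocalExtension K φ V F where
  mem p hp := h.mem p (hVU _ hp p.t_pos.le)
  isometricAt p hp := h.isometricAt p (hVU _ hp p.t_pos.le)
  tendsto w hw := h.tendsto w (hVU _ hw le_rfl)

/-- Local extensions that agree on intersections can be glued. -/
theorem glue {ι : Type*} (i₀ : ι) {U : ι → Set (ℂ × ℝ)} {F : ι → Hyp3 → X}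
    (hU : ∀ i, IsOpen (U i)) (hF : ∀ i, IsLocalExtension K φ (U i) (F i))
    (heq : ∀ i j p, coord p ∈ U i → coord p ∈ U j → F i p = F j p) :
    ∃ G, IsLocalExtension K φ (⋃ i, U i) G ∧ ∀ i p, coord p ∈ U i → G p = F i p := by
  have : ∀ p, ∃ x, ∀ i, coord p ∈ U i → x = F i p := by
    intro p
    by_cases h : ∃ i, coord p ∈ U i
    · obtain ⟨i, hi⟩ := h
      exact ⟨F i p, fun j hj => heq i j p hi hj⟩
    · exact ⟨F i₀ p, fun i hi => absurd ⟨i, hi⟩ h⟩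
  choose G hG using this
  refine ⟨G, ⟨fun p hp => ?_, fun p hp => ?_, fun w hw => ?_⟩, fun i p => hG p i⟩
  · obtain ⟨i, hi⟩ := mem_iUnion.1 hp
    rw [hG p i hi]
    exact (hF i).mem p hi
  · obtain ⟨i, hi⟩ := mem_iUnion.1 hp
    refine ((hF i).isometricAt p hi).congr ?_
    filter_upwards [eventually_nhds_coord_mem ((hU i).mem_nhds hi)] with q hq
    exact (hG q i hq).symm
  · obtain ⟨i, hi⟩ := mem_iUnion.1 hw
    refine ((hF i).tendsto w hi).congr' ?_
    filter_upwards [eventually_coord_mem ((hU i).mem_nhds hi)] with q hq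
    rw [hG q i hq]

/-- Local extensions on a convex set that agree near a point are equal. -/
theorem eq_of_eventuallyEq {U₁ U₂ V : Set (ℂ × ℝ)} {F₁ F₂ : Hyp3 → X}
    (h₁ : IsLocalExtension K φ U₁ F₁) (h₂ : IsLocalExtension K φ U₂ F₂) (hV : Convex ℝ V)
    (hV₁ : V ⊆ U₁) (hV₂ : V ⊆ U₂) {p₀ : Hyp3} (hp₀ : coord p₀ ∈ V)
    (he : ∀ᶠ p in 𝓝 p₀, F₁ p = F₂ p) {p : Hyp3} (hp : coord p ∈ V) : F₁ p = F₂ p :=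
  Eventually.self_of_nhds (p := fun p => F₁ p = F₂ p) <|
    eventuallyEq_of_isometricAt (isPreconnected_coord_preimage hV)
      (fun q hq => h₁.isometricAt q (hV₁ hq)) (fun q hq => h₂.isometricAt q (hV₂ hq))
      (fun q hq => h₁.mem q (hV₁ hq)) hp₀ he hp

/-- Near an ideal point, a local extension is determined by the disk: in a chart at infinity it is
the isometry with the same boundary values. -/
theorem eventually_chart_eq {U : Set (ℂ × ℝ)} {F : Hyp3 → X} (hF : IsLocalExtension K φ U F)
    {w : ℂ} (hU : U ∈ 𝓝 (w, (0 : ℝ))) {c : OpenPartialHomeomorph N HypBar}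
    (hc : K.IsChartAtInfinity c) {T : ExtIsom}
    (hT : ∀ᶠ w' in 𝓝 (w : Sphere), φ w' ∈ c.source ∧ c (φ w') = T.bar (bdry w')) :
    ∀ᶠ p in idealNhds w, K.incl (F p) ∈ c.source ∧ c (K.incl (F p)) = toBar (T p) := by
  have hT' := eventually_coe_of_eventually hT
  have hsrc : ∀ᶠ p in idealNhds w, K.incl (F p) ∈ c.source :=
    (hF.tendsto w (mem_of_mem_nhds hU)) (c.open_source.mem_nhds hT'.self_of_nhds.1)
  rw [idealNhds_coe] at hsrc
  obtain ⟨V, hV, hVc⟩ := mem_comap.1 hsrc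
  obtain ⟨δ, hδ, hb⟩ := Metric.mem_nhds_iff.1 (inter_mem hU hV)
  have hmem : ∀ p : Hyp3, coord p ∈ Metric.ball (w, (0 : ℝ)) δ → K.incl (F p) ∈ c.source :=
    fun p hp => hVc (hb hp).2
  have hk : ∀ p : Hyp3, coord p ∈ Metric.ball (w, (0 : ℝ)) δ →
      ∃ k, c (K.incl (F p)) = toBar k := fun p hp => by
    obtain ⟨k, -, hk⟩ := hc.exists_isometricAt (hmem p hp)
    exact ⟨_, hk.self_of_nhds⟩
  choose! k hk using hk
  have hne : (coord ⁻¹' Metric.ball (w, (0 : ℝ)) δ).Nonempty :=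
    (eventually_coord_mem (Metric.ball_mem_nhds _ hδ)).exists
  obtain ⟨S, hS⟩ := exists_extIsom_of_isPreconnected
    (isPreconnected_coord_preimage (convex_ball (w, (0 : ℝ)) δ)) hne (f := k) (fun p hp => by
      obtain ⟨k', hk', hck'⟩ := hc.exists_isometricAt (hmem p hp)
      have hFp := hF.isometricAt p (hb hp).1
      refine (hk'.comp hFp).congr ?_
      filter_upwards [hFp.continuousAt.eventually hck',
        eventually_nhds_coord_mem (Metric.isOpen_ball.mem_nhds hp)] with q h1 h2
      rw [hk q h2] at h1
      exact (toBar_injective h1).symm)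
  have hbar : ∀ᶠ w' : ℂ in 𝓝 w, S.bar (bdry w') = T.bar (bdry w') := by
    filter_upwards [hT', Metric.ball_mem_nhds w hδ] with w' hw' hd
    have hd' : (w', (0 : ℝ)) ∈ Metric.ball (w, (0 : ℝ)) δ := by
      simpa [Metric.mem_ball, Prod.dist_eq, hδ] using hd
    rw [← hw'.2]
    have h1 : Tendsto (fun p => c (K.incl (F p))) (idealNhds w') (𝓝 (c (φ w'))) :=
      (c.continuousAt hw'.1).tendsto.comp (hF.tendsto w' (hb hd').1)
    have h2 : Tendsto (fun p => S.bar (toBar p)) (idealNhds w') (𝓝 (S.bar (bdry w'))) :=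
      (S.bar.continuous.tendsto _).comp tendsto_comap
    refine tendsto_nhds_unique (h2.congr' ?_) h1
    filter_upwards [eventually_coord_mem (Metric.isOpen_ball.mem_nhds hd')] with p hp
    rw [hk p hp, hS p hp, S.bar_toBar]
  filter_upwards [eventually_coord_mem (Metric.ball_mem_nhds _ hδ)] with p hp
  exact ⟨hmem p hp, by rw [hk p hp, hS p hp, ExtIsom.eq_of_bar_eq hbar]⟩

/-- Local extensions on a convex open set containing an ideal point are unique. -/
theorem unique {U : Set (ℂ × ℝ)} {F₁ F₂ : Hyp3 → X} (h₁ : IsLocalExtension K φ U F₁)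
    (h₂ : IsLocalExtension K φ U F₂) (hU : IsOpen U) (hconv : Convex ℝ U) {w : ℂ}
    (hw : (w, (0 : ℝ)) ∈ U) (hφ : IsConformalAt K φ w) {p : Hyp3} (hp : coord p ∈ U) :
    F₁ p = F₂ p := by
  obtain ⟨c, hc, T, hT⟩ := hφ
  have he : ∀ᶠ p in idealNhds w, F₁ p = F₂ p := by
    filter_upwards [h₁.eventually_chart_eq (hU.mem_nhds hw) hc hT,
      h₂.eventually_chart_eq (hU.mem_nhds hw) hc hT] with p e1 e2
    exact K.incl_isEmbedding.injective (c.injOn e1.1 e2.1 (e1.2.trans e2.2.symm))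
  obtain ⟨p₀, hp₀, hp₀U⟩ := ((eventually_eventually_nhds_of_idealNhds he).and
    (eventually_coord_mem (hU.mem_nhds hw))).exists
  exact h₁.eq_of_eventuallyEq h₂ hconv subset_rfl subset_rfl hp₀U hp₀ hp

end IsLocalExtension

/-- Near an ideal point, a local extension is obtained from a chart at infinity. -/
theorem IsConformalAt.exists_isLocalExtension {w : ℂ} (h : IsConformalAt K φ w) :
    ∃ ε > 0, ∃ F, IsLocalExtension K φ (Metric.ball (w, (0 : ℝ)) ε) F := by
  obtain ⟨c, hc, T, hT⟩ := h
  have hT' := eventually_coe_of_eventually hT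
  have hcont : Continuous fun x : ℂ × ℝ => T.bar (barOf x) := T.bar.continuous.comp continuous_barOf
  have htgt : ∀ᶠ x in 𝓝 (w, (0 : ℝ)), T.bar (barOf x) ∈ c.target := by
    refine (hcont.tendsto _) (c.open_target.mem_nhds ?_)
    rw [barOf_zero, ← hT'.self_of_nhds.2]
    exact c.map_source hT'.self_of_nhds.1
  obtain ⟨ε, hε, hb⟩ := Metric.mem_nhds_iff.1
    (inter_mem htgt ((continuous_fst.tendsto (w, (0 : ℝ))).eventually hT'))
  have htgt' : ∀ p : Hyp3, coord p ∈ Metric.ball (w, (0 : ℝ)) ε → toBar (T p) ∈ c.target := by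
    intro p hp
    have := (hb hp).1
    rwa [mem_ofPred_eq, barOf_coord, T.bar_toBar] at this
  have hincl : ∀ q, toBar q ∈ c.target → ∃ x, K.incl x = c.symm (toBar q) := fun q hq =>
    hc.exists_incl (c.map_target hq) (c.right_inv hq)
  obtain ⟨p₀, hp₀⟩ := (eventually_coord_mem (Metric.ball_mem_nhds (w, (0 : ℝ)) hε)).exists
  have : Nonempty X := ⟨(hincl _ (htgt' p₀ hp₀)).choose⟩
  choose! f hf using hincl
  have hev : ∀ q, toBar q ∈ c.target → ∀ᶠ q' in 𝓝 q, K.incl (f q') = c.symm (toBar q') := by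
    intro q hq
    filter_upwards [isEmbedding_toBar.continuous.continuousAt.eventually
      (c.open_target.mem_nhds hq)] with q' hq' using hf q' hq'
  refine ⟨ε, hε, fun p => f (T p), fun p hp => ?_, fun p hp => ?_, fun w' hw' => ?_⟩
  · exact (hc.isometricAt_symm (htgt' p hp) (hev _ (htgt' p hp))).2
  · exact (hc.isometricAt_symm (htgt' p hp) (hev _ (htgt' p hp))).1.comp (T.isometricAt p)
  · have h1 := (hb hw').2
    have h2 : Tendsto (fun p => c.symm (T.bar (toBar p))) (idealNhds w')
        (𝓝 (c.symm (T.bar (bdry w')))) := by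
      refine (c.symm.continuousAt ?_).tendsto.comp
        ((T.bar.continuous.tendsto _).comp tendsto_comap)
      rw [← h1.2]
      exact c.map_source h1.1
    rw [← h1.2, c.left_inv h1.1] at h2
    refine h2.congr' ?_
    filter_upwards [eventually_coord_mem (Metric.isOpen_ball.mem_nhds hw')] with p hp
    rw [hf _ (htgt' p hp), T.bar_toBar]

end

/-! ### Concentric half-balls -/

/-- The Euclidean ball of radius `R` about the origin of `ℂ × ℝ`. Its part with positive height is
the hyperbolic half-space bounded by the disk of radius `R`. -/
def euclBall (R : ℝ) : Set (ℂ × ℝ) := {x | ‖x.1‖ ^ 2 + x.2 ^ 2 < R ^ 2}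

theorem mem_euclBall {R : ℝ} {x : ℂ × ℝ} : x ∈ euclBall R ↔ ‖x.1‖ ^ 2 + x.2 ^ 2 < R ^ 2 := Iff.rfl

theorem coord_mem_euclBall {R : ℝ} {p : Hyp3} : coord p ∈ euclBall R ↔ p.sq < R ^ 2 := Iff.rfl

theorem isOpen_euclBall (R : ℝ) : IsOpen (euclBall R) :=
  isOpen_lt (by fun_prop) continuous_const

theorem convex_euclBall (R : ℝ) : Convex ℝ (euclBall R) := by
  have h1 : ConvexOn ℝ univ fun x : ℂ × ℝ => ‖x.1‖ ^ 2 + x.2 ^ 2 := by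
    have a : ConvexOn ℝ univ fun x : ℂ × ℝ => ‖x.1‖ ^ 2 :=
      ((convexOn_univ_norm (E := ℂ)).comp_linearMap (LinearMap.fst ℝ ℂ ℝ)).pow
        (fun x _ => norm_nonneg _) 2
    have b : ConvexOn ℝ univ fun x : ℂ × ℝ => x.2 ^ 2 :=
      (even_two.convexOn_pow (𝕜 := ℝ)).comp_linearMap (LinearMap.snd ℝ ℂ ℝ)
    exact a.add b
  simpa [euclBall] using h1.convex_lt (R ^ 2)

theorem euclBall_mono {R R' : ℝ} (hR : 0 ≤ R) (h : R ≤ R') : euclBall R ⊆ euclBall R' :=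
  fun _ hx => lt_of_lt_of_le hx (pow_le_pow_left₀ hR h 2)

/-- The closed upper hemisphere of radius `R` about the origin. -/
def hemisphere (R : ℝ) : Set (ℂ × ℝ) := {x | ‖x.1‖ ^ 2 + x.2 ^ 2 = R ^ 2 ∧ 0 ≤ x.2}

theorem isCompact_hemisphere (R : ℝ) : IsCompact (hemisphere R) := by
  refine Metric.isCompact_of_isClosed_isBounded ?_ ?_
  · exact (isClosed_eq (by fun_prop) continuous_const).inter
      (isClosed_le continuous_const continuous_snd)
  · refine (Metric.isBounded_closedBall (x := (0 : ℂ × ℝ)) (r := |R|)).subset fun x hx => ?_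
    rw [mem_closedBall_zero_iff, Prod.norm_def, max_le_iff, Real.norm_eq_abs]
    exact ⟨by rw [← abs_norm]; exact sq_le_sq.1 (by nlinarith [hx.1, sq_nonneg x.2]),
      sq_le_sq.1 (by nlinarith [hx.1, sq_nonneg ‖x.1‖])⟩

/-- Points of the hemisphere are limits of points of the half-ball. -/
theorem exists_coord_mem_euclBall {R : ℝ} (hR : 0 < R) {x : ℂ × ℝ} (hx : x ∈ hemisphere R)
    {V : Set (ℂ × ℝ)} (hV : V ∈ 𝓝 x) : ∃ p, coord p ∈ V ∧ coord p ∈ euclBall R := by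
  have hc : Tendsto (fun η : ℝ => (((1 - η : ℝ) : ℂ) * x.1, (1 - η) * x.2 + η * (R / 2)))
      (𝓝[>] 0) (𝓝 x) := by
    have h : Continuous fun η : ℝ => (((1 - η : ℝ) : ℂ) * x.1, (1 - η) * x.2 + η * (R / 2)) := by
      fun_prop
    have := (h.tendsto 0).mono_left (nhdsWithin_le_nhds (s := Ioi (0 : ℝ)))
    simpa using this
  obtain ⟨η, hηV, hη0, hη1⟩ := ((hc.eventually hV).and
    (Ioo_mem_nhdsGT (zero_lt_one (α := ℝ)))).exists
  have hx2 : x.2 ≤ R := abs_le_of_sq_le_sq' (by nlinarith [hx.1, sq_nonneg ‖x.1‖]) hR.le |>.2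
  have hpos : 0 < (1 - η) * x.2 + η * (R / 2) := by
    have := mul_nonneg (sub_nonneg.2 hη1.le) hx.2
    positivity
  refine ⟨⟨((1 - η : ℝ) : ℂ) * x.1, (1 - η) * x.2 + η * (R / 2), hpos⟩, hηV, ?_⟩
  rw [coord_mem_euclBall, Hyp3.sq, norm_mul, Complex.norm_real, Real.norm_eq_abs, mul_pow, sq_abs]
  have h1 := hx.1
  have h2 : (1 - η) * η * R * x.2 ≤ (1 - η) * η * R * R := by
    have := sub_nonneg.2 hη1.le
    gcongr
  have h3 : 0 < η * (1 - η / 4) * R ^ 2 := by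
    have : 0 < 1 - η / 4 := by linarith
    positivity
  nlinarith

section

variable {N : Type*} [TopologicalSpace N] [T2Space N] [CompactSpace N]
  [ChartedSpace (EuclideanHalfSpace 3) N] {X : Type*} [EMetricSpace X] {K : HypConeManifold N X}
  {φ : Sphere → N} {F : Hyp3 → X} {R : ℝ}

/-! ### Continuation across the boundary of a half-ball -/

/-- The local extension `F` on the half-ball of radius `R` continues to a neighbourhood of `x`. -/
def Continues (K : HypConeManifold N X) (φ : Sphere → N) (R : ℝ) (F : Hyp3 → X) (x : ℂ × ℝ)
    (ε : ℝ) : Prop :=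
  ∃ F', IsLocalExtension K φ (Metric.ball x ε) F' ∧
    ∀ p, coord p ∈ Metric.ball x ε → coord p ∈ euclBall R → F' p = F p

theorem Continues.mono {x y : ℂ × ℝ} {ε δ : ℝ} (h : Continues K φ R F x ε)
    (hsub : Metric.ball y δ ⊆ Metric.ball x ε) : Continues K φ R F y δ := by
  obtain ⟨F', h1, h2⟩ := h
  exact ⟨F', h1.mono fun z hz _ => hsub hz, fun p hp => h2 p (hsub hp)⟩

/-- Continuation at ideal points of the hemisphere. -/
theorem IsLocalExtension.continues_of_ideal (hF : IsLocalExtension K φ (euclBall R) F) (hR : 0 < R)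
    {w : ℂ} (hw : ‖w‖ = R) (hφ : ∀ᶠ w' in 𝓝 w, IsConformalAt K φ (w' : ℂ)) :
    ∃ ε > 0, Continues K φ R F (w, 0) ε := by
  obtain ⟨ε, hε, F', hF'⟩ := hφ.self_of_nhds.exists_isLocalExtension
  refine ⟨ε, hε, F', hF', fun p hp hpR => ?_⟩
  -- an ideal point in the intersection of the two balls
  have hc : Tendsto (fun η : ℝ => ((1 - η : ℝ) : ℂ) * w) (𝓝[>] 0) (𝓝 w) := by
    have h : Continuous fun η : ℝ => ((1 - η : ℝ) : ℂ) * w := by fun_prop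
    simpa using (h.tendsto 0).mono_left (nhdsWithin_le_nhds (s := Ioi (0 : ℝ)))
  obtain ⟨η, ⟨hη1, hη2⟩, hη3⟩ := (((hc.eventually hφ).and
    (hc.eventually (Metric.ball_mem_nhds w hε))).and
    (Ioo_mem_nhdsGT (zero_lt_one (α := ℝ)))).exists
  refine IsLocalExtension.unique (hF'.mono fun x hx _ => hx.1) (hF.mono fun x hx _ => hx.2)
    (Metric.isOpen_ball.inter (isOpen_euclBall R))
    ((convex_ball _ _).inter (convex_euclBall R)) (w := ((1 - η : ℝ) : ℂ) * w) ⟨?_, ?_⟩ hη1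
    ⟨hp, hpR⟩
  · have : dist (((1 - η : ℝ) : ℂ) * w) w < ε := hη2
    rw [Metric.mem_ball, Prod.dist_eq]
    simpa [hε] using this
  · rw [mem_euclBall, norm_mul, Complex.norm_real, Real.norm_eq_abs, mul_pow, sq_abs, hw]
    have h0 := hη3.1
    have h1 := hη3.2
    have : (1 - η) ^ 2 < 1 := by nlinarith
    have hR2 : 0 < R ^ 2 := by positivity
    simp only [ne_eq, OfNat.ofNat_ne_zero, not_false_eq_true, zero_pow, add_zero]
    nlinarith

theorem mem_closure_coord_preimage (hR : 0 < R) {p : Hyp3} (hp : p.sq = R ^ 2) :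
    p ∈ closure (coord ⁻¹' euclBall R) := by
  rw [mem_closure_iff_nhds]
  intro U hU
  rw [isInducing_coord.nhds_eq_comap] at hU
  obtain ⟨V, hV, hVU⟩ := mem_comap.1 hU
  obtain ⟨q, hq1, hq2⟩ := exists_coord_mem_euclBall hR (x := coord p) ⟨hp, p.t_pos.le⟩ hV
  exact ⟨q, hVU hq1, hq2⟩

/-- By completeness, a local extension has limits at the points of the hemisphere. -/
theorem IsLocalExtension.exists_tendsto (hF : IsLocalExtension K φ (euclBall R) F) (hR : 0 < R)
    {p : Hyp3} (hp : p.sq = R ^ 2) : ∃ x, Tendsto F (𝓝[coord ⁻¹' euclBall R] p) (𝓝 x) := by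
  have := K.complete
  have hne : NeBot (𝓝[coord ⁻¹' euclBall R] p) :=
    mem_closure_iff_nhdsWithin_neBot.1 (mem_closure_coord_preimage hR hp)
  obtain ⟨τ, hτ0, hτp⟩ : ∃ τ, 0 < τ ∧ τ < p.t := ⟨p.t / 2, by have := p.t_pos; linarith,
    by have := p.t_pos; linarith⟩
  have hV : Convex ℝ (euclBall R ∩ {x : ℂ × ℝ | τ < x.2}) :=
    (convex_euclBall R).inter (convex_halfSpace_gt (LinearMap.snd ℝ ℂ ℝ).isLinear τ)
  have hV' : IsOpen (euclBall R ∩ {x : ℂ × ℝ | τ < x.2}) :=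
    (isOpen_euclBall R).inter (isOpen_lt continuous_const continuous_snd)
  obtain ⟨C, hC⟩ : ∃ C : ℝ≥0, (C : ℝ) = 2 / τ := ⟨⟨2 / τ, by positivity⟩, rfl⟩
  -- `F` in coordinates is locally Lipschitz
  let f : ℂ × ℝ → X := fun x => if h : 0 < x.2 then F ⟨x.1, x.2, h⟩ else F p
  have hf : ∀ q : Hyp3, f (coord q) = F q := fun q => dif_pos q.t_pos
  have hlip : ∀ a b : Hyp3, coord a ∈ euclBall R ∩ {x : ℂ × ℝ | τ < x.2} →
      coord b ∈ euclBall R ∩ {x : ℂ × ℝ | τ < x.2} →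
      edist (F a) (F b) ≤ C * edist (coord a) (coord b) := by
    intro a b ha hb
    rw [← hf a, ← hf b]
    refine edist_le_of_locally hV (fun x hx => ?_) ha hb
    obtain ⟨q, rfl⟩ : ∃ q, coord q = x := ⟨⟨x.1, x.2, hτ0.trans hx.2⟩, rfl⟩
    obtain ⟨W, hW, hWF⟩ := hF.isometricAt q hx.1
    rw [← isOpenEmbedding_coord.image_mem_nhds] at hW
    refine ⟨_, inter_mem (mem_nhdsWithin_of_mem_nhds hW) self_mem_nhdsWithin, ?_⟩
    rintro _ ⟨⟨a, ha, rfl⟩, ha'⟩ _ ⟨⟨b, hb, rfl⟩, hb'⟩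
    rw [hf, hf, hWF a ha b hb, edist_dist, edist_dist, ← ENNReal.ofReal_coe_nnreal, hC,
      ← ENNReal.ofReal_mul (by positivity)]
    exact ENNReal.ofReal_le_ofReal (dist_le_of_le_t hτ0 (le_of_lt ha'.2) (le_of_lt hb'.2))
  have hcauchy : Cauchy (map F (𝓝[coord ⁻¹' euclBall R] p)) := by
    rw [cauchy_map_iff]
    refine ⟨hne, uniformity_basis_edist.tendsto_right_iff.2 fun ε hε => ?_⟩
    have hlim : Tendsto (fun x : Hyp3 × Hyp3 => C * edist (coord x.1) (coord x.2))
        (𝓝[coord ⁻¹' euclBall R] p ×ˢ 𝓝[coord ⁻¹' euclBall R] p) (𝓝 0) := by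
      have h1 : Continuous fun x : Hyp3 × Hyp3 => edist (coord x.1) (coord x.2) := by fun_prop
      have h2 := ENNReal.Tendsto.const_mul (h1.tendsto (p, p))
        (Or.inr (ENNReal.coe_ne_top (r := C)))
      rw [edist_self, mul_zero, nhds_prod_eq] at h2
      exact h2.mono_left (prod_mono nhdsWithin_le_nhds nhdsWithin_le_nhds)
    have hmem : ∀ᶠ q in 𝓝[coord ⁻¹' euclBall R] p,
        coord q ∈ euclBall R ∩ {x : ℂ × ℝ | τ < x.2} := by
      filter_upwards [self_mem_nhdsWithin, mem_nhdsWithin_of_mem_nhds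
        (continuous_t.continuousAt.eventually (lt_mem_nhds hτp))] with q h1 h2 using ⟨h1, h2⟩
    filter_upwards [hlim.eventually (gt_mem_nhds hε), hmem.prod_mk hmem] with x h1 h2
    exact (hlip _ _ h2.1 h2.2).trans_lt h1
  exact CompleteSpace.complete hcauchy

/-- Continuation at the points of the hemisphere where the limit is non-singular. -/
theorem IsLocalExtension.continues_of_tendsto (hF : IsLocalExtension K φ (euclBall R) F)
    (hR : 0 < R) {p : Hyp3} (hp : p.sq = R ^ 2) {x : X}
    (hlim : Tendsto F (𝓝[coord ⁻¹' euclBall R] p) (𝓝 x)) (hx : x ∈ K.nonsingular) :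
    ∃ ε > 0, Continues K φ R F (coord p) ε := by
  have hne : NeBot (𝓝[coord ⁻¹' euclBall R] p) :=
    mem_closure_iff_nhdsWithin_neBot.1 (mem_closure_coord_preimage hR hp)
  obtain ⟨k, hk⟩ := locallyModelled_iff.1 hx
  obtain ⟨g, hg, -, hgk⟩ := hk.exists_inverse
  obtain ⟨U, hU, hUF⟩ := mem_nhdsWithin_iff_exists_mem_nhds_inter.1
    (hlim (inter_mem hk.1.eventually hgk))
  rw [isInducing_coord.nhds_eq_comap] at hU
  obtain ⟨V, hV, hVU⟩ := mem_comap.1 hU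
  obtain ⟨δ, hδ, hb⟩ := Metric.mem_nhds_iff.1 hV
  have hmem : ∀ q, coord q ∈ Metric.ball (coord p) δ ∩ euclBall R →
      IsometricAt k (F q) ∧ g (k (F q)) = F q := fun q hq => hUF ⟨hVU (hb hq.1), hq.2⟩
  have hev : ∀ᶠ q in 𝓝[coord ⁻¹' euclBall R] p, coord q ∈ Metric.ball (coord p) δ ∩ euclBall R :=
    inter_mem (mem_nhdsWithin_of_mem_nhds (eventually_nhds_coord_mem (Metric.ball_mem_nhds _ hδ)))
      self_mem_nhdsWithin
  obtain ⟨T, hT⟩ := exists_extIsom_of_isPreconnected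
    (isPreconnected_coord_preimage ((convex_ball (coord p) δ).inter (convex_euclBall R)))
    hev.exists (f := fun q => k (F q))
    (fun q hq => (hmem q hq).1.comp (hF.isometricAt q hq.2))
  have hTp : T p = k x := by
    have h1 : Tendsto T (𝓝[coord ⁻¹' euclBall R] p) (𝓝 (T p)) :=
      (T.continuous.tendsto p).mono_left nhdsWithin_le_nhds
    have h2 := hk.1.continuousAt.tendsto.comp hlim
    exact tendsto_nhds_unique h1 (h2.congr' (hev.mono fun q hq => hT q hq))
  have hgT : ∀ᶠ q in 𝓝 p, OpenIsometricAt g (T q) := by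
    refine T.continuous.continuousAt.eventually ?_
    rw [hTp]
    exact hg.eventually
  have hgT' : {q | OpenIsometricAt g (T q)} ∈ 𝓝 p := hgT
  rw [isInducing_coord.nhds_eq_comap] at hgT'
  obtain ⟨V', hV', hVg⟩ := mem_comap.1 hgT'
  obtain ⟨ε, hε, hb'⟩ := Metric.mem_nhds_iff.1 (inter_mem hV' (inter_mem
    (Metric.ball_mem_nhds (coord p) hδ)
    ((continuous_snd.tendsto (coord p)).eventually (lt_mem_nhds p.t_pos))))
  refine ⟨ε, hε, fun q => g (T q), ⟨fun q hq => ?_, fun q hq => ?_, fun w hw => ?_⟩,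
    fun q hq hqR => ?_⟩
  · have h1 : OpenIsometricAt g (T q) := hVg (hb' hq).1
    exact h1.locallyModelled_iff.2 (locallyModelled_iff.2
      ⟨id, ⟨univ, univ_mem, fun _ _ _ _ => rfl⟩, le_rfl⟩)
  · have h1 : OpenIsometricAt g (T q) := hVg (hb' hq).1
    exact h1.1.comp (T.isometricAt q)
  · exact absurd (show (0 : ℝ) < 0 from (hb' hw).2.2) (lt_irrefl _)
  · have h1 : coord q ∈ Metric.ball (coord p) δ ∩ euclBall R := ⟨(hb' hq).2.1, hqR⟩
    change g (T q) = F q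
    rw [← hT q h1, (hmem q h1).2]

theorem cosh_dist_vertical (q : Hyp3) {h : ℝ} (hh : 0 < h) :
    Real.cosh (dist q ⟨0, h, hh⟩) = (q.sq + h ^ 2) / (2 * q.t * h) := by
  have := q.t_pos
  rw [cosh_dist, Hyp3.sq]
  field_simp
  simp only [sub_zero]
  ring

/-- Along a geodesic, `cosh` of the distance to a point satisfies the equation `f'' = f`, in the
form of a functional equation. -/
theorem cosh_dist_geodesic (S : ExtIsom) (z : Hyp3) (s h : ℝ) :
    Real.cosh (dist (S (cyl 0 0 (s + h))) z) + Real.cosh (dist (S (cyl 0 0 (s - h))) z) =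
      2 * Real.cosh h * Real.cosh (dist (S (cyl 0 0 s)) z) := by
  have key : ∀ u, Real.cosh (dist (S (cyl 0 0 u)) z) =
      Real.cosh (S.symm z).cylR * Real.cosh (u - (S.symm z).cylX) := by
    intro u
    conv_lhs => rw [← S.apply_symm_apply z, S.dist_eq, ← cyl_cylR_cylX (S.symm z)]
    rw [cosh_dist_cyl]
    simp
  rw [key, key, key]
  have e1 : s + h - (S.symm z).cylX = (s - (S.symm z).cylX) + h := by ring
  have e2 : s - h - (S.symm z).cylX = (s - (S.symm z).cylX) - h := by ring
  rw [e1, e2]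
  generalize s - (S.symm z).cylX = u
  rw [Real.cosh_add, Real.cosh_sub]
  ring

/-- A local extension on a half-ball continues across every point of its boundary hemisphere. If it
did not, it would tend to singular points along a geodesic in the hemisphere through a point of least
height among those where it fails to continue; but on such a geodesic the height has no local
minimum. -/
theorem IsLocalExtension.continues (hF : IsLocalExtension K φ (euclBall R) F) (hR : 0 < R)
    (hφ : ∀ w : ℂ, ‖w‖ = R → ∀ᶠ w' in 𝓝 w, IsConformalAt K φ (w' : ℂ)) :
    ∀ x ∈ hemisphere R, ∃ ε > 0, Continues K φ R F x ε := by
  by_contra hbad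
  have hopen : IsOpen {x | ∃ ε > 0, Continues K φ R F x ε} := by
    rw [isOpen_iff_mem_nhds]
    rintro x ⟨ε, hε, h⟩
    filter_upwards [Metric.ball_mem_nhds x hε] with y hy
    refine ⟨ε - dist y x, sub_pos.2 hy, h.mono (Metric.ball_subset_ball' ?_)⟩
    linarith
  have hcpt : IsCompact (hemisphere R ∩ {x | ∃ ε > 0, Continues K φ R F x ε}ᶜ) :=
    (isCompact_hemisphere R).inter_right hopen.isClosed_compl
  have hne : (hemisphere R ∩ {x | ∃ ε > 0, Continues K φ R F x ε}ᶜ).Nonempty := by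
    push Not at hbad
    obtain ⟨x, hx, hx'⟩ := hbad
    refine ⟨x, hx, fun ⟨ε, hε, h⟩ => hx' ε hε h⟩
  obtain ⟨x, ⟨hxS, hxbad⟩, hmin⟩ := hcpt.exists_isMinOn hne continuous_snd.continuousOn
  have hx2 : 0 < x.2 := by
    refine lt_of_le_of_ne hxS.2 fun h0 => hxbad ?_
    obtain ⟨w, t⟩ := x
    change 0 = t at h0
    subst h0
    have hw : ‖w‖ = R := by
      have := hxS.1
      simp only [ne_eq, OfNat.ofNat_ne_zero, not_false_eq_true, zero_pow, add_zero] at this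
      exact (sq_eq_sq₀ (norm_nonneg w) hR.le).1 this
    exact hF.continues_of_ideal hR hw (hφ w hw)
  obtain ⟨p, rfl⟩ : ∃ p, coord p = x := ⟨⟨x.1, x.2, hx2⟩, rfl⟩
  have hpsq : p.sq = R ^ 2 := hxS.1
  obtain ⟨y, hy⟩ := hF.exists_tendsto hR hpsq
  have hysing : ¬ LocallyModelled Hyp3 y := fun h =>
    hxbad (hF.continues_of_tendsto hR hpsq hy h)
  obtain ⟨α, hα, hcone⟩ := K.cone y
  obtain ⟨S, s₀, hS, hgeo⟩ := exists_singular_geodesic hα (fun U hU => by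
      rw [isInducing_coord.nhds_eq_comap] at hU
      obtain ⟨V, hV, hVU⟩ := mem_comap.1 hU
      obtain ⟨δ, hδ, hb⟩ := Metric.mem_nhds_iff.1 hV
      refine ⟨coord ⁻¹' Metric.ball (coord p) δ,
        eventually_nhds_coord_mem (Metric.ball_mem_nhds _ hδ), fun q hq => hVU (hb hq), ?_⟩
      rw [← preimage_inter]
      exact isPreconnected_coord_preimage ((convex_ball _ _).inter (convex_euclBall R)))
    (mem_closure_coord_preimage hR hpsq) (fun q hq => hF.isometricAt q hq)
    (fun q hq => hF.mem q hq) hy hcone hysing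
  obtain ⟨η, hη, hηgeo⟩ := Metric.eventually_nhds_iff.1 hgeo
  obtain ⟨h, hh0, hhη⟩ : ∃ h : ℝ, 0 < h ∧ h < η := ⟨η / 2, by positivity, by linarith⟩
  obtain ⟨hp1, y1, hy1, hlim1⟩ := hηgeo (y := s₀ + h) (by
    rw [Real.dist_eq, add_sub_cancel_left, abs_of_pos hh0]; exact hhη)
  obtain ⟨hm1, y2, hy2, hlim2⟩ := hηgeo (y := s₀ - h) (by
    rw [Real.dist_eq, sub_sub_cancel_left, abs_neg, abs_of_pos hh0]; exact hhη)
  have f1 := cosh_dist_geodesic S ⟨0, 2 * R, by positivity⟩ s₀ h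
  have f2 := cosh_dist_geodesic S ⟨0, R / 2, by positivity⟩ s₀ h
  have f3 := cosh_dist_geodesic S ⟨0, R, hR⟩ s₀ h
  rw [cosh_dist_vertical, cosh_dist_vertical, cosh_dist_vertical, hS, hpsq] at f1 f2 f3
  -- a point of the hemisphere where `F` has a singular limit is no lower than `p`
  have hlow : ∀ (o : Hyp3) (y' : X), ¬ LocallyModelled Hyp3 y' →
      Tendsto F (𝓝[coord ⁻¹' euclBall R] o) (𝓝 y') → o.sq = R ^ 2 → p.t ≤ o.t := by
    intro o y' hy' hlim ho
    refine isMinOn_iff.1 hmin (coord o) ⟨⟨ho, o.t_pos.le⟩, ?_⟩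
    rintro ⟨ε, hε, F', hF', heq⟩
    have : NeBot (𝓝[coord ⁻¹' euclBall R] o) :=
      mem_closure_iff_nhdsWithin_neBot.1 (mem_closure_coord_preimage hR ho)
    have h1 : Tendsto F (𝓝[coord ⁻¹' euclBall R] o) (𝓝 (F' o)) := by
      refine ((hF'.isometricAt o (Metric.mem_ball_self hε)).continuousAt.mono_left
        nhdsWithin_le_nhds).congr' ?_
      filter_upwards [mem_nhdsWithin_of_mem_nhds (eventually_nhds_coord_mem
        (Metric.ball_mem_nhds _ hε)), self_mem_nhdsWithin] with q hq1 hq2 using heq q hq1 hq2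
    rw [tendsto_nhds_unique hlim h1] at hy'
    exact hy' (hF'.mem o (Metric.mem_ball_self hε))
  have l1 := hlow _ _ hy1 hlim1
  have l2 := hlow _ _ hy2 hlim2
  rw [mem_preimage, coord_mem_euclBall, not_lt] at hp1 hm1
  have hp := p.t_pos
  generalize S (cyl 0 0 (s₀ + h)) = o₁ at *
  generalize S (cyl 0 0 (s₀ - h)) = o₂ at *
  have ho₁ := o₁.t_pos
  have ho₂ := o₂.t_pos
  have hcosh : 1 < Real.cosh h := Real.one_lt_cosh.2 hh0.ne'
  generalize Real.cosh h = C at *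
  -- the geodesic stays on one side of the hemisphere, hence in the hemisphere
  have hsum : (o₁.sq - R ^ 2) / o₁.t + (o₂.sq - R ^ 2) / o₂.t = 0 := by
    have e : ∀ (u t : ℝ), 0 < t → (u + (2 * R) ^ 2) / (2 * t * (2 * R)) -
        (u + (R / 2) ^ 2) / (2 * t * (R / 2)) = -3 / (4 * R) * ((u - R ^ 2) / t) := by
      intro u t ht
      field_simp
      ring
    have e1 := e o₁.sq o₁.t ho₁
    have e2 := e o₂.sq o₂.t ho₂
    have e3 := e (R ^ 2) p.t hp
    rw [sub_self, zero_div, mul_zero] at e3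
    have : -3 / (4 * R) * ((o₁.sq - R ^ 2) / o₁.t + (o₂.sq - R ^ 2) / o₂.t) = 0 := by
      linear_combination f1 - f2 - e1 - e2 + 2 * C * e3
    refine (mul_eq_zero.1 this).resolve_left ?_
    exact div_ne_zero (by norm_num) (by positivity)
  have n1 : 0 ≤ (o₁.sq - R ^ 2) / o₁.t := div_nonneg (by linarith) ho₁.le
  have n2 : 0 ≤ (o₂.sq - R ^ 2) / o₂.t := div_nonneg (by linarith) ho₂.le
  have z1 : o₁.sq = R ^ 2 := by
    have : (o₁.sq - R ^ 2) / o₁.t = 0 := by linarith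
    rcases div_eq_zero_iff.1 this with h | h <;> linarith
  have z2 : o₂.sq = R ^ 2 := by
    have : (o₂.sq - R ^ 2) / o₂.t = 0 := by linarith
    rcases div_eq_zero_iff.1 this with h | h <;> linarith
  rw [z1, z2] at f3
  have e : ∀ t : ℝ, 0 < t → (R ^ 2 + R ^ 2) / (2 * t * R) = R / t := by
    intro t ht
    field_simp
    ring
  rw [e _ ho₁, e _ ho₂, e _ hp] at f3
  have m1 : R / o₁.t ≤ R / p.t := div_le_div_of_nonneg_left hR.le hp (l1 z1)
  have m2 : R / o₂.t ≤ R / p.t := div_le_div_of_nonneg_left hR.le hp (l2 z2)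
  have m3 : 0 < R / p.t := by positivity
  nlinarith

/-- A local extension on a half-ball extends to a larger half-ball. -/
theorem IsLocalExtension.exists_larger (hF : IsLocalExtension K φ (euclBall R) F) (hR : 0 < R)
    (hφ : ∀ w : ℂ, ‖w‖ = R → ∀ᶠ w' in 𝓝 w, IsConformalAt K φ (w' : ℂ)) :
    ∃ R' > R, ∃ F', IsLocalExtension K φ (euclBall R') F' := by
  have hcont := hF.continues hR hφ
  -- a radius at which `F` continues uniformly
  obtain ⟨δ, hδ, hδF⟩ : ∃ δ > 0, ∀ x ∈ hemisphere R, Continues K φ R F x δ := by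
    choose! ε hε hc using hcont
    obtain ⟨δ, hδ, h⟩ := lebesgue_number_lemma_of_metric (isCompact_hemisphere R)
      (c := fun x : hemisphere R => Metric.ball (x : ℂ × ℝ) (ε x))
      (fun _ => Metric.isOpen_ball)
      (fun x hx => mem_iUnion.2 ⟨⟨x, hx⟩, Metric.mem_ball_self (hε x hx)⟩)
    refine ⟨δ, hδ, fun x hx => ?_⟩
    obtain ⟨i, hi⟩ := h x hx
    exact (hc i i.2).mono hi
  have : Nonempty X := ⟨F ⟨0, 1, one_pos⟩⟩
  choose! G hG hGF using hδF
  have hball : ∀ x ∈ hemisphere R, ∀ y ∈ hemisphere R, ∀ p,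
      coord p ∈ Metric.ball x (δ / 2) → coord p ∈ Metric.ball y (δ / 2) → G x p = G y p := by
    intro x hx y hy p hpx hpy
    have hxy : dist x y < δ := by
      have := dist_triangle_left x y (coord p)
      rw [Metric.mem_ball] at hpx hpy
      linarith
    have hO : IsOpen (Metric.ball x δ ∩ Metric.ball y δ) := Metric.isOpen_ball.inter Metric.isOpen_ball
    obtain ⟨p₀, hp₀, hp₀R⟩ := exists_coord_mem_euclBall hR hx
      (hO.mem_nhds ⟨Metric.mem_ball_self hδ, hxy⟩)
    refine (hG x hx).eq_of_eventuallyEq (hG y hy) ((convex_ball x δ).inter (convex_ball y δ))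
      inter_subset_left inter_subset_right hp₀ ?_
      ⟨Metric.ball_subset_ball (by linarith) hpx, Metric.ball_subset_ball (by linarith) hpy⟩
    filter_upwards [eventually_nhds_coord_mem (hO.mem_nhds hp₀),
      eventually_nhds_coord_mem ((isOpen_euclBall R).mem_nhds hp₀R)] with q h1 h2
    rw [hGF x hx q h1.1 h2, hGF y hy q h1.2 h2]
  obtain ⟨F', hF', -⟩ := IsLocalExtension.glue (K := K) (φ := φ) (ι := Option (hemisphere R)) none
    (U := fun i => i.elim (euclBall R) fun x => Metric.ball (x : ℂ × ℝ) (δ / 2))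
    (F := fun i => i.elim F fun x => G x)
    (by
      rintro (_ | x)
      · exact isOpen_euclBall R
      · exact Metric.isOpen_ball)
    (by
      rintro (_ | x)
      · exact hF
      · exact (hG x x.2).mono fun y hy _ => Metric.ball_subset_ball (by linarith) hy)
    (by
      rintro (_ | x) (_ | y) p h1 h2
      · rfl
      · exact (hGF y y.2 p (Metric.ball_subset_ball (by linarith) h2) h1).symm
      · exact hGF x x.2 p (Metric.ball_subset_ball (by linarith) h1) h2
      · exact hball x x.2 y y.2 p h1 h2)
  refine ⟨R + δ / 2, by linarith, F', hF'.mono fun x hx hx2 => ?_⟩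
  rw [mem_iUnion]
  by_cases hxR : x ∈ euclBall R
  · exact ⟨none, hxR⟩
  -- project radially to the hemisphere
  rw [mem_euclBall, not_lt] at hxR
  rw [mem_euclBall] at hx
  obtain ⟨n, hn, hn2⟩ : ∃ n : ℝ, 0 ≤ n ∧ n ^ 2 = ‖x.1‖ ^ 2 + x.2 ^ 2 :=
    ⟨_, Real.sqrt_nonneg _, Real.sq_sqrt (by positivity)⟩
  rw [← hn2] at hxR hx
  have hRn : R ≤ n := (sq_le_sq₀ hR.le hn).1 hxR
  have hnR : n < R + δ / 2 := (sq_lt_sq₀ hn (by positivity)).1 hx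
  have hn0 : 0 < n := hR.trans_le hRn
  have hS : (((R / n : ℝ) : ℂ) * x.1, R / n * x.2) ∈ hemisphere R := by
    refine ⟨?_, by positivity⟩
    simp only [norm_mul, Complex.norm_real, Real.norm_eq_abs, mul_pow, sq_abs]
    rw [← mul_add, ← hn2]
    field_simp
  refine ⟨some ⟨_, hS⟩, ?_⟩
  change x ∈ Metric.ball _ _
  have hx1 : ‖x.1‖ ≤ n := abs_le_of_sq_le_sq' (by nlinarith [sq_nonneg x.2]) hn |>.2
  have hx2' : |x.2| ≤ n := abs_le_of_sq_le_sq (by nlinarith [sq_nonneg ‖x.1‖]) hn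
  have hc : |1 - R / n| * n < δ / 2 := by
    rw [abs_of_nonneg (by rw [sub_nonneg, div_le_one hn0]; exact hRn)]
    have : (1 - R / n) * n = n - R := by field_simp
    linarith
  rw [Metric.mem_ball, Prod.dist_eq, max_lt_iff, dist_eq_norm, Real.dist_eq]
  constructor
  · have : x.1 - ((R / n : ℝ) : ℂ) * x.1 = ((1 - R / n : ℝ) : ℂ) * x.1 := by push_cast; ring
    rw [this, norm_mul, Complex.norm_real, Real.norm_eq_abs]
    exact (mul_le_mul_of_nonneg_left hx1 (abs_nonneg _)).trans_lt hc
  · have : x.2 - R / n * x.2 = (1 - R / n) * x.2 := by ring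
    rw [this, abs_mul]
    exact (mul_le_mul_of_nonneg_left hx2' (abs_nonneg _)).trans_lt hc

/-- A map that is conformal on the unit disk extends to the half-ball over the unit disk. -/
theorem exists_isLocalExtension_unit (hφ : ∀ w : ℂ, ‖w‖ < 1 → IsConformalAt K φ w) :
    ∃ F, IsLocalExtension K φ (euclBall 1) F := by
  have hφ0 : IsConformalAt K φ ((0 : ℂ) : Sphere) := hφ 0 (by simp)
  let A : Set ℝ := {R | 0 < R ∧ R ≤ 1 ∧ ∃ F, IsLocalExtension K φ (euclBall R) F}
  have hA0 : ∃ R, R ∈ A := by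
    obtain ⟨ε, hε, F, hF⟩ := hφ0.exists_isLocalExtension
    refine ⟨min ε 1, by positivity, min_le_right _ _, F, hF.mono fun x hx _ => ?_⟩
    have h0 : (0 : ℝ) ≤ min ε 1 := by positivity
    rw [mem_euclBall] at hx
    have h1 : ‖x.1‖ < min ε 1 := (sq_lt_sq₀ (norm_nonneg _) h0).1 (by nlinarith [sq_nonneg x.2])
    have h2 : |x.2| < min ε 1 := abs_lt_of_sq_lt_sq (by nlinarith [sq_nonneg ‖x.1‖]) h0
    have hm := min_le_left ε 1
    rw [Metric.mem_ball, Prod.dist_eq, max_lt_iff]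
    exact ⟨by simpa using h1.trans_le hm, by simpa using h2.trans_le hm⟩
  obtain ⟨R₀, hR₀⟩ := hA0
  have hbdd : BddAbove A := ⟨1, fun R hR => hR.2.1⟩
  have hs0 : 0 < sSup A := hR₀.1.trans_le (le_csSup hbdd hR₀)
  have hs1 : sSup A ≤ 1 := csSup_le ⟨R₀, hR₀⟩ fun R hR => hR.2.1
  -- the extensions on smaller half-balls glue
  have hsA : ∃ F, IsLocalExtension K φ (euclBall (sSup A)) F := by
    choose F hF using fun R : A => R.2.2.2
    have h0 : ∀ R : ℝ, 0 < R → ((0 : ℂ), (0 : ℝ)) ∈ euclBall R := fun R hR => by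
      rw [mem_euclBall]
      simpa using pow_pos hR 2
    have heq : ∀ (i j : A), i.1 ≤ j.1 → ∀ p, coord p ∈ euclBall i → F i p = F j p := by
      intro i j hij p hp
      exact (hF i).unique ((hF j).mono fun x hx _ => euclBall_mono i.2.1.le hij hx)
        (isOpen_euclBall _) (convex_euclBall _) (h0 _ i.2.1) hφ0 hp
    obtain ⟨G, hG, -⟩ := IsLocalExtension.glue (⟨R₀, hR₀⟩ : A) (fun i : A => isOpen_euclBall i) hF
      (fun i j p hi hj => by
        rcases le_total i.1 j.1 with h | h
        · exact heq i j h p hi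
        · exact (heq j i h p hj).symm)
    refine ⟨G, hG.mono fun x hx _ => ?_⟩
    have hx' : √(‖x.1‖ ^ 2 + x.2 ^ 2) < sSup A := (Real.sqrt_lt' hs0).2 hx
    obtain ⟨R, hR, hxR⟩ := exists_lt_of_lt_csSup ⟨R₀, hR₀⟩ hx'
    exact mem_iUnion.2 ⟨⟨R, hR⟩, (Real.sqrt_lt' hR.1).1 hxR⟩
  rcases hs1.eq_or_lt with h | h
  · rwa [h] at hsA
  · obtain ⟨F, hF⟩ := hsA
    obtain ⟨R', hR', F', hF'⟩ := hF.exists_larger hs0 (fun w hw => by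
      have : ∀ᶠ w' : ℂ in 𝓝 w, ‖w'‖ < 1 := continuous_norm.continuousAt.eventually
        (gt_mem_nhds (by change ‖w‖ < 1; rw [hw]; exact h))
      filter_upwards [this] with w' hw' using hφ w' hw')
    have hmem : min R' 1 ∈ A := by
      refine ⟨lt_min (hs0.trans hR') one_pos, min_le_right _ _, F', hF'.mono fun x hx _ => ?_⟩
      exact euclBall_mono (le_min (hs0.trans hR').le zero_le_one) (min_le_left _ _) hx
    exact absurd (le_csSup hbdd hmem) (not_le.2 (lt_min hR' h))

end

/-! ### Normalization of round disks -/

/-- The extended isometry `B` takes the disk `D` to `D'`, and the half-space of `D` to that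
of `D'`. -/
structure ExtIsom.MapsDisk (B : ExtIsom) (D D' : RoundDisk) : Prop where
  halfSpace : ∀ p, B p ∈ D'.halfSpace ↔ p ∈ D.halfSpace
  disk : ∀ w w', B.bar (bdry w) = bdry w' → (w' ∈ D'.disk ↔ w ∈ D.disk)

theorem ExtIsom.MapsDisk.trans {B B' : ExtIsom} {D D' D'' : RoundDisk} (h : B.MapsDisk D D')
    (h' : B'.MapsDisk D' D'') : (B.trans B').MapsDisk D D'' where
  halfSpace p := (h'.halfSpace (B p)).trans (h.halfSpace p)
  disk w w'' hw := by
    obtain ⟨w', hw'⟩ := B.exists_bar_bdry w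
    rw [trans_bar, hw'] at hw
    exact (h'.disk w' w'' hw).trans (h.disk w w' hw')

namespace RoundDisk

theorem coe_mem_disk {D : RoundDisk} {z : ℂ} : (z : Sphere) ∈ D.disk ↔
    D.a * ‖z‖ ^ 2 + 2 * (starRingEnd ℂ D.b * z).re + D.c < 0 := by
  constructor
  · rintro (⟨h, -⟩ | ⟨z', h, hz'⟩)
    · exact absurd h (OnePoint.coe_ne_infty z)
    · rwa [OnePoint.coe_injective h]
  · exact fun h => Or.inr ⟨z, rfl, h⟩

theorem infty_mem_disk {D : RoundDisk} : (OnePoint.infty : Sphere) ∈ D.disk ↔ D.a < 0 := by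
  constructor
  · rintro (⟨-, h⟩ | ⟨z', h, -⟩)
    · exact h
    · exact absurd h.symm (OnePoint.coe_ne_infty z')
  · exact fun h => Or.inl ⟨rfl, h⟩

theorem mem_halfSpace {D : RoundDisk} {p : Hyp3} : p ∈ D.halfSpace ↔
    D.a * p.sq + 2 * (starRingEnd ℂ D.b * p.z).re + D.c < 0 := Iff.rfl

theorem isOpen_halfSpace (D : RoundDisk) : IsOpen D.halfSpace :=
  isOpen_lt (f := fun p : Hyp3 => D.a * (‖p.z‖ ^ 2 + p.t ^ 2) +
    2 * (starRingEnd ℂ D.b * p.z).re + D.c) (by fun_prop) continuous_const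

/-- The unit disk. -/
def unit : RoundDisk := ⟨1, 0, -1, by simp⟩

theorem mem_unit_halfSpace {p : Hyp3} : p ∈ unit.halfSpace ↔ p.sq < 1 := by
  rw [mem_halfSpace]
  simp only [unit, one_mul, map_zero, zero_mul, Complex.zero_re, mul_zero, add_zero]
  constructor <;> intro h <;> linarith

theorem coe_mem_unit_disk {z : ℂ} : (z : Sphere) ∈ unit.disk ↔ ‖z‖ < 1 := by
  rw [coe_mem_disk, ← sq_lt_one_iff₀ (norm_nonneg z)]
  simp only [unit, one_mul, map_zero, zero_mul, Complex.zero_re, mul_zero, add_zero]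
  constructor <;> intro h <;> linarith

theorem infty_notMem_unit_disk : (OnePoint.infty : Sphere) ∉ unit.disk := by
  rw [infty_mem_disk]
  simp [unit]

/-- The image under the translation by `v`. -/
def translate (D : RoundDisk) (v : ℂ) : RoundDisk where
  a := D.a
  b := D.b - D.a * v
  c := D.a * ‖v‖ ^ 2 - 2 * (starRingEnd ℂ D.b * v).re + D.c
  disc_pos := by
    have := D.disc_pos
    rw [← Complex.normSq_eq_norm_sq, Complex.normSq_apply] at this ⊢
    rw [← Complex.normSq_eq_norm_sq, Complex.normSq_apply]
    simp
    linarith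

theorem mapsDisk_translate (D : RoundDisk) (v : ℂ) :
    (similarity 1 v one_ne_zero).MapsDisk D (D.translate v) where
  halfSpace p := by
    rw [mem_halfSpace, mem_halfSpace]
    simp only [Hyp3.sq, similarity_z, similarity_t, translate, ← Complex.normSq_eq_norm_sq,
      Complex.normSq_apply]
    simp
    ring_nf
  disk w w' h := by
    induction w using OnePoint.rec with
    | infty =>
      rw [similarity_bar_infty] at h
      rw [← bdry_injective h, infty_mem_disk, infty_mem_disk]
      rfl
    | coe w =>
      rw [similarity_bar_coe] at h
      rw [← bdry_injective h, coe_mem_disk, coe_mem_disk]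
      simp only [translate, ← Complex.normSq_eq_norm_sq, Complex.normSq_apply]
      simp
      ring_nf

/-- The image under the inversion in the unit circle. -/
def invert (D : RoundDisk) : RoundDisk := ⟨D.c, D.b, D.a, by rw [mul_comm]; exact D.disc_pos⟩

theorem mapsDisk_invert (D : RoundDisk) : inversion.MapsDisk D D.invert where
  halfSpace p := by
    have h0 := p.sq_pos
    have h1 : (inversion p).sq = p.sq⁻¹ := by
      have h2 : (inversion p).sq = p.sq⁻¹ ^ 2 * (‖p.z‖ ^ 2 + p.t ^ 2) := by
        rw [Hyp3.sq, inversion_z, inversion_t, norm_mul, Complex.norm_real, Real.norm_eq_abs,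
          mul_pow, mul_pow, sq_abs]
        ring
      rw [h2, ← Hyp3.sq]
      field_simp
    rw [mem_halfSpace, mem_halfSpace, h1, inversion_z, invert]
    have h2 : (starRingEnd ℂ D.b * (((p.sq⁻¹ : ℝ) : ℂ) * p.z)).re =
        p.sq⁻¹ * (starRingEnd ℂ D.b * p.z).re := by
      rw [mul_left_comm, Complex.re_ofReal_mul]
    rw [h2]
    have h3 : D.c * p.sq⁻¹ + 2 * (p.sq⁻¹ * (starRingEnd ℂ D.b * p.z).re) + D.a =
        p.sq⁻¹ * (D.a * p.sq + 2 * (starRingEnd ℂ D.b * p.z).re + D.c) := by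
      field_simp
      ring
    dsimp only
    rw [h3, mul_neg_iff]
    have : 0 < p.sq⁻¹ := inv_pos.2 h0
    constructor
    · rintro (h | h)
      · exact h.2
      · linarith
    · exact fun h => Or.inl ⟨this, h⟩
  disk w w' h := by
    induction w using OnePoint.rec with
    | infty =>
      rw [inversion_bar_infty] at h
      rw [← bdry_injective h, infty_mem_disk, coe_mem_disk]
      simp [invert]
    | coe w =>
      by_cases hw : w = 0
      · subst hw
        rw [inversion_bar_zero] at h
        rw [← bdry_injective h, infty_mem_disk, coe_mem_disk]
        simp [invert]
      · rw [inversion_bar_coe hw] at h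
        rw [← bdry_injective h, coe_mem_disk, coe_mem_disk]
        have h0 : 0 < ‖w‖ ^ 2 := by
          have := norm_pos_iff.2 hw
          positivity
        have e : (starRingEnd ℂ w)⁻¹ = (((‖w‖ ^ 2)⁻¹ : ℝ) : ℂ) * w := by
          have := Complex.conj_mul' w
          have h2 : starRingEnd ℂ w ≠ 0 := fun h => hw ((map_eq_zero _).1 h)
          push_cast
          rw [← this]
          field_simp
        have h2 : (starRingEnd ℂ D.b * (starRingEnd ℂ w)⁻¹).re =
            (‖w‖ ^ 2)⁻¹ * (starRingEnd ℂ D.b * w).re := by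
          rw [e, mul_left_comm, Complex.re_ofReal_mul]
        rw [invert]
        dsimp only
        rw [h2, norm_inv, Complex.norm_conj]
        have h3 : D.c * ‖w‖⁻¹ ^ 2 + 2 * ((‖w‖ ^ 2)⁻¹ * (starRingEnd ℂ D.b * w).re) + D.a =
            (‖w‖ ^ 2)⁻¹ * (D.a * ‖w‖ ^ 2 + 2 * (starRingEnd ℂ D.b * w).re + D.c) := by
          field_simp
          ring
        rw [h3, mul_neg_iff]
        have : 0 < (‖w‖ ^ 2)⁻¹ := inv_pos.2 h0
        constructor
        · rintro (h | h)
          · exact h.2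
          · linarith
        · exact fun h => Or.inl ⟨this, h⟩

/-- Euclidean disks are similar to the unit disk. -/
theorem exists_mapsDisk_unit_of_pos (D : RoundDisk) (ha : 0 < D.a) :
    ∃ B : ExtIsom, B.MapsDisk D unit := by
  obtain ⟨r, hr, hr2⟩ : ∃ r : ℝ, 0 < r ∧ D.a ^ 2 * r ^ 2 = ‖D.b‖ ^ 2 - D.a * D.c := by
    have h : 0 < (‖D.b‖ ^ 2 - D.a * D.c) / D.a ^ 2 := by
      have := D.disc_pos
      apply div_pos <;> [linarith; positivity]
    refine ⟨_, Real.sqrt_pos.2 h, ?_⟩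
    rw [Real.sq_sqrt h.le]
    field_simp
  have hr' : ((r⁻¹ : ℝ) : ℂ) ≠ 0 := by exact_mod_cast (inv_pos.2 hr).ne'
  have key : ∀ (z : ℂ) (t : ℝ), D.a * r ^ 2 *
      (‖((r⁻¹ : ℝ) : ℂ) * z + ((D.a * r)⁻¹ : ℝ) * D.b‖ ^ 2 + (r⁻¹ * t) ^ 2 - 1) =
      D.a * (‖z‖ ^ 2 + t ^ 2) + 2 * (starRingEnd ℂ D.b * z).re + D.c := by
    intro z t
    rw [← Complex.normSq_eq_norm_sq, Complex.normSq_apply] at hr2 ⊢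
    rw [← Complex.normSq_eq_norm_sq, Complex.normSq_apply]
    simp only [Complex.add_re, Complex.add_im, Complex.re_ofReal_mul, Complex.im_ofReal_mul]
    simp only [Complex.mul_re, Complex.conj_re, Complex.conj_im]
    field_simp
    linear_combination -hr2
  have hpos : 0 < D.a * r ^ 2 := by positivity
  refine ⟨similarity _ (((D.a * r)⁻¹ : ℝ) * D.b) hr', fun p => ?_, fun w w' h => ?_⟩
  · rw [mem_unit_halfSpace, mem_halfSpace, Hyp3.sq, Hyp3.sq, ← key, similarity_z, similarity_t,
      mul_neg_iff, Complex.norm_real, Real.norm_eq_abs, abs_of_pos (inv_pos.2 hr)]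
    constructor
    · exact fun h => Or.inl ⟨hpos, by linarith⟩
    · rintro (h | h) <;> linarith
  · induction w using OnePoint.rec with
    | infty =>
      rw [similarity_bar_infty] at h
      rw [← bdry_injective h]
      exact iff_of_false infty_notMem_unit_disk (by rw [infty_mem_disk]; exact ha.not_gt)
    | coe w =>
      rw [similarity_bar_coe] at h
      have := key w 0
      rw [mul_zero, zero_pow two_ne_zero, add_zero, add_zero] at this
      rw [← bdry_injective h, coe_mem_unit_disk, coe_mem_disk, ← this, mul_neg_iff,
        ← sq_lt_one_iff₀ (norm_nonneg _)]
      constructor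
      · exact fun h => Or.inl ⟨hpos, by linarith⟩
      · rintro (h | h) <;> linarith

/-- Every round disk can be mapped to the unit disk. -/
theorem exists_mapsDisk_unit (D : RoundDisk) : ∃ B : ExtIsom, B.MapsDisk D unit := by
  by_cases ha : 0 < D.a
  · exact D.exists_mapsDisk_unit_of_pos ha
  -- move a point of the exterior to the origin, then invert
  obtain ⟨v, hv⟩ : ∃ v : ℂ, 0 < (D.translate v).c := by
    have hd := D.disc_pos
    have hb : ∀ s : ℝ, (starRingEnd ℂ D.b * (((s : ℝ) : ℂ) * D.b)).re = s * ‖D.b‖ ^ 2 := by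
      intro s
      rw [mul_left_comm, Complex.re_ofReal_mul, Complex.conj_mul']
      norm_cast
    rcases (not_lt.1 ha).lt_or_eq with h | h
    · refine ⟨((D.a⁻¹ : ℝ) : ℂ) * D.b, ?_⟩
      have e : (D.translate (((D.a⁻¹ : ℝ) : ℂ) * D.b)).c = (D.a * D.c - ‖D.b‖ ^ 2) / D.a := by
        simp only [translate, norm_mul, Complex.norm_real, Real.norm_eq_abs, mul_pow, sq_abs]
        rw [hb]
        have hane := h.ne
        field_simp
        ring
      rw [e]
      exact div_pos_of_neg_of_neg (by linarith) h
    · rw [h, zero_mul] at hd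
      refine ⟨(((D.c - 1) / (2 * ‖D.b‖ ^ 2) : ℝ) : ℂ) * D.b, ?_⟩
      have e : (D.translate ((((D.c - 1) / (2 * ‖D.b‖ ^ 2) : ℝ) : ℂ) * D.b)).c = 1 := by
        simp only [translate, h]
        rw [hb]
        have hd' : ‖D.b‖ ≠ 0 := fun h => by simp [h] at hd
        field_simp
        ring
      rw [e]
      exact one_pos
  obtain ⟨B, hB⟩ := (D.translate v).invert.exists_mapsDisk_unit_of_pos hv
  exact ⟨_, ((D.mapsDisk_translate v).trans (mapsDisk_invert _)).trans hB⟩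

end RoundDisk

/-! ### Embeddedness -/

/-- The preimage of the unit half-space under an isometry, and its ideal points, are given by a
quadratic inequality of the same shape. -/
theorem ExtIsom.exists_preimage_unit (T : ExtIsom) : ∃ (a : ℝ) (b : ℂ) (c : ℝ),
    (∀ q, (T q).sq < 1 ↔ a * q.sq + 2 * (starRingEnd ℂ b * q.z).re + c < 0) ∧
    ∀ w w' : ℂ, T.bar (bdry w) = bdry w' →
      (‖w'‖ < 1 ↔ a * ‖w‖ ^ 2 + 2 * (starRingEnd ℂ b * w).re + c < 0) := by
  -- the unit half-space consists of the points that are closer to `(0, 1/2)` than to `(0, 2)`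
  obtain ⟨X, hX⟩ : ∃ X, T X = ⟨0, 2, two_pos⟩ := ⟨_, T.apply_symm_apply _⟩
  obtain ⟨Y, hY⟩ : ∃ Y, T Y = ⟨0, 2⁻¹, by norm_num⟩ := ⟨_, T.apply_symm_apply _⟩
  have hXt := X.t_pos
  have hYt := Y.t_pos
  refine ⟨Y.t⁻¹ - X.t⁻¹, ((X.t⁻¹ : ℝ) : ℂ) * X.z - ((Y.t⁻¹ : ℝ) : ℂ) * Y.z,
    Y.sq / Y.t - X.sq / X.t, fun q => ?_, fun w w' h => ?_⟩
  · have hq := q.t_pos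
    have hTq := (T q).t_pos
    have h1 := Hyp3.cosh_dist (T q) (T X)
    have h2 := Hyp3.cosh_dist (T q) (T Y)
    rw [T.dist_eq, Hyp3.cosh_dist, hX] at h1
    rw [T.dist_eq, Hyp3.cosh_dist, hY] at h2
    have e : (Y.t⁻¹ - X.t⁻¹) * q.sq +
        2 * (starRingEnd ℂ (((X.t⁻¹ : ℝ) : ℂ) * X.z - ((Y.t⁻¹ : ℝ) : ℂ) * Y.z) * q.z).re +
        (Y.sq / Y.t - X.sq / X.t) = 2 * q.t *
        ((1 + (‖q.z - Y.z‖ ^ 2 + (q.t - Y.t) ^ 2) / (2 * q.t * Y.t)) -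
          (1 + (‖q.z - X.z‖ ^ 2 + (q.t - X.t) ^ 2) / (2 * q.t * X.t))) := by
      simp only [Hyp3.sq, ← Complex.normSq_eq_norm_sq, Complex.normSq_apply, Complex.sub_re,
        Complex.sub_im, map_sub, map_mul, Complex.conj_ofReal, sub_mul, mul_assoc,
        Complex.re_ofReal_mul]
      simp only [Complex.mul_re, Complex.conj_re, Complex.conj_im]
      field_simp
      ring
    have e' : 2 * q.t *
        ((1 + (‖q.z - Y.z‖ ^ 2 + (q.t - Y.t) ^ 2) / (2 * q.t * Y.t)) -
          (1 + (‖q.z - X.z‖ ^ 2 + (q.t - X.t) ^ 2) / (2 * q.t * X.t))) =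
        3 / 2 * (q.t / (T q).t) * ((T q).sq - 1) := by
      rw [h1, h2, Hyp3.sq]
      simp only [sub_zero]
      field_simp
      ring
    rw [e, e', mul_neg_iff]
    have : 0 < 3 / 2 * (q.t / (T q).t) := by positivity
    constructor
    · exact fun h => Or.inl ⟨this, by linarith⟩
    · rintro (h | h) <;> linarith
  · obtain ⟨k, hk, -, hh⟩ := T.exists_horo_eq h
    have h1 := hh X
    have h2 := hh Y
    rw [hX, horo, horo] at h1
    rw [hY, horo, horo] at h2
    have e : (Y.t⁻¹ - X.t⁻¹) * ‖w‖ ^ 2 +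
        2 * (starRingEnd ℂ (((X.t⁻¹ : ℝ) : ℂ) * X.z - ((Y.t⁻¹ : ℝ) : ℂ) * Y.z) * w).re +
        (Y.sq / Y.t - X.sq / X.t) =
        2 * ((‖w - Y.z‖ ^ 2 + Y.t ^ 2) / (2 * Y.t) - (‖w - X.z‖ ^ 2 + X.t ^ 2) / (2 * X.t)) := by
      simp only [Hyp3.sq, ← Complex.normSq_eq_norm_sq, Complex.normSq_apply, Complex.sub_re,
        Complex.sub_im, map_sub, map_mul, Complex.conj_ofReal, sub_mul, mul_assoc,
        Complex.re_ofReal_mul]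
      simp only [Complex.mul_re, Complex.conj_re, Complex.conj_im]
      field_simp
      ring
    have e' : 3 / 4 * (‖w'‖ ^ 2 - 1) = k *
        ((‖w - Y.z‖ ^ 2 + Y.t ^ 2) / (2 * Y.t) - (‖w - X.z‖ ^ 2 + X.t ^ 2) / (2 * X.t)) := by
      rw [mul_sub k, ← h1, ← h2]
      simp only [sub_zero]
      field_simp
      ring
    rw [e, ← sq_lt_one_iff₀ (norm_nonneg w')]
    constructor
    · intro h
      by_contra! hc
      have := mul_nonneg hk.le (by linarith : 0 ≤
        (‖w - Y.z‖ ^ 2 + Y.t ^ 2) / (2 * Y.t) - (‖w - X.z‖ ^ 2 + X.t ^ 2) / (2 * X.t))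
      linarith
    · intro h
      have := mul_neg_of_pos_of_neg hk (by linarith :
        (‖w - Y.z‖ ^ 2 + Y.t ^ 2) / (2 * Y.t) - (‖w - X.z‖ ^ 2 + X.t ^ 2) / (2 * X.t) < 0)
      linarith

theorem exists_unit_re_nonpos (α β : ℂ) :
    ∃ u : ℂ, ‖u‖ = 1 ∧ (starRingEnd ℂ α * u).re ≤ 0 ∧ (starRingEnd ℂ β * u).re ≤ 0 := by
  -- a unit vector orthogonal to `α`
  obtain ⟨u, hu, h⟩ : ∃ u : ℂ, ‖u‖ = 1 ∧ (starRingEnd ℂ α * u).re = 0 := by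
    by_cases hα : α = 0
    · exact ⟨1, by simp, by simp [hα]⟩
    · have h0 : ‖α‖ ≠ 0 := norm_ne_zero_iff.2 hα
      refine ⟨((‖α‖⁻¹ : ℝ) : ℂ) * (Complex.I * α), ?_, ?_⟩
      · rw [norm_mul, Complex.norm_real, norm_mul, Complex.norm_I, one_mul, norm_inv, norm_norm,
          inv_mul_cancel₀ h0]
      · rw [mul_left_comm, Complex.re_ofReal_mul]
        simp
        right
        ring
  rcases le_total (starRingEnd ℂ β * u).re 0 with h' | h'
  · exact ⟨u, hu, h.le, h'⟩
  · exact ⟨-u, by rwa [norm_neg], by simp only [mul_neg, Complex.neg_re]; linarith,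
      by simp only [mul_neg, Complex.neg_re]; linarith⟩

/-- In coordinates, the geodesic ray that starts at `(w - t u, t)` in the horizontal direction `u` and,
for a unit vector `u`, ends at the ideal point `w`. The parameter `s ∈ [0, 1)` is the horizontal
displacement divided by `t`. -/
def ray (w u : ℂ) (t s : ℝ) : ℂ × ℝ := (w - t * u + (t * s : ℝ) * u, t * √(1 - s ^ 2))

/-- If the direction `u` at `(z, t)` does not point out of a half-space that contains this point,
then the geodesic rays in direction `u` from nearby points at the same height stay in the
half-space, uniformly up to the ideal end point. -/
theorem eventually_ray_mem {a c t : ℝ} {b z u : ℂ} (ht : 0 < t) (hu : ‖u‖ = 1)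
    (hp : a * (‖z‖ ^ 2 + t ^ 2) + 2 * (starRingEnd ℂ b * z).re + c < 0)
    (hd : (starRingEnd ℂ (a * z + b) * u).re ≤ 0) :
    ∀ᶠ w in 𝓝 (z + t * u), ∀ s ∈ Icc (0 : ℝ) 1,
      a * (‖(ray w u t s).1‖ ^ 2 + (ray w u t s).2 ^ 2) +
        2 * (starRingEnd ℂ b * (ray w u t s).1).re + c < 0 := by
  have hcont : Continuous fun w : ℂ => a * (‖w - t * u‖ ^ 2 + t ^ 2) +
      2 * (starRingEnd ℂ b * (w - t * u)).re + c +
      2 * t * max 0 (starRingEnd ℂ (a * (w - t * u) + b) * u).re := by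
    have h1 : Continuous fun w : ℂ => (starRingEnd ℂ b * (w - t * u)).re :=
      Complex.continuous_re.comp (by fun_prop)
    have h2 : Continuous fun w : ℂ => (starRingEnd ℂ (a * (w - t * u) + b) * u).re :=
      Complex.continuous_re.comp
        ((Complex.continuous_conj.comp (by fun_prop)).mul continuous_const)
    fun_prop
  have hlim := hcont.tendsto (z + t * u)
  rw [add_sub_cancel_right, max_eq_left hd, mul_zero, add_zero] at hlim
  filter_upwards [hlim.eventually_lt_const hp] with w hw s hs
  set z' := w - t * u
  have hs2 : 0 ≤ 1 - s ^ 2 := by nlinarith [hs.1, hs.2]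
  have hu2 : u.re * u.re + u.im * u.im = 1 := by
    rw [← Complex.normSq_apply, Complex.normSq_eq_norm_sq, hu, one_pow]
  have e : a * (‖(ray w u t s).1‖ ^ 2 + (ray w u t s).2 ^ 2) +
      2 * (starRingEnd ℂ b * (ray w u t s).1).re + c =
      a * (‖z'‖ ^ 2 + t ^ 2) + 2 * (starRingEnd ℂ b * z').re + c +
        2 * t * (s * (starRingEnd ℂ (a * z' + b) * u).re) := by
    have e1 : ray w u t s = (z' + (t * s : ℝ) * u, t * √(1 - s ^ 2)) := rfl
    rw [e1]
    dsimp only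
    rw [mul_pow, Real.sq_sqrt hs2, ← Complex.normSq_eq_norm_sq, ← Complex.normSq_eq_norm_sq,
      Complex.normSq_apply, Complex.normSq_apply]
    simp only [Complex.add_re, Complex.add_im, Complex.re_ofReal_mul, Complex.im_ofReal_mul,
      map_add, map_mul, Complex.conj_ofReal, add_mul, mul_add, mul_assoc]
    simp only [Complex.mul_re, Complex.mul_im, Complex.conj_re, Complex.conj_im,
      Complex.ofReal_re, Complex.ofReal_im]
    linear_combination a * t ^ 2 * s ^ 2 * hu2
  rw [e]
  refine lt_of_le_of_lt ?_ hw
  have : s * (starRingEnd ℂ (a * z' + b) * u).re ≤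
      max 0 (starRingEnd ℂ (a * z' + b) * u).re := by
    rcases le_total 0 (starRingEnd ℂ (a * z' + b) * u).re with h | h
    · exact (mul_le_of_le_one_left h hs.2).trans (le_max_right _ _)
    · exact (mul_nonpos_of_nonneg_of_nonpos hs.1 h).trans (le_max_left _ _)
  gcongr

section

variable {N : Type*} [TopologicalSpace N] [T2Space N] [CompactSpace N]
  [ChartedSpace (EuclideanHalfSpace 3) N] {X : Type*} [EMetricSpace X]
  {K : HypConeManifold N X} {φ : Sphere → N}

/-- Two points of a local isometry into a hyperbolic manifold with the same image differ by an
isometry of hyperbolic space under which the map is locally invariant. -/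
theorem exists_extIsom_of_eq {F : Hyp3 → X} {p q : Hyp3} (hp : IsometricAt F p)
    (hq : IsometricAt F q) (hX : LocallyModelled Hyp3 (F p)) (h : F p = F q) :
    ∃ T : ExtIsom, T p = q ∧ ∀ᶠ x in 𝓝 p, F x = F (T x) := by
  obtain ⟨k, hk⟩ := locallyModelled_iff.1 hX
  obtain ⟨T₁, hT₁⟩ := (hk.1.comp hp).exists_extIsom
  obtain ⟨T₂, hT₂⟩ := ((h ▸ hk.1 : IsometricAt k (F q)).comp hq).exists_extIsom
  have hTp : T₁.trans T₂.symm p = q := by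
    rw [ExtIsom.trans_apply, ← hT₁.self_of_nhds, h, hT₂.self_of_nhds, ExtIsom.symm_apply_apply]
  have hlim : Tendsto (T₁.trans T₂.symm) (𝓝 p) (𝓝 q) := by
    have := (T₁.trans T₂.symm).continuous.tendsto p
    rwa [hTp] at this
  refine ⟨_, hTp, ?_⟩
  have h1 : Tendsto (fun x => (F x, F (T₁.trans T₂.symm x))) (𝓝 p) (𝓝 (F p, F p)) := by
    refine hp.continuousAt.tendsto.prodMk_nhds ?_
    have := hq.continuousAt.tendsto.comp hlim
    rwa [← h] at this
  filter_upwards [h1.eventually hk.1.eventually_eq_of_eq, hT₁, hlim.eventually hT₂] with x h1 h2 h3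
  apply h1
  rw [h2, h3, ExtIsom.trans_apply, ExtIsom.apply_symm_apply]

theorem exists_bar_bdry_coe_of_frequently {T : ExtIsom} {w : ℂ}
    (h : ∃ᶠ q in idealNhds w, (T q).sq < 1) : ∃ w' : ℂ, T.bar (bdry w) = bdry w' := by
  obtain ⟨w', hw'⟩ := T.exists_bar_bdry w
  induction w' using OnePoint.rec with
  | coe w' => exact ⟨w', hw'⟩
  | infty =>
    exfalso
    have hc : IsCompact (Metric.closedBall (0 : ℂ) 1 ×ˢ Icc (0 : ℝ≥0) 1) :=
      (isCompact_closedBall _ _).prod isCompact_Icc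
    have hopen := (OnePoint.isClosed_image_coe.2 ⟨hc.isClosed, hc⟩).isOpen_compl
    have hmem : bdry OnePoint.infty ∈
        ((fun x : ℂ × ℝ≥0 => (x : HypBar)) '' (Metric.closedBall (0 : ℂ) 1 ×ˢ Icc 0 1))ᶜ := by
      rw [bdry_infty]
      simp
    have hev : ∀ᶠ q in idealNhds w, toBar (T q) ∈
        ((fun x : ℂ × ℝ≥0 => (x : HypBar)) '' (Metric.closedBall (0 : ℂ) 1 ×ˢ Icc 0 1))ᶜ :=
      (T.tendsto_idealNhds hw').eventually (tendsto_comap.eventually (hopen.mem_nhds hmem))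
    obtain ⟨q, hq, hq'⟩ := (h.and_eventually hev).exists
    have h0 := (T q).t_pos
    rw [Hyp3.sq] at hq
    refine hq' ⟨((T q).z, ⟨(T q).t, h0.le⟩), ⟨?_, zero_le, ?_⟩, rfl⟩
    · rw [mem_closedBall_zero_iff]
      dsimp only
      nlinarith [norm_nonneg (T q).z]
    · rw [← NNReal.coe_le_coe]
      change (T q).t ≤ 1
      nlinarith [sq_nonneg ‖(T q).z‖]

/-- If the unit disk is embedded, then so is the half-space that extends it. Two points with the
same image differ by an isometry `T` with `F = F ∘ T` near the first point. The first point can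
be joined to an open set of ideal points by geodesic rays that stay in the intersection of the
unit half-space with its preimage under `T`, because two half-spaces that contain a point
have a common direction that does not leave them. In the limit, `φ = φ ∘ T` on an open set of ideal
points, so these are fixed by `T`. -/
theorem IsLocalExtension.injective {F : Hyp3 → X} (hF : IsLocalExtension K φ (euclBall 1) F)
    (hφ : ∀ w w' : ℂ, ‖w‖ < 1 → ‖w'‖ < 1 → φ w = φ w' → w = w') {p q : Hyp3} (hp : p.sq < 1)
    (hq : q.sq < 1) (h : F p = F q) : p = q := by
  have hmem : ∀ {x : Hyp3}, coord x ∈ euclBall 1 ↔ x.sq < 1 := by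
    intro x
    rw [coord_mem_euclBall, one_pow]
  have hiso : ∀ {x : Hyp3}, x.sq < 1 → IsometricAt F x := fun hx => hF.isometricAt _ (hmem.2 hx)
  obtain ⟨T, hTp, hT⟩ := exists_extIsom_of_eq (hiso hp) (hiso hq) (hF.mem p (hmem.2 hp)) h
  obtain ⟨a, b, c, hin, hid⟩ := T.exists_preimage_unit
  obtain ⟨u, hu, hu1, hu2⟩ := exists_unit_re_nonpos p.z (a * p.z + b)
  have ht := p.t_pos
  have hev : ∀ᶠ w in 𝓝 (p.z + p.t * u), ∀ᶠ x in 𝓝 (⟨w - p.t * u, p.t, ht⟩ : Hyp3),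
      F x = F (T x) := by
    have hlim : Tendsto (fun w : ℂ => (⟨w - p.t * u, p.t, ht⟩ : Hyp3)) (𝓝 (p.z + p.t * u))
        (𝓝 p) := by
      rw [isInducing_coord.tendsto_nhds_iff]
      have hc : Continuous fun w : ℂ => (w - p.t * u, p.t) := by fun_prop
      have := hc.tendsto (p.z + p.t * u)
      rwa [add_sub_cancel_right] at this
    exact hlim.eventually (eventually_eventually_nhds.2 hT)
  have hfix : ∀ᶠ w : ℂ in 𝓝 (p.z + p.t * u), T.bar (bdry w) = bdry w := by
    filter_upwards [hev, eventually_ray_mem (a := 1) (b := 0) (c := -1) ht hu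
      (by simpa [Hyp3.sq] using hp) (by simpa using hu1),
      eventually_ray_mem ht hu ((hin p).1 (by rwa [hTp])) hu2] with w hw hr1 hr2
    have hcont : Continuous (ray w u p.t) := by
      unfold ray
      fun_prop
    have hr0 : ray w u p.t 0 = (w - p.t * u, p.t) := by simp [ray]
    have hr1' : ray w u p.t 1 = (w, 0) := by simp [ray]
    have hpos : ∀ s ∈ Ico (0 : ℝ) 1, 0 < (ray w u p.t s).2 := by
      intro s hs
      have : 0 < 1 - s ^ 2 := by nlinarith [hs.1, hs.2]
      exact mul_pos ht (Real.sqrt_pos.2 this)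
    set S := coord ⁻¹' (ray w u p.t '' Ico 0 1) with hS
    have hSc : IsPreconnected S := by
      rw [← isInducing_coord.isPreconnected_image, hS, image_preimage_eq_of_subset]
      · exact isPreconnected_Ico.image _ hcont.continuousOn
      · rintro _ ⟨s, hs, rfl⟩
        rw [range_coord]
        exact hpos s hs
    have hS1 : ∀ x ∈ S, x.sq < 1 ∧ (T x).sq < 1 := by
      rintro x ⟨s, hs, hx⟩
      have h1 := hr1 s (Ico_subset_Icc_self hs)
      have h2 := hr2 s (Ico_subset_Icc_self hs)
      rw [hx] at h1 h2
      refine ⟨?_, (hin x).2 h2⟩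
      have : 1 * (‖x.z‖ ^ 2 + x.t ^ 2) + 2 * (starRingEnd ℂ 0 * x.z).re + -1 < 0 := h1
      simp only [map_zero, zero_mul, Complex.zero_re] at this
      rw [Hyp3.sq]
      linarith
    have heq : ∀ x ∈ S, F x = F (T x) := fun x hx =>
      Eventually.self_of_nhds (p := fun x => F x = F (T x)) <|
        eventuallyEq_of_isometricAt hSc (fun y hy => hiso (hS1 y hy).1)
          (fun y hy => (hiso (hS1 y hy).2).comp (T.isometricAt y))
          (fun y hy => hF.mem y (hmem.2 (hS1 y hy).1))
          (x₀ := ⟨w - p.t * u, p.t, ht⟩) ⟨0, by simp, hr0⟩ hw hx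
    have hfreq : ∃ᶠ x in idealNhds w, x ∈ S := by
      rw [idealNhds_coe, frequently_comap]
      have hl : Tendsto (ray w u p.t) (𝓝[<] 1) (𝓝 (w, 0)) := by
        rw [← hr1']
        exact (hcont.tendsto 1).mono_left nhdsWithin_le_nhds
      refine hl.frequently (Eventually.frequently ?_)
      filter_upwards [Ico_mem_nhdsLT one_pos] with s hs
      exact ⟨⟨_, _, hpos s hs⟩, rfl, s, hs, rfl⟩
    obtain ⟨w', hw'⟩ := exists_bar_bdry_coe_of_frequently (hfreq.mono fun x hx => (hS1 x hx).2)
    have hwd : ‖w‖ < 1 := by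
      have := hr1 1 (by simp)
      rw [hr1'] at this
      simp at this
      linarith
    have hwd' : ‖w'‖ < 1 := by
      have := hr2 1 (by simp)
      rw [hr1'] at this
      exact (hid w w' hw').2 (by simpa using this)
    have hball : ∀ {v : ℂ}, ‖v‖ < 1 → (v, (0 : ℝ)) ∈ euclBall 1 := by
      intro v hv
      rw [mem_euclBall]
      simpa using hv
    have hlim1 := hF.tendsto w (hball hwd)
    have hlim2 := (hF.tendsto w' (hball hwd')).comp (T.tendsto_idealNhds hw')
    rw [hw', hφ w w' hwd hwd' (tendsto_nhds_unique_of_frequently_eq hlim1 hlim2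
      (hfreq.mono fun x hx => congrArg K.incl (heq x hx)))]
  rw [← hTp, T.eq_of_bar_eq_self hfix]

theorem IsometricAt.openIsometricAt {F : Hyp3 → X} {p : Hyp3} (h : IsometricAt F p)
    (hX : LocallyModelled Hyp3 (F p)) : OpenIsometricAt F p := by
  refine ⟨h, ?_⟩
  obtain ⟨k, hk⟩ := locallyModelled_iff.1 hX
  obtain ⟨T, hT⟩ := (hk.1.comp h).exists_extIsom
  obtain ⟨g, hg, -, hgk⟩ := hk.exists_inverse
  have e : F =ᶠ[𝓝 p] fun x => g (T x) := by
    filter_upwards [hT, h.continuousAt.eventually hgk] with x h1 h2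
    rw [← h1, h2]
  have h1 : k (F p) = T p := hT.self_of_nhds
  rw [map_congr e, ← Function.comp_def, ← Filter.map_map, T.map_nhds, ← h1, hg.map_nhds,
    hgk.self_of_nhds]

end

/-! ### Transport between a round disk and the unit disk -/

theorem isEmbedding_bdry : IsEmbedding bdry :=
  (continuous_bdry.isClosedEmbedding bdry_injective).isEmbedding

/-- The action of an extended isometry on the Riemann sphere. -/
def ExtIsom.onSphere (B : ExtIsom) (w : Sphere) : Sphere := (B.exists_bar_bdry w).choose

theorem ExtIsom.bar_bdry (B : ExtIsom) (w : Sphere) : B.bar (bdry w) = bdry (B.onSphere w) :=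
  (B.exists_bar_bdry w).choose_spec

theorem ExtIsom.continuous_onSphere (B : ExtIsom) : Continuous B.onSphere := by
  rw [isEmbedding_bdry.continuous_iff]
  exact (B.bar.continuous.comp continuous_bdry).congr B.bar_bdry

theorem ExtIsom.bar_bdry_symm_onSphere (B : ExtIsom) (u : Sphere) :
    B.bar (bdry (B.symm.onSphere u)) = bdry u := by
  rw [← bar_bdry, bar_symm_bar]

theorem ExtIsom.symm_onSphere_of_bar_eq {B : ExtIsom} {w u : Sphere} (h : B.bar (bdry w) = bdry u) :
    B.symm.onSphere u = w := by
  apply bdry_injective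
  rw [← bar_bdry, ← h, symm_bar_bar]

theorem ExtIsom.MapsDisk.symm_onSphere_mem {B : ExtIsom} {D D' : RoundDisk} (h : B.MapsDisk D D')
    {u : Sphere} (hu : u ∈ D'.disk) : B.symm.onSphere u ∈ D.disk :=
  (h.disk _ u (B.bar_bdry_symm_onSphere u)).1 hu

theorem mem_euclBall_one_iff {x : ℂ} : (x, (0 : ℝ)) ∈ euclBall 1 ↔ (x : Sphere) ∈ RoundDisk.unit.disk := by
  rw [mem_euclBall, RoundDisk.coe_mem_unit_disk, ← sq_lt_one_iff₀ (norm_nonneg x)]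
  simp

theorem coord_mem_euclBall_one_iff {p : Hyp3} :
    coord p ∈ euclBall 1 ↔ p ∈ RoundDisk.unit.halfSpace := by
  rw [coord_mem_euclBall, one_pow, RoundDisk.mem_unit_halfSpace]

variable {N : Type*} [TopologicalSpace N] [T2Space N] [CompactSpace N]
  [ChartedSpace (EuclideanHalfSpace 3) N] {X : Type*} [EMetricSpace X]
  {K : HypConeManifold N X} {φ : Sphere → N} {D : RoundDisk} {F : Hyp3 → X}

theorem IsConformalAt.continuousAt {w : Sphere} (h : IsConformalAt K φ w) : ContinuousAt φ w := by
  obtain ⟨c, -, T, hT⟩ := h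
  have hw := hT.self_of_nhds
  have h1 : ContinuousAt (fun w' => c.symm (T.bar (bdry w'))) w := by
    refine ContinuousAt.comp (g := c.symm) (f := fun w' => T.bar (bdry w')) ?_
      (T.bar.continuous.comp continuous_bdry).continuousAt
    rw [← hw.2]
    exact c.continuousAt_symm (c.map_source hw.1)
  refine h1.congr ?_
  filter_upwards [hT] with w' h'
  rw [← h'.2, c.left_inv h'.1]

theorem HypConeManifold.ProjectiveBoundary.IsRoundDiskMap.isConformalAt {S : K.ProjectiveBoundary}
    (h : S.IsRoundDiskMap D φ) {w : Sphere} (hw : w ∈ D.disk) : IsConformalAt K φ w := by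
  obtain ⟨-, c, hc, -, g, hg⟩ := h w hw
  obtain ⟨T, hT⟩ := exists_poincare_extension g
  refine ⟨c, S.isChart c hc, T, ?_⟩
  filter_upwards [hg] with w' h'
  rwa [hT]

theorem IsConformalAt.comp_onSphere {B : ExtIsom} {u : Sphere}
    (h : IsConformalAt K φ (B.onSphere u)) : IsConformalAt K (fun u => φ (B.onSphere u)) u := by
  obtain ⟨c, hc, T, hT⟩ := h
  refine ⟨c, hc, B.trans T, ?_⟩
  filter_upwards [(B.continuous_onSphere.tendsto u).eventually hT] with u' hu'
  rwa [ExtIsom.trans_bar, B.bar_bdry]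

/-- A local isometry on a half-space that converges to `φ` at the ideal points of the disk is an
extension of `φ`. -/
theorem isHalfSpaceExtension_of_tendsto (hmem : ∀ p ∈ D.halfSpace, F p ∈ K.nonsingular)
    (hiso : ∀ p ∈ D.halfSpace, IsometricAt F p)
    (hlim : ∀ w ∈ D.disk, Tendsto (fun p => K.incl (F p)) (idealNhds w) (𝓝 (φ w)))
    (hφ : ∀ w ∈ D.disk, ContinuousAt φ w) : K.IsHalfSpaceExtension D φ F := by
  let G : HypBar → N := Function.extend toBar (fun p => K.incl (F p))
    (Function.extend bdry φ fun _ => φ OnePoint.infty)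
  have hG1 : ∀ p, G (toBar p) = K.incl (F p) := fun p => toBar_injective.extend_apply _ _ p
  have hG2 : ∀ w, G (bdry w) = φ w := fun w => by
    have : ¬∃ p, toBar p = bdry w := fun ⟨p, hp⟩ => toBar_ne_bdry p w hp
    simp only [G]
    rw [Function.extend_apply' _ _ _ this, bdry_injective.extend_apply]
  refine ⟨hmem, hiso, G, ?_, fun p _ => hG1 p, fun w _ => hG2 w⟩
  refine fun x hx => ContinuousAt.continuousWithinAt ?_
  rcases hx with ⟨p, hp, rfl⟩ | ⟨w, hw, rfl⟩
  · rw [← isOpenEmbedding_toBar.continuousAt_iff]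
    refine ContinuousAt.congr ?_ (Eventually.of_forall fun q => (hG1 q).symm)
    exact K.incl_isEmbedding.continuous.continuousAt.comp (hiso p hp).continuousAt
  · have h1 : Tendsto G (𝓝[range toBar] (bdry w)) (𝓝 (φ w)) := by
      rw [nhdsWithin, ← Filter.map_comap, tendsto_map'_iff]
      exact (hlim w hw).congr fun p => (hG1 p).symm
    have h2 : Tendsto G (𝓝[range bdry] (bdry w)) (𝓝 (φ w)) := by
      rw [← isEmbedding_bdry.map_nhds_eq, tendsto_map'_iff]
      exact Tendsto.congr (fun v => (hG2 v).symm) (hφ w hw)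
    rw [ContinuousAt, hG2]
    refine (h1.sup h2).mono_left ?_
    rw [← nhdsWithin_union, range_toBar, compl_union_self, nhdsWithin_univ]

theorem IsLocalExtension.isHalfSpaceExtension {B : ExtIsom} (hB : B.MapsDisk D RoundDisk.unit)
    (hF : IsLocalExtension K (fun u => φ (B.symm.onSphere u)) (euclBall 1) F)
    (hφ : ∀ w ∈ D.disk, IsConformalAt K φ w) :
    K.IsHalfSpaceExtension D φ (fun p => F (B p)) := by
  have hmem : ∀ p ∈ D.halfSpace, coord (B p) ∈ euclBall 1 := fun p hp =>
    coord_mem_euclBall_one_iff.2 ((hB.halfSpace p).2 hp)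
  refine isHalfSpaceExtension_of_tendsto (fun p hp => hF.mem _ (hmem p hp))
    (fun p hp => (hF.isometricAt _ (hmem p hp)).comp (B.isometricAt p)) (fun w hw => ?_)
    fun w hw => (hφ w hw).continuousAt
  obtain ⟨u, hu⟩ := B.exists_bar_bdry w
  have hud := (hB.disk w u hu).2 hw
  induction u using OnePoint.rec with
  | infty => exact absurd hud RoundDisk.infty_notMem_unit_disk
  | coe u =>
    have := (hF.tendsto u (mem_euclBall_one_iff.2 hud)).comp (B.tendsto_idealNhds hu)
    rwa [ExtIsom.symm_onSphere_of_bar_eq hu] at this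

theorem HypConeManifold.IsHalfSpaceExtension.isLocalExtension {B : ExtIsom}
    (hB : B.MapsDisk D RoundDisk.unit) (hF : K.IsHalfSpaceExtension D φ F) :
    IsLocalExtension K (fun u => φ (B.symm.onSphere u)) (euclBall 1)
      (fun p => F (B.symm p)) := by
  have hmem : ∀ p, coord p ∈ euclBall 1 → B.symm p ∈ D.halfSpace := fun p hp => by
    rw [← hB.halfSpace, ExtIsom.apply_symm_apply]
    exact coord_mem_euclBall_one_iff.1 hp
  refine ⟨fun p hp => hF.mapsTo (hmem p hp), fun p hp => ?_, fun u hu => ?_⟩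
  · exact IsometricAt.comp (hF.isometric _ (hmem p hp)) (B.symm.isometricAt p)
  · obtain ⟨G, hG, hG1, hG2⟩ := hF.extends_disk
    have hw := hB.symm_onSphere_mem (mem_euclBall_one_iff.1 hu)
    have h1 := hG _ (Or.inr ⟨_, hw, rfl⟩)
    rw [ContinuousWithinAt, hG2 _ hw] at h1
    have hev : ∀ᶠ p in idealNhds u, B.symm p ∈ D.halfSpace :=
      (eventually_coord_mem ((isOpen_euclBall 1).mem_nhds hu)).mono hmem
    have h2 : Tendsto (fun p => toBar (B.symm p)) (idealNhds u)
        (𝓝[toBar '' D.halfSpace ∪ bdry '' D.disk] (bdry (B.symm.onSphere u))) := by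
      refine tendsto_nhdsWithin_iff.2 ⟨?_, hev.mono fun p hp => Or.inl ⟨_, hp, rfl⟩⟩
      exact (tendsto_comap (f := toBar)).comp (B.symm.tendsto_idealNhds (B.symm.bar_bdry u))
    exact (h1.comp h2).congr' (hev.mono fun p hp => hG1 _ hp)

theorem HypConeManifold.IsHalfSpaceExtension.injOn (hF : K.IsHalfSpaceExtension D φ F)
    (hφ : InjOn φ D.disk) : InjOn F D.halfSpace := by
  obtain ⟨B, hB⟩ := D.exists_mapsDisk_unit
  intro p hp q hq h
  have hsq : ∀ x ∈ D.halfSpace, (B x).sq < 1 := fun x hx =>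
    RoundDisk.mem_unit_halfSpace.1 ((hB.halfSpace x).2 hx)
  refine B.toFun.injective ((hF.isLocalExtension hB).injective (fun w w' hw hw' he => ?_)
    (hsq p hp) (hsq q hq) ?_)
  · have := hφ (hB.symm_onSphere_mem (RoundDisk.coe_mem_unit_disk.2 hw))
      (hB.symm_onSphere_mem (RoundDisk.coe_mem_unit_disk.2 hw')) he
    have h2 := B.bar_bdry_symm_onSphere w
    rw [this, B.bar_bdry_symm_onSphere] at h2
    exact (OnePoint.coe_injective (bdry_injective h2)).symm
  · rwa [ExtIsom.symm_apply_apply, ExtIsom.symm_apply_apply]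

/-- An injective half-space is an embedding, because it is an open map. -/
theorem HypConeManifold.IsHalfSpaceExtension.isEmbedding (hF : K.IsHalfSpaceExtension D φ F)
    (hinj : InjOn F D.halfSpace) : IsEmbedding (D.halfSpace.domRestrict F) := by
  have hiso : ∀ p ∈ D.halfSpace, IsometricAt F p := hF.isometric
  have hopen := D.isOpen_halfSpace
  refine (IsOpenEmbedding.of_continuous_injective_isOpenMap ?_ ?_ ?_).isEmbedding
  · exact continuous_iff_continuousAt.2 fun p =>
      (hiso p p.2).continuousAt.comp continuous_subtype_val.continuousAt
  · exact fun p q h => Subtype.ext (hinj p.2 q.2 h)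
  · refine isOpenMap_iff_nhds_le.2 fun p => ?_
    have h1 := ((hiso p p.2).openIsometricAt (hF.mapsTo p.2)).2
    rwa [← hopen.isOpenEmbedding_subtypeVal.map_nhds_eq, Filter.map_map] at h1

end ConeManifold

theorem lemma4p3 {N : Type*} [TopologicalSpace N] [T2Space N] [CompactSpace N]
    [ChartedSpace (EuclideanHalfSpace 3) N] {X : Type*} [EMetricSpace X]
    (K : ConeManifold.HypConeManifold N X) (S : K.ProjectiveBoundary)
    (D : ConeManifold.RoundDisk) (φ : ConeManifold.Sphere → N) (hφ : S.IsRoundDiskMap D φ) :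
    (∃ F : ConeManifold.Hyp3 → X, K.IsHalfSpaceExtension D φ F) ∧
      (Set.InjOn φ D.disk → ∀ F : ConeManifold.Hyp3 → X, K.IsHalfSpaceExtension D φ F →
        Topology.IsEmbedding (D.halfSpace.domRestrict F)) := by
  refine ⟨?_, fun hinj F hF => hF.isEmbedding (hF.injOn hinj)⟩
  obtain ⟨B, hB⟩ := D.exists_mapsDisk_unit
  have hconf : ∀ w ∈ D.disk, ConeManifold.IsConformalAt K φ w := fun w hw => hφ.isConformalAt hw
  obtain ⟨F, hF⟩ := ConeManifold.exists_isLocalExtension_unit fun u hu =>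
    (hconf _ (hB.symm_onSphere_mem
      (ConeManifold.RoundDisk.coe_mem_unit_disk.2 hu))).comp_onSphere
  exact ⟨_, hF.isHalfSpaceExtension hB hconf⟩

end
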